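/- Conventions. Manifolds are smooth, Hausdorff and without boundary. For an isometric immersion of a Riemannian manifold $M^m$ into $\mathbb R^q$ with second fundamental form $B$ (that is, $B(X,Y)$ is the normal part of $\overline\nabla_XY$, with $\overline\nabla$ the flat connection of $\mathbb R^q$), put $$F_{\Phi_{(3)},x}(v)=\sum_{i=1}^m\Big(6\,\langle B(v,e_i),B(v,e_i)\rangle-\langle B(v,v),B(e_i,e_i)\rangle\Big),\qquad v\in T_xM,$$ where $e_1,\dots,e_m$ is an orthonormal basis of $T_xM$. The manifold $M$ is called $\Phi_{(3)}$-superstrongly unstable ($\Phi_{(3)}$-SSU) if it admits a smooth isometric immersion into some $\mathbb R^q$ such that $F_{\Phi_{(3)},x}(v)<0$ for every $x\in M$ and every unit vector $v\in T_xM$. Let $(M^m,g)$ and $(N^n,h)$ be compact Riemannian manifolds. The $\Phi_{(3)}$-energy of a smooth map $u:M\to N$ is $$E_{\Phi_{(3)}}(u)=\frac16\int_M\sum_{i,j,k=1}^m h\big(du(e_i),du(e_j)\big)\,h\big(du(e_j),du(e_k)\big)\,h\big(du(e_k),du(e_i)\big)\,dv_g,$$ where $\{e_i\}$ is a local orthonormal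 frame and $dv_g$ is the Riemannian volume. A smooth map $u$ is $\Phi_{(3)}$-harmonic if $\frac{d}{dt}E_{\Phi_{(3)}}(u_t)\big|_{t=0}=0$ for every smooth variation $u_t$, $|t|<\varepsilon$, of $u=u_0$. For a $\Phi_{(3)}$-harmonic map $u$ and smooth vector fields $V,W$ along $u$, let $$I(V,W)=\frac{\partial^2}{\partial s\,\partial t}E_{\Phi_{(3)}}(u_{s,t})\Big|_{s=t=0},$$ where $u_{s,t}$, $|s|,|t|<\varepsilon$, is any smooth two-parameter variation of $u=u_{0,0}$ with $\frac{\partial u_{s,t}}{\partial t}\big|_{s=t=0}=V$ and $\frac{\partial u_{s,t}}{\partial s}\big|_{s=t=0}=W$. A $\Phi_{(3)}$-harmonic map $u$ is stable if $I(V,V)\ge 0$ for every smooth vector field $V$ along $u$. Theorem. Let $(M^m,g)$ be a compact connected $\Phi_{(3)}$-SSU manifold and let $(N^n,h)$ be a compact Riemannian manifold. Then every stable $\Phi_{(3)}$-harmonic map $u:(M^m,g)\to(N^n,h)$ is constant. -/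

import Mathlib

open Set MeasureTheory Bundle Manifold
open scoped ContDiff Topology

noncomputable section

namespace Phi3

section Domain

variable {m : ℕ} {M : Type*} [TopologicalSpace M] [ChartedSpace (EuclideanSpace ℝ (Fin m)) M]
  [RiemannianBundle (fun x : M ↦ TangentSpace (𝓡 m) x)]

/-- The coefficients `g_{ij}(y)` of the Riemannian metric in the chart around `x`, at a point `y` of
the target of that chart: `g_{ij} = g(∂_i, ∂_j)`, where `∂_i` is the image of the `i`-th standard
basis vector under the differential of the inverse chart. -/
def metricMatrix (x : M) (y : EuclideanSpace ℝ (Fin m)) : Matrix (Fin m) (Fin m) ℝ :=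
  Matrix.of fun i j ↦
    inner ℝ
      (mfderiv (𝓡 m) (𝓡 m) (chartAt (EuclideanSpace ℝ (Fin m)) x).symm y
        (EuclideanSpace.single i (1 : ℝ)))
      (mfderiv (𝓡 m) (𝓡 m) (chartAt (EuclideanSpace ℝ (Fin m)) x).symm y
        (EuclideanSpace.single j (1 : ℝ)))

/-- The Riemannian volume on the domain of the chart around `x` (and zero outside of it): the
push-forward of `√(det g_{ij}) dy` on the target of the chart by the inverse chart. -/
def chartVolume [MeasurableSpace M] (x : M) : Measure M :=
  Measure.map (chartAt (EuclideanSpace ℝ (Fin m)) x).symm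
    ((volume.restrict (chartAt (EuclideanSpace ℝ (Fin m)) x).target).withDensity
      fun y ↦ ENNReal.ofReal (Real.sqrt (metricMatrix x y).det))

variable (m M) in
/-- The Riemannian volume measure `dv_g`: the least measure which dominates the volumes of all
charts. Two chart volumes agree on the intersection of the chart domains, by the change of variables
formula, so that on each chart domain this measure is the volume of that chart. -/
def riemannianVolume [MeasurableSpace M] : Measure M :=
  ⨆ x : M, chartVolume (m := m) x

instance (x : M) : FiniteDimensional ℝ (TangentSpace (𝓡 m) x) :=
  inferInstanceAs (FiniteDimensional ℝ (EuclideanSpace ℝ (Fin m)))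

/-! ### Isometric immersions into Euclidean space and their second fundamental form -/

/-- The differential at `x` of a map into a Euclidean space, with values in that space. -/
def euclideanDifferential {q : ℕ} (f : M → EuclideanSpace ℝ (Fin q)) (x : M) :
    TangentSpace (𝓡 m) x →L[ℝ] EuclideanSpace ℝ (Fin q) :=
  mfderiv (𝓡 m) (𝓡 q) f x

/-- Smooth isometric immersions of `M` into `ℝ^q`: the differentials preserve the inner product (and
hence are injective). -/
structure IsIsometricImmersion {q : ℕ} (f : M → EuclideanSpace ℝ (Fin q)) : Prop where
  contMDiff : ContMDiff (𝓡 m) (𝓡 q) ∞ f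
  inner_map : ∀ (x : M) (v w : TangentSpace (𝓡 m) x),
    inner ℝ (euclideanDifferential f x v) (euclideanDifferential f x w) = inner ℝ v w

/-- The second fundamental form `B(v, w)` at `x` of an immersion `f : M → ℝ^q`: the normal part of
`\bar∇_v W`, where `W` is a vector field along `M`, tangent to `M`, with `W(x) = w`. Here `W` is the
field which is constant in the chart `φ` around `x`, so that `\bar∇_v W` is the second derivative of
`f ∘ φ⁻¹` at `φ(x)` in the directions `dφ(v)`, `dφ(w)`. (The normal part does not depend on the
extension `W`, because two extensions differ by a tangential vector.) -/
def secondFundamentalForm {q : ℕ} (f : M → EuclideanSpace ℝ (Fin q)) (x : M)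
    (v w : TangentSpace (𝓡 m) x) : EuclideanSpace ℝ (Fin q) :=
  let φ := chartAt (EuclideanSpace ℝ (Fin m)) x
  let dφ : TangentSpace (𝓡 m) x →L[ℝ] EuclideanSpace ℝ (Fin m) := mfderiv (𝓡 m) (𝓡 m) φ x
  ((euclideanDifferential (m := m) f x).range)ᗮ.starProjection
    (fderiv ℝ (fderiv ℝ (f ∘ φ.symm)) (φ x) (dφ v) (dφ w))

/-- `F_{Φ₍₃₎,x}(v) = ∑ᵢ (6 ⟨B(v, eᵢ), B(v, eᵢ)⟩ - ⟨B(v, v), B(eᵢ, eᵢ)⟩)` for an orthonormal basis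
`e₁, …, e_m` of the tangent space at `x`. -/
def ssuFunctional {q : ℕ} (f : M → EuclideanSpace ℝ (Fin q)) (x : M)
    (e : OrthonormalBasis (Fin m) ℝ (TangentSpace (𝓡 m) x)) (v : TangentSpace (𝓡 m) x) : ℝ :=
  ∑ i, (6 * inner ℝ (secondFundamentalForm f x v (e i)) (secondFundamentalForm f x v (e i))
    - inner ℝ (secondFundamentalForm f x v v) (secondFundamentalForm f x (e i) (e i)))

variable (m M) in
/-- `Φ₍₃₎`-superstrongly unstable Riemannian manifolds. (The functional does not depend on the
orthonormal basis.) -/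
def IsPhi3SSU : Prop :=
  ∃ (q : ℕ) (f : M → EuclideanSpace ℝ (Fin q)), IsIsometricImmersion (m := m) f ∧
    ∀ (x : M) (e : OrthonormalBasis (Fin m) ℝ (TangentSpace (𝓡 m) x)) (v : TangentSpace (𝓡 m) x),
      ‖v‖ = 1 → ssuFunctional f x e v < 0

end Domain

section Maps

variable {m n : ℕ}
  {M : Type*} [TopologicalSpace M] [ChartedSpace (EuclideanSpace ℝ (Fin m)) M]
  [RiemannianBundle (fun x : M ↦ TangentSpace (𝓡 m) x)]
  {N : Type*} [TopologicalSpace N] [ChartedSpace (EuclideanSpace ℝ (Fin n)) N]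
  [RiemannianBundle (fun y : N ↦ TangentSpace (𝓡 n) y)]

variable (m n) in
/-- The `Φ₍₃₎`-energy density
`(1/6) ∑_{i,j,k} h(du(eᵢ), du(eⱼ)) h(du(eⱼ), du(e_k)) h(du(e_k), du(eᵢ))` of `u` at `x`, where `(eᵢ)`
is an orthonormal basis of the tangent space at `x` (the value does not depend on it). -/
def energyDensity (u : M → N) (x : M) : ℝ :=
  let e := stdOrthonormalBasis ℝ (TangentSpace (𝓡 m) x)
  let G := fun i j ↦ inner ℝ (mfderiv (𝓡 m) (𝓡 n) u x (e i)) (mfderiv (𝓡 m) (𝓡 n) u x (e j))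
  (1 / 6 : ℝ) * ∑ i, ∑ j, ∑ k, G i j * G j k * G k i

variable (m n) in
/-- The `Φ₍₃₎`-energy of `u : M → N`. -/
def energy [MeasurableSpace M] (u : M → N) : ℝ :=
  ∫ x, energyDensity m n u x ∂(riemannianVolume m M)

variable (m n) in
/-- `U : (-ε, ε) × M → N` is a smooth one-parameter variation of `u`. On a compact manifold `M` every
variation is compactly supported. -/
structure IsVariation (u : M → N) (ε : ℝ) (U : ℝ → M → N) : Prop where
  pos : 0 < ε
  contMDiffOn : ContMDiffOn (𝓘(ℝ, ℝ).prod (𝓡 m)) (𝓡 n) ∞ (fun p : ℝ × M ↦ U p.1 p.2)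
    (Ioo (-ε) ε ×ˢ univ)
  init : ∀ x, U 0 x = u x

variable (m n) in
/-- `Ψ : (-ε, ε) × (-ε, ε) × M → N` is a smooth two-parameter variation of `u`. -/
structure IsTwoParameterVariation (u : M → N) (ε : ℝ) (Ψ : ℝ → ℝ → M → N) : Prop where
  pos : 0 < ε
  contMDiffOn : ContMDiffOn (𝓘(ℝ, ℝ).prod (𝓘(ℝ, ℝ).prod (𝓡 m))) (𝓡 n) ∞
    (fun p : ℝ × ℝ × M ↦ Ψ p.1 p.2.1 p.2.2) (Ioo (-ε) ε ×ˢ Ioo (-ε) ε ×ˢ univ)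
  init : ∀ x, Ψ 0 0 x = u x

variable (n) in
/-- The variation field `V(x) = dΨ(∂/∂t)` at `s = t = 0`. -/
def variationFieldT (Ψ : ℝ → ℝ → M → N) (x : M) : TangentSpace (𝓡 n) (Ψ 0 0 x) :=
  mfderiv 𝓘(ℝ, ℝ) (𝓡 n) (fun t : ℝ ↦ Ψ 0 t x) 0 (1 : ℝ)

variable (n) in
/-- The variation field `W(x) = dΨ(∂/∂s)` at `s = t = 0`. -/
def variationFieldS (Ψ : ℝ → ℝ → M → N) (x : M) : TangentSpace (𝓡 n) (Ψ 0 0 x) :=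
  mfderiv 𝓘(ℝ, ℝ) (𝓡 n) (fun s : ℝ ↦ Ψ s 0 x) 0 (1 : ℝ)

variable (m n) in
/-- The second variation `∂²/∂s∂t E(Ψ_{s,t})` at `s = t = 0`. For a critical point of the energy it
depends only on the two variation fields `V`, `W` of `Ψ` and is the index form `I(V, W)`. -/
def secondVariation [MeasurableSpace M] (Ψ : ℝ → ℝ → M → N) : ℝ :=
  deriv (fun s : ℝ ↦ deriv (fun t : ℝ ↦ energy m n (Ψ s t)) 0) 0

variable (m n) in
/-- `Φ₍₃₎`-harmonic maps (on a compact domain): smooth critical points of the `Φ₍₃₎`-energy with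
respect to all smooth variations. -/
def IsPhi3Harmonic [MeasurableSpace M] (u : M → N) : Prop :=
  ContMDiff (𝓡 m) (𝓡 n) ∞ u ∧
    ∀ (ε : ℝ) (U : ℝ → M → N), IsVariation m n u ε U →
      deriv (fun t : ℝ ↦ energy m n (U t)) 0 = 0

variable (m n) in
/-- Stable `Φ₍₃₎`-harmonic maps (on a compact domain): `Φ₍₃₎`-harmonic maps with `I(V, V) ≥ 0` for
all smooth vector fields `V` along `u`, where `I(V, V)` is the second variation of the energy along a
two-parameter variation both of whose variation fields are `V`. -/
def IsStablePhi3Harmonic [MeasurableSpace M] (u : M → N) : Prop :=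
  IsPhi3Harmonic m n u ∧
    ∀ (ε : ℝ) (Ψ : ℝ → ℝ → M → N), IsTwoParameterVariation m n u ε Ψ →
      (∀ x, variationFieldT n Ψ x = variationFieldS n Ψ x) → 0 ≤ secondVariation m n Ψ

end Maps

end Phi3

end

/-! # Stable `Φ₍₃₎`-harmonic maps from superstrongly unstable manifolds are constant

Let `f : M → ℝ^q` be an isometric immersion with `F_x(v) < 0`, and let `u : M → N` be stable. The map
`u` is varied by reparametrization of the domain: for a fixed vector `ν` of `ℝ^q`, the tangential part
`ξ` of `ν` is a vector field on `M`, and the variation is `u ∘ ψ_t⁻¹`, where `ψ_t` are diffeomorphisms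
of `M` with velocity `ξ` at `t = 0`. Averaging the second variations over an orthonormal basis of
directions `ν` produces an integrand which is bounded by `∑ λᵢ³ F_x(eᵢ)`, where `e` is an orthonormal
eigenbasis of the pullback `u^*h` and `λᵢ ≥ 0` are its eigenvalues. Stability says that the integral is
nonnegative, so that all `λᵢ` vanish, `du = 0`, and `u` is constant.

*Energy along the variation.* By the change of variables formula, `E(u ∘ ψ_t⁻¹)` is the energy of `u`
with respect to the metric induced by `f ∘ ψ_t` (`energy_comp_symm`). In an orthonormal basis of `T_xM`
its integrand is the function `volDensity G H = (1/6) tr((G⁻¹H)³) √det G`, where `H` is the Gram matrix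
of `du` and `G` is that of `d(f ∘ ψ_t)`. Thus no connection on `N` and no derivative of `du` is needed:
the `t`-derivatives at `G = 1` are the polynomials `firstVar` and `secondVar`
(`hasDerivAt_energyIntegrand`).

*Diffeomorphisms without flows.* Every smooth tangential field is the velocity of a family of
diffeomorphisms (`isVelocity_of_tangential`): a partition of unity reduces this to fields with compact
support in a chart, where `z ↦ z + t Y(z)` works for small `t`, and the families are composed. The
acceleration `η` of `f ∘ ψ_t` depends on the family, but its normal part is the second fundamental form
`B(ξ, ξ)`. The tangential part of `η` is again a velocity, so that its contribution to the second
variation is a first variation of the energy, which vanishes for a harmonic map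
(`DiffeoFamily.integral_deriv_eq_zero`).

*The trace.* The Gauss and Weingarten equations express the remaining terms through `B`
(`secondVar_add_firstVar_sub`). Summing over `ν` gives
`∑ᵢⱼ ((4 λᵢ² λⱼ + 2 λᵢ³) |B(eᵢ, eⱼ)|² - λᵢ³ ⟨B(eᵢ, eᵢ), B(eⱼ, eⱼ)⟩)` (`sum_secondVar_add_firstVar`), and
`λᵢ² λⱼ + λⱼ² λᵢ ≤ λᵢ³ + λⱼ³` bounds this by `∑ λᵢ³ F_x(eᵢ)` (`trace_formula_le`).
-/

noncomputable section

namespace Phi3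

/-! ### Matrix calculus for the energy density -/

section MatrixCalculus

open Matrix
open scoped Matrix.Norms.Operator

variable {ι : Type*} [Fintype ι] [DecidableEq ι]

/-- The `Φ₍₃₎`-energy density `(1/6) tr((G⁻¹ H)³)` of a bilinear form with matrix `H`, measured with
respect to an inner product with matrix `G`. -/
def density (G H : Matrix ι ι ℝ) : ℝ := (1 / 6 : ℝ) * trace (G⁻¹ * H * (G⁻¹ * H) * (G⁻¹ * H))

/-- The energy density is invariant under a change of basis. -/
lemma density_transform (A G H : Matrix ι ι ℝ) (hA : IsUnit A.det) :
    density (Aᵀ * G * A) (Aᵀ * H * A) = density G H := by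
  have hAt : IsUnit Aᵀ.det := by rwa [det_transpose]
  have h : (Aᵀ * G * A)⁻¹ * (Aᵀ * H * A) = A⁻¹ * (G⁻¹ * H) * A := by
    rw [Matrix.mul_inv_rev, Matrix.mul_inv_rev]
    calc A⁻¹ * (G⁻¹ * Aᵀ⁻¹) * (Aᵀ * H * A) = A⁻¹ * (G⁻¹ * (Aᵀ⁻¹ * Aᵀ) * H) * A := by
          simp only [mul_assoc]
      _ = _ := by rw [nonsing_inv_mul _ hAt, mul_one]
  have h3 : ∀ X : Matrix ι ι ℝ, A⁻¹ * X * A * (A⁻¹ * X * A) * (A⁻¹ * X * A)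
      = A⁻¹ * (X * X * X * A) := by
    intro X
    calc A⁻¹ * X * A * (A⁻¹ * X * A) * (A⁻¹ * X * A)
        = A⁻¹ * X * (A * A⁻¹) * X * (A * A⁻¹) * X * A := by simp only [mul_assoc]
      _ = _ := by rw [mul_nonsing_inv _ hA]; simp only [mul_assoc, mul_one]
  rw [density, density, h, h3, trace_mul_comm, mul_assoc, mul_nonsing_inv _ hA, mul_one]

/-- Jacobi's formula. -/
lemma hasDerivAt_det {G : ℝ → Matrix ι ι ℝ} {G' : Matrix ι ι ℝ} {t : ℝ}
    (h : HasDerivAt G G' t) :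
    HasDerivAt (fun s ↦ (G s).det) (trace (adjugate (G t) * G')) t := by
  have hij : ∀ i j, HasDerivAt (fun s ↦ G s i j) (G' i j) t := fun i j ↦
    hasDerivAt_pi.1 (hasDerivAt_pi.1 h i) j
  have h1 : HasDerivAt (fun s ↦ ∑ σ : Equiv.Perm ι, (Equiv.Perm.sign σ : ℤ) • ∏ i, G s (σ i) i)
      (∑ σ : Equiv.Perm ι, (Equiv.Perm.sign σ : ℤ) •
        ∑ i, (∏ j ∈ Finset.univ.erase i, G t (σ j) j) • G' (σ i) i) t := by
    refine HasDerivAt.fun_sum fun σ _ ↦ ?_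
    have := HasDerivAt.fun_finsetProd (u := Finset.univ) fun i (_ : i ∈ Finset.univ) ↦ hij (σ i) i
    simpa only [zsmul_eq_mul] using this.const_mul ((Equiv.Perm.sign σ : ℤ) : ℝ)
  have h2 : trace (adjugate (G t) * G') = ∑ σ : Equiv.Perm ι, (Equiv.Perm.sign σ : ℤ) •
        ∑ i, (∏ j ∈ Finset.univ.erase i, G t (σ j) j) • G' (σ i) i := by
    have : ∀ i, (adjugate (G t) * G') i i = ((G t).updateCol i (fun k ↦ G' k i)).det := by
      intro i
      rw [← cramer_apply, cramer_eq_adjugate_mulVec]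
      rfl
    simp only [trace, diag, this, det_apply, Finset.smul_sum]
    rw [Finset.sum_comm]
    refine Finset.sum_congr rfl fun σ _ ↦ Finset.sum_congr rfl fun i _ ↦ ?_
    rw [← Finset.mul_prod_erase _ _ (Finset.mem_univ i)]
    simp only [updateCol_self, smul_eq_mul, Units.smul_def]
    congr 1
    rw [mul_comm]
    congr 1
    exact Finset.prod_congr rfl fun j hj ↦ by rw [updateCol_ne (Finset.ne_of_mem_erase hj)]
  rw [h2]
  simpa only [det_apply, Units.smul_def] using h1

omit [DecidableEq ι] in
lemma hasDerivAt_trace {G : ℝ → Matrix ι ι ℝ} {G' : Matrix ι ι ℝ} {t : ℝ}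
    (h : HasDerivAt G G' t) : HasDerivAt (fun s ↦ trace (G s)) (trace G') t :=
  (traceLinearMap ι ℝ ℝ).toContinuousLinearMap.hasFDerivAt.comp_hasDerivAt t h

lemma hasDerivAt_inv {G : ℝ → Matrix ι ι ℝ} {G' : Matrix ι ι ℝ} {t : ℝ}
    (h : HasDerivAt G G' t) (hG : IsUnit (G t).det) :
    HasDerivAt (fun s ↦ (G s)⁻¹) (-((G t)⁻¹ * G' * (G t)⁻¹)) t := by
  obtain ⟨U, hU⟩ := (isUnit_iff_isUnit_det _).2 hG
  have h1 := (hasFDerivAt_ringInverse (𝕜 := ℝ) U)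
  rw [hU] at h1
  have h2 := h1.comp_hasDerivAt t h
  have h3 : (↑U⁻¹ : Matrix ι ι ℝ) = (G t)⁻¹ := by rw [← hU, coe_units_inv]
  simp only [nonsing_inv_eq_ringInverse] at h3 ⊢
  refine HasDerivAt.congr_deriv h2 ?_
  simp [h3]

/-- The integrand of the energy with respect to a background volume: the energy density times the
volume density `√(det G)` of the inner product `G`. -/
def volDensity (G H : Matrix ι ι ℝ) : ℝ := density G H * √(G.det)

/-- The derivative of `volDensity` at `G = 1` in the direction `P`. -/
def firstVar (H P : Matrix ι ι ℝ) : ℝ :=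
  -(1 / 2) * trace (P * (H * H * H)) + 1 / 12 * trace (H * H * H) * trace P

/-- The part of the second derivative of `volDensity` at `G = 1` that is quadratic in the velocity
`P`. -/
def secondVar (H P : Matrix ι ι ℝ) : ℝ :=
  trace (H * P * H * P * H) + trace (P * P * (H * H * H))
    - 1 / 2 * trace (P * (H * H * H)) * trace P
    + 1 / 6 * trace (H * H * H) * (1 / 4 * trace P ^ 2 - 1 / 2 * trace (P * P))

/-- At a general inner product `G`, the derivative is the one at `1`, in a basis that is orthonormal
for `G`, times the volume density of `G`. -/
lemma hasDerivAt_volDensity {G : ℝ → Matrix ι ι ℝ} {G' : Matrix ι ι ℝ} {t : ℝ} (H : Matrix ι ι ℝ)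
    (h : HasDerivAt G G' t) (hG : 0 < (G t).det) :
    HasDerivAt (fun s ↦ volDensity (G s) H)
      (√((G t).det) * firstVar ((G t)⁻¹ * H) ((G t)⁻¹ * G')) t := by
  have hu : IsUnit (G t).det := hG.ne'.isUnit
  have hA := (hasDerivAt_inv h hu).mul_const H
  have hd : HasDerivAt (fun s ↦ √((G s).det))
      (√((G t).det) * (1 / 2 * trace ((G t)⁻¹ * G'))) t := by
    have h1 := (hasDerivAt_det h).sqrt hG.ne'
    refine h1.congr_deriv ?_
    have h2 : (G t)⁻¹ = (G t).det⁻¹ • adjugate (G t) := by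
      rw [inv_def, Ring.inverse_eq_inv']
    rw [h2, smul_mul, trace_smul, smul_eq_mul]
    have h3 := Real.sq_sqrt hG.le
    have h4 : √((G t).det) ≠ 0 := (Real.sqrt_pos.2 hG).ne'
    field_simp
    rw [h3]
  have h3 := ((hasDerivAt_trace ((hA.mul hA).mul hA)).const_mul (1 / 6 : ℝ)).mul hd
  refine HasDerivAt.congr_deriv h3 ?_
  simp only [firstVar]
  have e : -((G t)⁻¹ * G' * (G t)⁻¹) * H = -((G t)⁻¹ * G' * ((G t)⁻¹ * H)) := by
    simp only [neg_mul, mul_assoc]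
  simp only [e, Pi.mul_apply]
  generalize (G t)⁻¹ * H = A
  generalize (G t)⁻¹ * G' = K
  have e1 : trace (A * (-(K * A)) * A) = -trace (K * (A * A * A)) := by
    rw [mul_neg, neg_mul, trace_neg, mul_assoc, trace_mul_comm]
    simp only [mul_assoc]
  have e2 : trace (A * A * (-(K * A))) = -trace (K * (A * A * A)) := by
    rw [mul_neg, trace_neg, trace_mul_comm]
    simp only [mul_assoc]
  have e3 : trace (-(K * A) * A * A) = -trace (K * (A * A * A)) := by
    simp only [neg_mul, trace_neg, mul_assoc]
  simp only [add_mul, trace_add, e1, e2, e3]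
  ring

/-- The derivative at `0` of the first derivative of `volDensity` along a curve of inner products
with `G 0 = 1`, velocity `P` and acceleration `Q`. -/
lemma hasDerivAt_deriv_volDensity {G G' : ℝ → Matrix ι ι ℝ} {Q : Matrix ι ι ℝ} (H : Matrix ι ι ℝ)
    (h : HasDerivAt G (G' 0) 0) (h' : HasDerivAt G' Q 0) (h0 : G 0 = 1) :
    HasDerivAt (fun t ↦ √((G t).det) * firstVar ((G t)⁻¹ * H) ((G t)⁻¹ * G' t))
      (secondVar H (G' 0) + firstVar H Q) 0 := by
  have hpos : 0 < (G 0).det := by rw [h0, det_one]; exact one_pos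
  have hi := hasDerivAt_inv h hpos.ne'.isUnit
  have hd : HasDerivAt (fun s ↦ √((G s).det)) (1 / 2 * trace (G' 0)) 0 := by
    have h1 := (hasDerivAt_det h).sqrt hpos.ne'
    refine h1.congr_deriv ?_
    rw [h0, adjugate_one, det_one, Real.sqrt_one, one_mul]
    ring
  have hA := hi.mul_const H
  have hA3 := (hA.mul hA).mul hA
  have hK := hi.mul h'
  have h1 := ((hasDerivAt_trace (hK.mul hA3)).const_mul (-(1 / 2) : ℝ)).add
    (((hasDerivAt_trace hA3).const_mul (1 / 12 : ℝ)).mul (hasDerivAt_trace hK))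
  have h2 := hd.mul h1
  refine HasDerivAt.congr_deriv h2 ?_
  simp only [Pi.mul_apply, Pi.add_apply, h0, inv_one, one_mul, mul_one, det_one, Real.sqrt_one, secondVar,
    firstVar, neg_mul, mul_neg, mul_add, add_mul, trace_add, trace_neg]
  clear h2 h1 hK hA3 hA hd hi h
  generalize G' 0 = P
  have e0 : trace (H * P * H * P * H) = trace (P * (H * P * H * H)) := by
    have := trace_mul_comm H (P * H * P * H)
    simpa only [mul_assoc] using this
  have e1 : trace (P * (H * H * (P * H))) = trace (P * (H * P * H * H)) := by
    have := trace_mul_comm (P * H * H) (P * H)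
    simpa only [mul_assoc] using this
  have e2 : trace (H * (P * H) * H) = trace (P * (H * H * H)) := by
    rw [mul_assoc, trace_mul_comm]
    simp only [mul_assoc]
  have e3 : trace (H * H * (P * H)) = trace (P * (H * H * H)) := by
    rw [trace_mul_comm]
    simp only [mul_assoc]
  have e4 : trace (P * H * H * H) = trace (P * (H * H * H)) := by
    simp only [mul_assoc]
  have e5 : trace (P * (P * H * H * H)) = trace (P * P * (H * H * H)) := by
    simp only [mul_assoc]
  have e6 : P * (H * (P * H) * H) = P * (H * P * H * H) := by simp only [mul_assoc]
  simp only [e0, e1, e2, e3, e4, e5, e6]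
  ring

end MatrixCalculus

/-! ### The energy density in terms of Gram matrices -/

section GramMatrices

open Matrix

variable {ι : Type*} [Fintype ι] [DecidableEq ι]

omit [DecidableEq ι] in
lemma gram_basis_change {V W : Type*} [AddCommGroup V] [Module ℝ V] [NormedAddCommGroup W]
    [InnerProductSpace ℝ W] (L : V →ₗ[ℝ] W) (b : Module.Basis ι ℝ V) (w : ι → V) :
    gram ℝ (fun i ↦ L (w i)) = (b.toMatrix w)ᵀ * gram ℝ (fun i ↦ L (b i)) * b.toMatrix w := by
  ext i j
  have h : ∀ i, L (w i) = ∑ k, b.toMatrix w k i • L (b k) := fun i ↦ by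
    conv_lhs => rw [← b.sum_toMatrix_smul_self w i, map_sum]
    simp
  simp only [gram_apply, h, mul_apply, transpose_apply, sum_inner, inner_sum, inner_smul_left,
    inner_smul_right, Finset.sum_mul, Finset.mul_sum]
  refine Finset.sum_congr rfl fun k _ ↦ Finset.sum_congr rfl fun l _ ↦ ?_
  simp only [conj_trivial]
  ring

lemma isUnit_det_toMatrix {V : Type*} [AddCommGroup V] [Module ℝ V]
    (b w : Module.Basis ι ℝ V) : IsUnit (b.toMatrix w).det := by
  have := b.invertibleToMatrix w
  exact (isUnit_iff_isUnit_det _).1 (isUnit_of_invertible _)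

/-- The energy density of a pair of linear maps does not depend on the basis. -/
lemma density_gram_basis {V W₁ W₂ : Type*} [AddCommGroup V] [Module ℝ V] [NormedAddCommGroup W₁]
    [InnerProductSpace ℝ W₁] [NormedAddCommGroup W₂] [InnerProductSpace ℝ W₂]
    (L : V →ₗ[ℝ] W₁) (K : V →ₗ[ℝ] W₂) (b w : Module.Basis ι ℝ V) :
    density (gram ℝ (fun i ↦ L (w i))) (gram ℝ (fun i ↦ K (w i))) =
      density (gram ℝ (fun i ↦ L (b i))) (gram ℝ (fun i ↦ K (b i))) := by
  rw [gram_basis_change L b w, gram_basis_change K b w,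
    density_transform _ _ _ (isUnit_det_toMatrix b w)]

lemma sqrt_det_gram_basis {V W : Type*} [AddCommGroup V] [Module ℝ V] [NormedAddCommGroup W]
    [InnerProductSpace ℝ W] (L : V →ₗ[ℝ] W) (b w : Module.Basis ι ℝ V) :
    √(gram ℝ (fun i ↦ L (w i))).det = |(b.toMatrix w).det| * √(gram ℝ (fun i ↦ L (b i))).det := by
  rw [gram_basis_change L b w, det_mul, det_mul, det_transpose,
    show ∀ a c : ℝ, a * c * a = a ^ 2 * c from fun a c ↦ by ring,
    Real.sqrt_mul (sq_nonneg _), Real.sqrt_sq_eq_abs]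

lemma det_gram_pos {V W : Type*} [AddCommGroup V] [Module ℝ V] [NormedAddCommGroup W]
    [InnerProductSpace ℝ W] (L : V →ₗ[ℝ] W) (hL : Function.Injective L) (b : Module.Basis ι ℝ V) :
    0 < (gram ℝ (fun i ↦ L (b i))).det :=
  (posDef_gram_of_linearIndependent (b.linearIndependent.map' L (LinearMap.ker_eq_bot.2 hL))).det_pos

end GramMatrices

section EnergyDensity

open Matrix

variable {m n : ℕ}
  {M : Type*} [TopologicalSpace M] [ChartedSpace (EuclideanSpace ℝ (Fin m)) M]
  [RiemannianBundle (fun x : M ↦ TangentSpace (𝓡 m) x)]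
  {N : Type*} [TopologicalSpace N] [ChartedSpace (EuclideanSpace ℝ (Fin n)) N]
  [RiemannianBundle (fun y : N ↦ TangentSpace (𝓡 n) y)]

omit [RiemannianBundle (fun x : M ↦ TangentSpace (𝓡 m) x)] in
lemma finrank_tangentSpace (x : M) : Module.finrank ℝ (TangentSpace (𝓡 m) x) = m :=
  finrank_euclideanSpace_fin (𝕜 := ℝ) (n := m)

lemma energyDensity_eq (u : M → N) (x : M) (b : Module.Basis (Fin m) ℝ (TangentSpace (𝓡 m) x)) :
    energyDensity m n u x =
      density (gram ℝ (fun i ↦ b i)) (gram ℝ (fun i ↦ mfderiv (𝓡 m) (𝓡 n) u x (b i))) := by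
  set e := stdOrthonormalBasis ℝ (TangentSpace (𝓡 m) x) with he
  let σ : Fin (Module.finrank ℝ (TangentSpace (𝓡 m) x)) ≃ Fin m := finCongr (finrank_tangentSpace x)
  let w := e.reindex σ
  have h1 := density_gram_basis (LinearMap.id (R := ℝ) (M := TangentSpace (𝓡 m) x))
    (mfderiv (𝓡 m) (𝓡 n) u x).toLinearMap b w.toBasis
  have h2 : gram ℝ (fun i ↦ w i) = 1 := by
    ext i j
    simp only [gram_apply, orthonormal_iff_ite.1 w.orthonormal, one_apply]
  simp only [LinearMap.id_apply, OrthonormalBasis.coe_toBasis, h2,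
    ContinuousLinearMap.coe_coe] at h1
  rw [← h1, density, energyDensity]
  congr 1
  simp only [inv_one, one_mul, trace, diag, mul_apply, Finset.sum_mul, gram_apply]
  rw [← he]
  rw [← σ.sum_comp]
  refine Finset.sum_congr rfl fun i _ ↦ ?_
  rw [Finset.sum_comm, ← σ.sum_comp]
  refine Finset.sum_congr rfl fun j _ ↦ ?_
  rw [← σ.sum_comp]
  refine Finset.sum_congr rfl fun k _ ↦ ?_
  simp [w]

end EnergyDensity

/-! ### Expressions in charts -/

section Charts

open Matrix

variable {m n q : ℕ}
  {M : Type*} [TopologicalSpace M] [ChartedSpace (EuclideanSpace ℝ (Fin m)) M]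
  {N : Type*} [TopologicalSpace N] [ChartedSpace (EuclideanSpace ℝ (Fin n)) N]

/-- The inverse of the preferred chart around `x`. -/
abbrev chartInv (x : M) : EuclideanSpace ℝ (Fin m) → M :=
  (chartAt (EuclideanSpace ℝ (Fin m)) x).symm

variable (m) in
/-- The standard basis of a tangent space, in the coordinates of the preferred chart at its base
point. -/
def stdBasis (y : M) : Module.Basis (Fin m) ℝ (TangentSpace (𝓡 m) y) :=
  (EuclideanSpace.basisFun (Fin m) ℝ).toBasis

variable [IsManifold (𝓡 m) ∞ M]

/-- The coordinate frame of the chart around `x`, at the point with coordinates `z`. -/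
def chartBasis (x : M) {z : EuclideanSpace ℝ (Fin m)}
    (hz : z ∈ (chartAt (EuclideanSpace ℝ (Fin m)) x).target) :
    Module.Basis (Fin m) ℝ (TangentSpace (𝓡 m) (chartInv x z)) :=
  (EuclideanSpace.basisFun (Fin m) ℝ).toBasis.map
    ((mdifferentiable_chart (I := 𝓡 m) x).symm.mfderiv hz).toLinearEquiv

lemma chartBasis_apply (x : M) {z : EuclideanSpace ℝ (Fin m)}
    (hz : z ∈ (chartAt (EuclideanSpace ℝ (Fin m)) x).target) (i : Fin m) :
    chartBasis x hz i = mfderiv (𝓡 m) (𝓡 m) (chartInv x) z (EuclideanSpace.single i (1 : ℝ)) := by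
  refine (Module.Basis.map_apply _ _ _).trans ?_
  exact congrArg (mfderiv (𝓡 m) (𝓡 m) (chartInv x) z)
    (by simp : (EuclideanSpace.basisFun (Fin m) ℝ).toBasis i = EuclideanSpace.single i (1 : ℝ))

lemma mdifferentiableAt_chartInv (x : M) {z : EuclideanSpace ℝ (Fin m)}
    (hz : z ∈ (chartAt (EuclideanSpace ℝ (Fin m)) x).target) :
    MDifferentiableAt (𝓡 m) (𝓡 m) (chartInv x) z :=
  (mdifferentiable_chart (I := 𝓡 m) x).mdifferentiableAt_symm hz

lemma contMDiffAt_chartInv (x : M) {z : EuclideanSpace ℝ (Fin m)}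
    (hz : z ∈ (chartAt (EuclideanSpace ℝ (Fin m)) x).target) :
    ContMDiffAt (𝓡 m) (𝓡 m) ∞ (chartInv x) z :=
  contMDiffOn_chart_symm.contMDiffAt
    ((chartAt (EuclideanSpace ℝ (Fin m)) x).open_target.mem_nhds hz)

lemma mfderiv_chartBasis {u : M → N} (x : M) {z : EuclideanSpace ℝ (Fin m)}
    (hz : z ∈ (chartAt (EuclideanSpace ℝ (Fin m)) x).target)
    (hu : MDifferentiableAt (𝓡 m) (𝓡 n) u (chartInv x z)) (i : Fin m) :
    mfderiv (𝓡 m) (𝓡 n) u (chartInv x z) (chartBasis x hz i) =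
      mfderiv (𝓡 m) (𝓡 n) (u ∘ chartInv x) z (EuclideanSpace.single i (1 : ℝ)) := by
  rw [chartBasis_apply, mfderiv_comp z hu (mdifferentiableAt_chartInv x hz)]
  rfl

lemma euclideanDifferential_chartInv {g : M → EuclideanSpace ℝ (Fin q)} (x : M)
    {z v : EuclideanSpace ℝ (Fin m)}
    (hz : z ∈ (chartAt (EuclideanSpace ℝ (Fin m)) x).target)
    (hg : MDifferentiableAt (𝓡 m) (𝓡 q) g (chartInv x z)) :
    euclideanDifferential (m := m) g (chartInv x z) (mfderiv (𝓡 m) (𝓡 m) (chartInv x) z v) =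
      fderiv ℝ (g ∘ chartInv x) z v := by
  rw [← mfderiv_eq_fderiv, mfderiv_comp z hg (mdifferentiableAt_chartInv x hz)]
  rfl

lemma euclideanDifferential_chartBasis {g : M → EuclideanSpace ℝ (Fin q)} (x : M)
    {z : EuclideanSpace ℝ (Fin m)}
    (hz : z ∈ (chartAt (EuclideanSpace ℝ (Fin m)) x).target)
    (hg : MDifferentiableAt (𝓡 m) (𝓡 q) g (chartInv x z)) (i : Fin m) :
    euclideanDifferential g (chartInv x z) (chartBasis x hz i) =
      fderiv ℝ (g ∘ chartInv x) z (EuclideanSpace.single i (1 : ℝ)) := by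
  rw [chartBasis_apply, euclideanDifferential_chartInv x hz hg]

/-- The Gram matrix of the differential of a map between Euclidean spaces, in the standard basis. -/
def gramD (F : EuclideanSpace ℝ (Fin m) → EuclideanSpace ℝ (Fin q))
    (z : EuclideanSpace ℝ (Fin m)) : Matrix (Fin m) (Fin m) ℝ :=
  gram ℝ fun i ↦ fderiv ℝ F z (EuclideanSpace.single i (1 : ℝ))

variable [RiemannianBundle (fun x : M ↦ TangentSpace (𝓡 m) x)]

omit [IsManifold (𝓡 m) ∞ M] in
lemma IsIsometricImmersion.injective {f : M → EuclideanSpace ℝ (Fin q)}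
    (hf : IsIsometricImmersion (m := m) f) (x : M) :
    Function.Injective (euclideanDifferential (m := m) f x) := by
  rw [injective_iff_map_eq_zero]
  intro v hv
  have := hf.inner_map x v v
  rw [hv, inner_zero_left] at this
  exact inner_self_eq_zero.1 this.symm

omit [IsManifold (𝓡 m) ∞ M] in
lemma IsIsometricImmersion.mdifferentiableAt {f : M → EuclideanSpace ℝ (Fin q)}
    (hf : IsIsometricImmersion (m := m) f) (x : M) : MDifferentiableAt (𝓡 m) (𝓡 q) f x :=
  hf.contMDiff.mdifferentiableAt (by simp)

lemma metricMatrix_eq {f : M → EuclideanSpace ℝ (Fin q)}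
    (hf : IsIsometricImmersion (m := m) f) (x : M) {z : EuclideanSpace ℝ (Fin m)}
    (hz : z ∈ (chartAt (EuclideanSpace ℝ (Fin m)) x).target) :
    metricMatrix x z = gramD (f ∘ chartInv x) z := by
  ext i j
  rw [gramD, gram_apply, ← euclideanDifferential_chartBasis x hz (hf.mdifferentiableAt _),
    ← euclideanDifferential_chartBasis x hz (hf.mdifferentiableAt _), hf.inner_map,
    chartBasis_apply, chartBasis_apply]
  rfl

lemma fderiv_comp_chartInv_injective {f : M → EuclideanSpace ℝ (Fin q)}
    (hf : IsIsometricImmersion (m := m) f) (x : M) {z : EuclideanSpace ℝ (Fin m)}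
    (hz : z ∈ (chartAt (EuclideanSpace ℝ (Fin m)) x).target) :
    Function.Injective (fderiv ℝ (f ∘ chartInv x) z) := by
  intro v w h
  rw [← euclideanDifferential_chartInv x hz (hf.mdifferentiableAt _),
    ← euclideanDifferential_chartInv x hz (hf.mdifferentiableAt _)] at h
  exact ((mdifferentiable_chart (I := 𝓡 m) x).symm.mfderiv hz).injective (hf.injective _ h)

lemma det_gramD_pos {F : EuclideanSpace ℝ (Fin m) → EuclideanSpace ℝ (Fin q)}
    {z : EuclideanSpace ℝ (Fin m)} (hF : Function.Injective (fderiv ℝ F z)) :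
    0 < (gramD F z).det := by
  have := det_gram_pos (fderiv ℝ F z).toLinearMap hF (EuclideanSpace.basisFun (Fin m) ℝ).toBasis
  simpa [gramD] using this

variable [RiemannianBundle (fun y : N ↦ TangentSpace (𝓡 n) y)]

variable (m n) in
/-- The integrand `(1/6) tr((G⁻¹ H)³) √(det G) / √(det G₀)` at `y` of the energy of `u`, where `G`,
`G₀` and `H` are the matrices of the bilinear forms induced by `g`, `f` and `u`: this is the energy
density of `u` with respect to the metric induced by `g`, times the volume density of this metric
relative to the one induced by `f`. -/
def energyIntegrand (f g : M → EuclideanSpace ℝ (Fin q)) (u : M → N) (y : M) : ℝ :=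
  volDensity (gram ℝ fun i ↦ euclideanDifferential (m := m) g y (stdBasis m y i))
    (gram ℝ fun i ↦ mfderiv (𝓡 m) (𝓡 n) u y (stdBasis m y i)) /
    √(gram ℝ fun i ↦ euclideanDifferential (m := m) f y (stdBasis m y i)).det

variable (m) in
/-- The volume density of the metric induced by `g` relative to the one induced by `f`. -/
def volumeRatio (f g : M → EuclideanSpace ℝ (Fin q)) (y : M) : ℝ :=
  √(gram ℝ fun i ↦ euclideanDifferential (m := m) g y (stdBasis m y i)).det /
    √(gram ℝ fun i ↦ euclideanDifferential (m := m) f y (stdBasis m y i)).det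

omit [IsManifold (𝓡 m) ∞ M]
  [RiemannianBundle (fun x : M ↦ TangentSpace (𝓡 m) x)] in
lemma energyIntegrand_eq (f g : M → EuclideanSpace ℝ (Fin q)) (u : M → N) (y : M)
    (b : Module.Basis (Fin m) ℝ (TangentSpace (𝓡 m) y)) :
    energyIntegrand m n f g u y = volDensity (gram ℝ fun i ↦ euclideanDifferential (m := m) g y (b i))
      (gram ℝ fun i ↦ mfderiv (𝓡 m) (𝓡 n) u y (b i)) /
      √(gram ℝ fun i ↦ euclideanDifferential (m := m) f y (b i)).det := by
  have h1 := density_gram_basis (euclideanDifferential (m := m) g y).toLinearMap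
    (mfderiv (𝓡 m) (𝓡 n) u y).toLinearMap b (stdBasis m y)
  have h2 := sqrt_det_gram_basis (euclideanDifferential (m := m) g y).toLinearMap b (stdBasis m y)
  have h3 := sqrt_det_gram_basis (euclideanDifferential (m := m) f y).toLinearMap b (stdBasis m y)
  have h4 : |(b.toMatrix (stdBasis m y)).det| ≠ 0 :=
    abs_ne_zero.2 (isUnit_det_toMatrix _ _).ne_zero
  simp only [ContinuousLinearMap.coe_coe] at h1 h2 h3
  rw [energyIntegrand, volDensity, volDensity, h1, h2, h3, mul_left_comm,
    mul_div_mul_left _ _ h4]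

omit [IsManifold (𝓡 m) ∞ M] [RiemannianBundle (fun x : M ↦ TangentSpace (𝓡 m) x)] in
lemma volumeRatio_eq (f g : M → EuclideanSpace ℝ (Fin q)) (y : M)
    (b : Module.Basis (Fin m) ℝ (TangentSpace (𝓡 m) y)) :
    volumeRatio m f g y = √(gram ℝ fun i ↦ euclideanDifferential (m := m) g y (b i)).det /
      √(gram ℝ fun i ↦ euclideanDifferential (m := m) f y (b i)).det := by
  have h2 := sqrt_det_gram_basis (euclideanDifferential (m := m) g y).toLinearMap b (stdBasis m y)
  have h3 := sqrt_det_gram_basis (euclideanDifferential (m := m) f y).toLinearMap b (stdBasis m y)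
  have h4 : |(b.toMatrix (stdBasis m y)).det| ≠ 0 :=
    abs_ne_zero.2 (isUnit_det_toMatrix _ _).ne_zero
  simp only [ContinuousLinearMap.coe_coe] at h2 h3
  rw [volumeRatio, h2, h3, mul_div_mul_left _ _ h4]

omit [RiemannianBundle (fun x : M ↦ TangentSpace (𝓡 m) x)] in
lemma energyIntegrand_chartInv {f g : M → EuclideanSpace ℝ (Fin q)} {u : M → N} (x : M)
    {z : EuclideanSpace ℝ (Fin m)} (hz : z ∈ (chartAt (EuclideanSpace ℝ (Fin m)) x).target)
    (hf : MDifferentiableAt (𝓡 m) (𝓡 q) f (chartInv x z))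
    (hg : MDifferentiableAt (𝓡 m) (𝓡 q) g (chartInv x z))
    (hu : MDifferentiableAt (𝓡 m) (𝓡 n) u (chartInv x z)) :
    energyIntegrand m n f g u (chartInv x z) = volDensity (gramD (g ∘ chartInv x) z)
      (gram ℝ fun i ↦ (mfderiv (𝓡 m) (𝓡 n) (u ∘ chartInv x) z (EuclideanSpace.single i (1 : ℝ)) :
        TangentSpace (𝓡 n) (u (chartInv x z)))) /
      √(gramD (f ∘ chartInv x) z).det := by
  rw [energyIntegrand_eq f g u _ (chartBasis x hz)]
  simp only [euclideanDifferential_chartBasis x hz hf, euclideanDifferential_chartBasis x hz hg,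
    mfderiv_chartBasis x hz hu]
  rfl

omit [RiemannianBundle (fun x : M ↦ TangentSpace (𝓡 m) x)] in
lemma volumeRatio_chartInv {f g : M → EuclideanSpace ℝ (Fin q)} (x : M)
    {z : EuclideanSpace ℝ (Fin m)} (hz : z ∈ (chartAt (EuclideanSpace ℝ (Fin m)) x).target)
    (hf : MDifferentiableAt (𝓡 m) (𝓡 q) f (chartInv x z))
    (hg : MDifferentiableAt (𝓡 m) (𝓡 q) g (chartInv x z)) :
    volumeRatio m f g (chartInv x z) =
      √(gramD (g ∘ chartInv x) z).det / √(gramD (f ∘ chartInv x) z).det := by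
  rw [volumeRatio_eq f g _ (chartBasis x hz)]
  simp only [euclideanDifferential_chartBasis x hz hf, euclideanDifferential_chartBasis x hz hg]
  rfl

end Charts

/-! ### The Riemannian volume and its transformation under diffeomorphisms -/

section Volume

open Matrix

lemma measurableSet_inter_preimage_of_continuousOn {α β : Type*} [TopologicalSpace α]
    [MeasurableSpace α] [OpensMeasurableSpace α] [TopologicalSpace β] [MeasurableSpace β]
    [BorelSpace β] {g : α → β} {s : Set α} {t : Set β} (hg : ContinuousOn g s)
    (hs : MeasurableSet s) (ht : MeasurableSet t) : MeasurableSet (s ∩ g ⁻¹' t) := by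
  classical
  rcases s.eq_empty_or_nonempty with rfl | ⟨a, -⟩
  · simp
  have h := ContinuousOn.measurable_piecewise (g := fun _ ↦ g a) hg continuousOn_const hs
  have h2 : s ∩ g ⁻¹' t = s ∩ (s.piecewise g fun _ ↦ g a) ⁻¹' t := by
    ext x
    refine and_congr_right fun hx ↦ ?_
    simp [hx]
  rw [h2]
  exact hs.inter (h ht)

variable {m n q : ℕ}

lemma sqrt_det_gramD_comp {F : EuclideanSpace ℝ (Fin m) → EuclideanSpace ℝ (Fin q)}
    {τ : EuclideanSpace ℝ (Fin m) → EuclideanSpace ℝ (Fin m)} {z : EuclideanSpace ℝ (Fin m)}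
    (hF : DifferentiableAt ℝ F (τ z)) (hτ : DifferentiableAt ℝ τ z) :
    √(gramD (F ∘ τ) z).det = |(fderiv ℝ τ z).det| * √(gramD F (τ z)).det := by
  let b := (EuclideanSpace.basisFun (Fin m) ℝ).toBasis
  have h := gram_basis_change (fderiv ℝ F (τ z)).toLinearMap b (fun i ↦ fderiv ℝ τ z (b i))
  have h1 : (b.toMatrix fun i ↦ fderiv ℝ τ z (b i)).det = (fderiv ℝ τ z).det := by
    rw [ContinuousLinearMap.det, ← LinearMap.det_toMatrix b]
    congr 1
    ext i j
    rw [LinearMap.toMatrix_apply, Module.Basis.toMatrix_apply]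
    rfl
  have h2 : gramD (F ∘ τ) z = gram ℝ fun i ↦ (fderiv ℝ F (τ z)).toLinearMap (fderiv ℝ τ z (b i)) := by
    simp only [gramD, fderiv_comp z hF hτ, b, OrthonormalBasis.coe_toBasis,
      EuclideanSpace.basisFun_apply]
    rfl
  have h3 : gramD F (τ z) = gram ℝ fun i ↦ (fderiv ℝ F (τ z)).toLinearMap (b i) := by
    simp only [gramD, b, OrthonormalBasis.coe_toBasis, EuclideanSpace.basisFun_apply]
    rfl
  rw [h2, h, h3, det_mul, det_mul, det_transpose, h1,
    show ∀ a c : ℝ, a * c * a = a ^ 2 * c from fun a c ↦ by ring,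
    Real.sqrt_mul (sq_nonneg _), Real.sqrt_sq_eq_abs]

variable {M : Type*} [TopologicalSpace M] [ChartedSpace (EuclideanSpace ℝ (Fin m)) M]
  [IsManifold (𝓡 m) ∞ M]

lemma contDiffAt_comp_chartInv {g : M → EuclideanSpace ℝ (Fin q)} (x : M)
    {z : EuclideanSpace ℝ (Fin m)} (hz : z ∈ (chartAt (EuclideanSpace ℝ (Fin m)) x).target)
    (hg : ContMDiffAt (𝓡 m) (𝓡 q) ∞ g (chartInv x z)) : ContDiffAt ℝ ∞ (g ∘ chartInv x) z := by
  rw [← contMDiffAt_iff_contDiffAt]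
  exact hg.comp z (contMDiffAt_chartInv x hz)

omit [IsManifold (𝓡 m) ∞ M] in
lemma continuousOn_chartInv (x : M) :
    ContinuousOn (chartInv x) (chartAt (EuclideanSpace ℝ (Fin m)) x).target :=
  (chartAt (EuclideanSpace ℝ (Fin m)) x).continuousOn_symm

lemma contDiffAt_gramD {F : EuclideanSpace ℝ (Fin m) → EuclideanSpace ℝ (Fin q)}
    {z : EuclideanSpace ℝ (Fin m)} (hF : ContDiffAt ℝ ∞ F z) (i j : Fin m) :
    ContDiffAt ℝ ∞ (fun z ↦ gramD F z i j) z := by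
  have h : ContDiffAt ℝ ∞ (fderiv ℝ F) z := hF.fderiv_right (by simp)
  simp only [gramD, gram_apply]
  exact (h.clm_apply contDiffAt_const).inner ℝ (h.clm_apply contDiffAt_const)

lemma continuousAt_sqrt_det_gramD {F : EuclideanSpace ℝ (Fin m) → EuclideanSpace ℝ (Fin q)}
    {z : EuclideanSpace ℝ (Fin m)} (hF : ContDiffAt ℝ ∞ F z) :
    ContinuousAt (fun z ↦ √(gramD F z).det) z := by
  refine Real.continuous_sqrt.continuousAt.comp ?_
  have h : ContinuousAt (gramD F) z :=
    continuousAt_pi.2 fun i ↦ continuousAt_pi.2 fun j ↦ (contDiffAt_gramD hF i j).continuousAt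
  exact (Continuous.matrix_det continuous_id).continuousAt.comp h

variable [RiemannianBundle (fun x : M ↦ TangentSpace (𝓡 m) x)]
  [MeasurableSpace M] [BorelSpace M] {f : M → EuclideanSpace ℝ (Fin q)}

omit [IsManifold (𝓡 m) ∞ M] [RiemannianBundle (fun x : M ↦ TangentSpace (𝓡 m) x)] in
lemma measurableSet_chart_preimage (x : M) {A : Set M} (hA : MeasurableSet A) :
    MeasurableSet ((chartAt (EuclideanSpace ℝ (Fin m)) x).target ∩ chartInv x ⁻¹' A) :=
  measurableSet_inter_preimage_of_continuousOn (continuousOn_chartInv x)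
    (chartAt (EuclideanSpace ℝ (Fin m)) x).open_target.measurableSet hA

lemma setLIntegral_chartVolume (hf : IsIsometricImmersion (m := m) f) (x : M) {A : Set M}
    (hA : MeasurableSet A) {h : M → ENNReal} (hh : Measurable h) :
    ∫⁻ y in A, h y ∂(chartVolume (m := m) x) =
      ∫⁻ z in (chartAt (EuclideanSpace ℝ (Fin m)) x).target ∩ chartInv x ⁻¹' A,
        ENNReal.ofReal (√(gramD (f ∘ chartInv x) z).det) * h (chartInv x z) := by
  set T := (chartAt (EuclideanSpace ℝ (Fin m)) x).target with hT
  have hTm : MeasurableSet T := (chartAt (EuclideanSpace ℝ (Fin m)) x).open_target.measurableSet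
  have hc : AEMeasurable (chartInv x) (volume.restrict T) := (continuousOn_chartInv x).aemeasurable hTm
  have hd : AEMeasurable (fun z ↦ ENNReal.ofReal (√(gramD (f ∘ chartInv x) z).det))
      (volume.restrict T) := by
    refine ENNReal.measurable_ofReal.comp_aemeasurable (ContinuousOn.aemeasurable ?_ hTm)
    exact fun z hz ↦ (continuousAt_sqrt_det_gramD
      (contDiffAt_comp_chartInv x hz hf.contMDiff.contMDiffAt)).continuousWithinAt
  have hw : (volume.restrict T).withDensity
      (fun z ↦ ENNReal.ofReal (√(metricMatrix x z).det)) = (volume.restrict T).withDensity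
      (fun z ↦ ENNReal.ofReal (√(gramD (f ∘ chartInv x) z).det)) := by
    refine withDensity_congr_ae ?_
    filter_upwards [ae_restrict_mem hTm] with z hz
    rw [metricMatrix_eq hf x hz]
  have hc' := hc.mono_ac (withDensity_absolutelyContinuous (volume.restrict T)
    (fun z ↦ ENNReal.ofReal (√(gramD (f ∘ chartInv x) z).det)))
  rw [← lintegral_indicator hA]
  rw [chartVolume, ← hT, hw, lintegral_map' (hh.indicator hA).aemeasurable hc',
    lintegral_withDensity_eq_lintegral_mul₀ hd (g := fun z ↦ A.indicator h (chartInv x z))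
      ((hh.indicator hA).comp_aemeasurable hc),
    Set.inter_comm, ← Measure.restrict_restrict₀ (hc.nullMeasurableSet_preimage hA),
    ← lintegral_indicator₀ (hc.nullMeasurableSet_preimage hA)]
  refine lintegral_congr fun z ↦ ?_
  by_cases hz : chartInv x z ∈ A
  · simp [hz]
  · simp [hz]

lemma chartVolume_apply (hf : IsIsometricImmersion (m := m) f) (x : M) {A : Set M}
    (hA : MeasurableSet A) :
    chartVolume (m := m) x A =
      ∫⁻ z in (chartAt (EuclideanSpace ℝ (Fin m)) x).target ∩ chartInv x ⁻¹' A,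
        ENNReal.ofReal (√(gramD (f ∘ chartInv x) z).det) := by
  have := setLIntegral_chartVolume hf x hA (h := fun _ ↦ 1) measurable_const
  simpa using this

/-- The change of variables formula for a diffeomorphism which maps part of one chart to another
chart. -/
lemma chartVolume_image (hf : IsIsometricImmersion (m := m) f)
    (Φ : Diffeomorph (𝓡 m) (𝓡 m) M M ∞) (x y : M) {A : Set M} (hA : MeasurableSet A)
    (hx : A ⊆ (chartAt (EuclideanSpace ℝ (Fin m)) x).source)
    (hy : Φ '' A ⊆ (chartAt (EuclideanSpace ℝ (Fin m)) y).source) :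
    chartVolume (m := m) y (Φ '' A) =
      ∫⁻ z in (chartAt (EuclideanSpace ℝ (Fin m)) x).target ∩ chartInv x ⁻¹' A,
        ENNReal.ofReal (√(gramD (f ∘ Φ ∘ chartInv x) z).det) := by
  set φ := chartAt (EuclideanSpace ℝ (Fin m)) x with hφ
  set χ := chartAt (EuclideanSpace ℝ (Fin m)) y with hχ
  set S := φ.target ∩ chartInv x ⁻¹' A with hS
  have hΦA : MeasurableSet (Φ '' A) := by
    have := Φ.toHomeomorph.measurableEmbedding.measurableSet_image.2 hA
    simpa using this
  rw [chartVolume_apply hf y hΦA]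
  let τ : EuclideanSpace ℝ (Fin m) → EuclideanSpace ℝ (Fin m) := χ ∘ Φ ∘ chartInv x
  have hmem : ∀ z ∈ S, Φ (chartInv x z) ∈ χ.source := fun z hz ↦ hy ⟨_, hz.2, rfl⟩
  have himage : χ.target ∩ chartInv y ⁻¹' (Φ '' A) = τ '' S := by
    ext w
    constructor
    · rintro ⟨hw, a, ha, hae⟩
      refine ⟨φ a, ⟨φ.map_source (hx ha), ?_⟩, ?_⟩
      · simp only [mem_preimage, chartInv, ← hφ, φ.left_inv (hx ha), ha]
      · simp only [τ, Function.comp_apply, chartInv, ← hφ, φ.left_inv (hx ha), hae]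
        exact χ.right_inv hw
    · rintro ⟨z, hz, rfl⟩
      refine ⟨χ.map_source (hmem z hz), chartInv x z, hz.2, ?_⟩
      exact (χ.left_inv (hmem z hz)).symm
  have hdiff : ∀ z ∈ S, DifferentiableAt ℝ τ z := by
    intro z hz
    rw [← mdifferentiableAt_iff_differentiableAt]
    have h1 : MDifferentiableAt (𝓡 m) (𝓡 m) (Φ ∘ chartInv x) z :=
      ((Φ.contMDiff.mdifferentiable (by simp)) _).comp z (mdifferentiableAt_chartInv x hz.1)
    exact ((mdifferentiable_chart (I := 𝓡 m) y).mdifferentiableAt (hmem z hz)).comp z h1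
  have hinj : InjOn τ S := by
    intro z hz w hw h
    have h1 := χ.injOn (hmem z hz) (hmem w hw) h
    exact φ.symm.injOn hz.1 hw.1 (Φ.injective h1)
  rw [himage, lintegral_image_eq_lintegral_abs_det_fderiv_mul volume
    (measurableSet_chart_preimage x hA) (fun z hz ↦ (hdiff z hz).hasFDerivAt.hasFDerivWithinAt)
    hinj]
  refine setLIntegral_congr_fun (measurableSet_chart_preimage x hA) fun z hz ↦ ?_
  have htar : τ z ∈ χ.target := χ.map_source (hmem z hz)
  have hev : f ∘ Φ ∘ chartInv x =ᶠ[𝓝 z] (f ∘ chartInv y) ∘ τ := by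
    have hcont : ContinuousAt (Φ ∘ chartInv x) z :=
      Φ.continuous.continuousAt.comp ((mdifferentiableAt_chartInv x hz.1).continuousAt)
    filter_upwards [hcont.preimage_mem_nhds (χ.open_source.mem_nhds (hmem z hz))] with w hw
    simp only [Function.comp_apply, τ, chartInv, ← hχ]
    exact congrArg f (χ.left_inv hw).symm
  have hg : gramD (f ∘ Φ ∘ chartInv x) z = gramD ((f ∘ chartInv y) ∘ τ) z := by
    simp only [gramD, hev.fderiv_eq]
  rw [hg, sqrt_det_gramD_comp ((contDiffAt_comp_chartInv y htar
    hf.contMDiff.contMDiffAt).differentiableAt (by simp)) (hdiff z hz),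
    ENNReal.ofReal_mul (abs_nonneg _)]

/-- Chart volumes agree on the intersection of the chart domains. -/
lemma chartVolume_eq (hf : IsIsometricImmersion (m := m) f) (x y : M) {A : Set M}
    (hA : MeasurableSet A) (hx : A ⊆ (chartAt (EuclideanSpace ℝ (Fin m)) x).source)
    (hy : A ⊆ (chartAt (EuclideanSpace ℝ (Fin m)) y).source) :
    chartVolume (m := m) y A = chartVolume (m := m) x A := by
  have := chartVolume_image hf (Diffeomorph.refl (𝓡 m) M ∞) x y hA hx (by simpa using hy)
  rw [chartVolume_apply hf x hA]
  simpa using this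

lemma chartVolume_inter_source (hf : IsIsometricImmersion (m := m) f) (x : M) {A : Set M}
    (hA : MeasurableSet A) :
    chartVolume (m := m) x (A ∩ (chartAt (EuclideanSpace ℝ (Fin m)) x).source) =
      chartVolume (m := m) x A := by
  rw [chartVolume_apply hf x hA, chartVolume_apply hf x
    (hA.inter (chartAt (EuclideanSpace ℝ (Fin m)) x).open_source.measurableSet)]
  congr 2
  ext z
  simp only [mem_inter_iff, mem_preimage]
  exact ⟨fun h ↦ ⟨h.1, h.2.1⟩, fun h ↦ ⟨h.1, h.2, (chartAt (EuclideanSpace ℝ (Fin m)) x).map_target h.1⟩⟩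

/-- On the domain of a chart, the Riemannian volume is the volume of the chart. -/
lemma riemannianVolume_apply (hf : IsIsometricImmersion (m := m) f) (x : M) {A : Set M}
    (hA : MeasurableSet A) (hx : A ⊆ (chartAt (EuclideanSpace ℝ (Fin m)) x).source) :
    riemannianVolume m M A = chartVolume (m := m) x A := by
  apply le_antisymm _ (le_iSup (fun x : M ↦ chartVolume (m := m) x) x A)
  set s := (chartAt (EuclideanSpace ℝ (Fin m)) x).source with hs
  have hsm : MeasurableSet s := (chartAt (EuclideanSpace ℝ (Fin m)) x).open_source.measurableSet
  -- It suffices to bound the volume of every chart around `y` by the right side, which is the volume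
  -- of the chart around `x` on the domain of the latter.
  have hle : riemannianVolume m M ≤
      (chartVolume (m := m) x).restrict s + (riemannianVolume m M).restrict sᶜ := by
    refine iSup_le fun y ↦ Measure.le_iff.2 fun B hB ↦ ?_
    rw [← measure_inter_add_sdiff B hsm, Measure.add_apply, Measure.restrict_apply hB,
      Measure.restrict_apply hB, sdiff_eq]
    refine add_le_add ?_ (le_iSup (fun x : M ↦ chartVolume (m := m) x) y _)
    rw [← chartVolume_inter_source hf y (hB.inter hsm)]
    have hm := (hB.inter hsm).inter
      (chartAt (EuclideanSpace ℝ (Fin m)) y).open_source.measurableSet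
    rw [chartVolume_eq hf x y hm (inter_subset_left.trans inter_subset_right) inter_subset_right]
    exact measure_mono inter_subset_left
  refine (hle A).trans ?_
  rw [Measure.add_apply, Measure.restrict_apply hA, Measure.restrict_apply hA,
    inter_eq_left.2 hx, ← sdiff_eq, sdiff_eq_empty.2 hx, measure_empty, add_zero]

lemma riemannianVolume_restrict (hf : IsIsometricImmersion (m := m) f) (x : M) {A : Set M}
    (hA : MeasurableSet A) (hx : A ⊆ (chartAt (EuclideanSpace ℝ (Fin m)) x).source) :
    (riemannianVolume m M).restrict A = (chartVolume (m := m) x).restrict A := by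
  ext B hB
  rw [Measure.restrict_apply hB, Measure.restrict_apply hB,
    riemannianVolume_apply hf x (hB.inter hA) (inter_subset_right.trans hx)]

end Volume

section VolumeProperties

open Matrix

variable {m n q : ℕ}
  {M : Type*} [TopologicalSpace M] [ChartedSpace (EuclideanSpace ℝ (Fin m)) M]
  [IsManifold (𝓡 m) ∞ M] [RiemannianBundle (fun x : M ↦ TangentSpace (𝓡 m) x)]
  {f : M → EuclideanSpace ℝ (Fin q)}

lemma continuous_volumeRatio (hf : IsIsometricImmersion (m := m) f)
    {g : M → EuclideanSpace ℝ (Fin q)} (hg : ContMDiff (𝓡 m) (𝓡 q) ∞ g) :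
    Continuous (volumeRatio m f g) := by
  rw [continuous_iff_continuousAt]
  intro x
  set φ := chartAt (EuclideanSpace ℝ (Fin m)) x with hφ
  have hx := mem_chart_source (EuclideanSpace ℝ (Fin m)) x
  have hz : φ x ∈ φ.target := φ.map_source hx
  have h1 : ContinuousAt (fun z ↦ √(gramD (g ∘ chartInv x) z).det / √(gramD (f ∘ chartInv x) z).det)
      (φ x) :=
    (continuousAt_sqrt_det_gramD (contDiffAt_comp_chartInv x hz hg.contMDiffAt)).div
      (continuousAt_sqrt_det_gramD (contDiffAt_comp_chartInv x hz hf.contMDiff.contMDiffAt))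
      (Real.sqrt_pos.2 (det_gramD_pos (fderiv_comp_chartInv_injective hf x hz))).ne'
  refine (h1.comp (φ.continuousAt hx)).congr ?_
  filter_upwards [φ.open_source.mem_nhds hx] with y hy
  have h2 := volumeRatio_chartInv (f := f) (g := g) x (φ.map_source hy) (hf.mdifferentiableAt _)
    (hg.mdifferentiableAt (by simp))
  simp only [chartInv, ← hφ, φ.left_inv hy] at h2
  rw [h2]
  rfl

variable [MeasurableSpace M] [BorelSpace M]

lemma isLocallyFiniteMeasure_riemannianVolume (hf : IsIsometricImmersion (m := m) f) :
    IsLocallyFiniteMeasure (riemannianVolume m M) := by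
  refine ⟨fun x ↦ ?_⟩
  set φ := chartAt (EuclideanSpace ℝ (Fin m)) x with hφ
  have hx := mem_chart_source (EuclideanSpace ℝ (Fin m)) x
  obtain ⟨r, hr, hball⟩ := Metric.nhds_basis_closedBall.mem_iff.1
    (φ.open_target.mem_nhds (φ.map_source hx))
  have hopen : IsOpen (φ.source ∩ φ ⁻¹' Metric.ball (φ x) r) :=
    φ.isOpen_inter_preimage Metric.isOpen_ball
  refine ⟨_, hopen.mem_nhds ⟨hx, Metric.mem_ball_self hr⟩, ?_⟩
  rw [riemannianVolume_apply hf x hopen.measurableSet inter_subset_left,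
    chartVolume_apply hf x hopen.measurableSet]
  have hint : IntegrableOn (fun z ↦ √(gramD (f ∘ chartInv x) z).det)
      (Metric.closedBall (φ x) r) := by
    refine ContinuousOn.integrableOn_compact (isCompact_closedBall _ _) fun z hz ↦ ?_
    exact (continuousAt_sqrt_det_gramD (contDiffAt_comp_chartInv x (hball hz)
      hf.contMDiff.contMDiffAt)).continuousWithinAt
  refine lt_of_le_of_lt (lintegral_mono_set ?_) hint.lintegral_lt_top
  rintro z ⟨hz, -, hz2⟩
  have h3 : φ (chartInv x z) = z := φ.right_inv hz
  rw [mem_preimage, h3] at hz2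
  exact Metric.ball_subset_closedBall hz2

/-- Nonempty open sets have positive volume, because the volume density in a chart is positive. -/
lemma isOpenPosMeasure_riemannianVolume (hf : IsIsometricImmersion (m := m) f) :
    (riemannianVolume m M).IsOpenPosMeasure := by
  refine ⟨fun U hU hne h0 ↦ ?_⟩
  obtain ⟨x, hxU⟩ := hne
  set φ := chartAt (EuclideanSpace ℝ (Fin m)) x with hφ
  have hx := mem_chart_source (EuclideanSpace ℝ (Fin m)) x
  have h1 : chartVolume (m := m) x U = 0 :=
    le_antisymm ((le_iSup (fun x : M ↦ chartVolume (m := m) x) x U).trans h0.le) zero_le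
  have hS : IsOpen (φ.target ∩ chartInv x ⁻¹' U) := φ.symm.isOpen_inter_preimage hU
  rw [chartVolume_apply hf x hU.measurableSet] at h1
  have h2 := (lintegral_eq_zero_iff' ?_).1 h1
  · have h3 : ∀ᵐ z ∂(volume.restrict (φ.target ∩ chartInv x ⁻¹' U)), False := by
      filter_upwards [h2, ae_restrict_mem hS.measurableSet] with z hz hzS
      have := Real.sqrt_pos.2 (det_gramD_pos (fderiv_comp_chartInv_injective hf x hzS.1))
      simp only [Pi.zero_apply, ENNReal.ofReal_eq_zero] at hz
      exact absurd hz this.not_ge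
    simp only [Filter.eventually_false_iff_eq_bot, ae_eq_bot, Measure.restrict_eq_zero] at h3
    refine (hS.measure_pos volume ⟨φ x, φ.map_source hx, ?_⟩).ne' h3
    simpa [chartInv, ← hφ, φ.left_inv hx] using hxU
  · refine ENNReal.measurable_ofReal.comp_aemeasurable (ContinuousOn.aemeasurable ?_ hS.measurableSet)
    exact fun z hz ↦ (continuousAt_sqrt_det_gramD
      (contDiffAt_comp_chartInv x hz.1 hf.contMDiff.contMDiffAt)).continuousWithinAt

/-- The image of the Riemannian volume under the inverse of a diffeomorphism `Φ` is the volume of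
the metric pulled back by `Φ`. -/
lemma map_symm_riemannianVolume [CompactSpace M] (hf : IsIsometricImmersion (m := m) f)
    (Φ : Diffeomorph (𝓡 m) (𝓡 m) M M ∞) :
    Measure.map Φ.symm (riemannianVolume m M) = (riemannianVolume m M).withDensity
      fun y ↦ ENNReal.ofReal (volumeRatio m f (f ∘ Φ) y) := by
  have hc : Continuous (volumeRatio m f (f ∘ Φ)) :=
    continuous_volumeRatio hf (hf.contMDiff.comp Φ.contMDiff)
  have hmeas : Measurable fun y ↦ ENNReal.ofReal (volumeRatio m f (f ∘ Φ) y) :=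
    ENNReal.measurable_ofReal.comp hc.measurable
  -- Finitely many sets on which `Φ` maps one chart domain to another one suffice.
  let U : M → Set M := fun x ↦ (chartAt (EuclideanSpace ℝ (Fin m)) x).source ∩
    Φ ⁻¹' (chartAt (EuclideanSpace ℝ (Fin m)) (Φ x)).source
  have hU : ∀ x, IsOpen (U x) := fun x ↦ (chartAt _ x).open_source.inter
    ((chartAt _ (Φ x)).open_source.preimage Φ.continuous)
  obtain ⟨t, ht⟩ := isCompact_univ.elim_finite_subcover U hU
    (fun x _ ↦ mem_iUnion.2 ⟨x, mem_chart_source _ x, mem_chart_source _ (Φ x)⟩)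
  refine Measure.ext_of_iUnion_eq_univ (s := fun x : t ↦ U x) ?_ fun x ↦ ?_
  · rw [← univ_subset_iff, iUnion_subtype]
    exact ht
  ext A hA
  have hm : MeasurableSet (A ∩ U x) := hA.inter (hU x).measurableSet
  rw [Measure.restrict_apply hA, Measure.restrict_apply hA, withDensity_apply _ hm,
    Measure.map_apply Φ.symm.continuous.measurable hm]
  have himage : Φ.symm ⁻¹' (A ∩ U x) = Φ '' (A ∩ U x) := (Φ.toEquiv.image_eq_preimage_symm _).symm
  have hsub : A ∩ U x ⊆ (chartAt (EuclideanSpace ℝ (Fin m)) (x : M)).source :=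
    inter_subset_right.trans inter_subset_left
  have hsub2 : Φ '' (A ∩ U x) ⊆ (chartAt (EuclideanSpace ℝ (Fin m)) (Φ x)).source := by
    rintro _ ⟨y, hy, rfl⟩
    exact hy.2.2
  rw [himage, riemannianVolume_apply hf (Φ x) ?_ hsub2, chartVolume_image hf Φ x (Φ x) hm hsub hsub2,
    riemannianVolume_restrict hf x hm hsub, setLIntegral_chartVolume hf x hm hmeas]
  · refine setLIntegral_congr_fun (measurableSet_chart_preimage _ hm) fun z hz ↦ ?_
    rw [volumeRatio_chartInv (x : M) hz.1 (hf.mdifferentiableAt _)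
      ((hf.contMDiff.comp Φ.contMDiff).mdifferentiableAt (by simp)),
      ← ENNReal.ofReal_mul (Real.sqrt_nonneg _), mul_div_cancel₀]
    · rfl
    · exact (Real.sqrt_pos.2 (det_gramD_pos (fderiv_comp_chartInv_injective hf _ hz.1))).ne'
  · rw [← himage]
    exact Φ.symm.continuous.measurable hm

variable {N : Type*} [TopologicalSpace N] [ChartedSpace (EuclideanSpace ℝ (Fin n)) N]
  [RiemannianBundle (fun y : N ↦ TangentSpace (𝓡 n) y)]

/-- All tangent spaces of `N` are the same type, and their inner products depend only on the base
point. -/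
lemma inner_tangentSpace_congr {p p' : N} (h : p = p') (v w : EuclideanSpace ℝ (Fin n)) :
    inner ℝ (show TangentSpace (𝓡 n) p from v) (show TangentSpace (𝓡 n) p from w) =
      inner ℝ (show TangentSpace (𝓡 n) p' from v) (show TangentSpace (𝓡 n) p' from w) := by
  subst h
  rfl

omit [IsManifold (𝓡 m) ∞ M] [MeasurableSpace M] [BorelSpace M] in
lemma energyDensity_comp_symm_mul (hf : IsIsometricImmersion (m := m) f)
    (Φ : Diffeomorph (𝓡 m) (𝓡 m) M M ∞) {u : M → N} (hu : MDifferentiable (𝓡 m) (𝓡 n) u) (y : M) :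
    energyDensity m n (u ∘ Φ.symm) (Φ y) * volumeRatio m f (f ∘ Φ) y =
      energyIntegrand m n f (f ∘ Φ) u y := by
  let L := Φ.mfderivToContinuousLinearEquiv (by simp) y
  let b : Module.Basis (Fin m) ℝ (TangentSpace (𝓡 m) (Φ y)) := (stdBasis m y).map L.toLinearEquiv
  have hb : ∀ i, b i = mfderiv (𝓡 m) (𝓡 m) Φ y (stdBasis m y i) := fun i ↦
    Module.Basis.map_apply _ _ _
  have hΦ : MDifferentiableAt (𝓡 m) (𝓡 m) Φ y := Φ.contMDiff.mdifferentiableAt (by simp)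
  have h1 : ∀ v, euclideanDifferential (m := m) (f ∘ Φ) y v =
      euclideanDifferential f (Φ y) (mfderiv (𝓡 m) (𝓡 m) Φ y v) := fun v ↦ by
    rw [euclideanDifferential, mfderiv_comp y (hf.mdifferentiableAt _) hΦ]
    rfl
  have h2 : gram ℝ (fun i ↦ b i) =
      gram ℝ fun i ↦ euclideanDifferential (m := m) (f ∘ Φ) y (stdBasis m y i) := by
    ext i j
    simp only [gram_apply, h1, hf.inner_map, hb]
  have h3 : gram ℝ (fun i ↦ mfderiv (𝓡 m) (𝓡 n) (u ∘ Φ.symm) (Φ y) (b i)) =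
      gram ℝ fun i ↦ mfderiv (𝓡 m) (𝓡 n) u y (stdBasis m y i) := by
    have h4 : MDifferentiableAt (𝓡 m) (𝓡 n) (u ∘ Φ.symm) (Φ y) :=
      (hu _).comp _ (Φ.symm.contMDiff.mdifferentiableAt (by simp))
    have h5 : (u ∘ Φ.symm) ∘ Φ = u := by
      ext x
      simp
    have h6 := mfderiv_comp y h4 hΦ
    rw [h5] at h6
    have h7 : ∀ i, mfderiv (𝓡 m) (𝓡 n) u y (stdBasis m y i) =
        mfderiv (𝓡 m) (𝓡 n) (u ∘ Φ.symm) (Φ y) (b i) := fun i ↦ by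
      rw [h6, hb]
      rfl
    have h8 : u (Φ.symm (Φ y)) = u y := by simp
    ext i j
    simp only [gram_apply, h7]
    exact inner_tangentSpace_congr h8 _ _
  rw [energyDensity_eq _ _ b, h2, h3, energyIntegrand, volDensity, volumeRatio]
  ring

/-- The energy of `u ∘ Φ⁻¹` is the energy of `u` with respect to the metric induced by `f ∘ Φ`. -/
lemma energy_comp_symm [CompactSpace M] (hf : IsIsometricImmersion (m := m) f)
    (Φ : Diffeomorph (𝓡 m) (𝓡 m) M M ∞) {u : M → N} (hu : MDifferentiable (𝓡 m) (𝓡 n) u) :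
    energy m n (u ∘ Φ.symm) =
      ∫ y, energyIntegrand m n f (f ∘ Φ) u y ∂(riemannianVolume m M) := by
  have hc : Continuous (volumeRatio m f (f ∘ Φ)) :=
    continuous_volumeRatio hf (hf.contMDiff.comp Φ.contMDiff)
  have h1 : Measure.map Φ (Measure.map Φ.symm (riemannianVolume m M)) = riemannianVolume m M := by
    rw [Measure.map_map Φ.continuous.measurable Φ.symm.continuous.measurable]
    have : Φ ∘ Φ.symm = id := by
      ext x
      simp
    rw [this, Measure.map_id]
  have h2 : energy m n (u ∘ Φ.symm) = ∫ y, energyDensity m n (u ∘ Φ.symm) (Φ y)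
      ∂(Measure.map Φ.symm (riemannianVolume m M)) := by
    have h3 := (Φ.toHomeomorph.measurableEmbedding.integral_map
      (μ := Measure.map Φ.symm (riemannianVolume m M)) (energyDensity m n (u ∘ Φ.symm)))
    have h4 : (Φ.toHomeomorph : M → M) = Φ := rfl
    rw [h4, h1] at h3
    exact h3
  rw [h2, map_symm_riemannianVolume hf Φ, integral_withDensity_eq_integral_toReal_smul
    (f := fun y ↦ ENNReal.ofReal (volumeRatio m f (f ∘ Φ) y))
    (ENNReal.measurable_ofReal.comp hc.measurable) (by simp)]
  refine integral_congr_ae (Filter.Eventually.of_forall fun y ↦ ?_)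
  have h3 : 0 ≤ volumeRatio m f (f ∘ Φ) y := div_nonneg (Real.sqrt_nonneg _) (Real.sqrt_nonneg _)
  simp only [smul_eq_mul, ENNReal.toReal_ofReal h3]
  rw [← energyDensity_comp_symm_mul hf Φ hu y, mul_comm]

end VolumeProperties

/-! ### Smooth families of functions and differentiation under the integral sign -/

section SmoothFamilies

open Matrix

variable {m n q : ℕ}
  {M : Type*} [TopologicalSpace M] [ChartedSpace (EuclideanSpace ℝ (Fin m)) M]
  {X : Type*} [NormedAddCommGroup X] [NormedSpace ℝ X]

variable (m) in
/-- One-parameter families of vector-valued functions on `M`, jointly smooth for `|t| < ε`. -/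
def SmoothFamily (ε : ℝ) (F : ℝ → M → X) : Prop :=
  ContMDiffOn (𝓘(ℝ, ℝ).prod (𝓡 m)) 𝓘(ℝ, X) ∞ (fun p : ℝ × M ↦ F p.1 p.2) (Ioo (-ε) ε ×ˢ univ)

lemma SmoothFamily.contMDiffAt {ε : ℝ} {F : ℝ → M → X} (hF : SmoothFamily m ε F) {t : ℝ}
    (ht : t ∈ Ioo (-ε) ε) (x : M) :
    ContMDiffAt (𝓘(ℝ, ℝ).prod (𝓡 m)) 𝓘(ℝ, X) ∞ (fun p : ℝ × M ↦ F p.1 p.2) (t, x) :=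
  ContMDiffOn.contMDiffAt hF ((isOpen_Ioo.prod isOpen_univ).mem_nhds ⟨ht, mem_univ _⟩)

variable [IsManifold (𝓡 m) ∞ M]

lemma SmoothFamily.contDiffAt {ε : ℝ} {F : ℝ → M → X} (hF : SmoothFamily m ε F) {t : ℝ}
    (ht : t ∈ Ioo (-ε) ε) (x : M) {z : EuclideanSpace ℝ (Fin m)}
    (hz : z ∈ (chartAt (EuclideanSpace ℝ (Fin m)) x).target) :
    ContDiffAt ℝ ∞ (fun p : ℝ × EuclideanSpace ℝ (Fin m) ↦ F p.1 (chartInv x p.2)) (t, z) := by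
  rw [← contMDiffAt_iff_contDiffAt, modelWithCornersSelf_prod, ← chartedSpaceSelf_prod]
  have h1 : ContMDiffAt (𝓘(ℝ, ℝ).prod (𝓡 m)) (𝓘(ℝ, ℝ).prod (𝓡 m)) ∞
      (fun p : ℝ × EuclideanSpace ℝ (Fin m) ↦ (p.1, chartInv x p.2)) (t, z) :=
    contMDiffAt_fst.prodMk ((contMDiffAt_chartInv x hz).comp (t, z) contMDiffAt_snd)
  exact ContMDiffAt.comp (t, z) (hF.contMDiffAt ht (chartInv x z)) h1

lemma SmoothFamily.of_contDiffAt {ε : ℝ} {F : ℝ → M → X}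
    (hF : ∀ t ∈ Ioo (-ε) ε, ∀ x : M, ContDiffAt ℝ ∞
      (fun p : ℝ × EuclideanSpace ℝ (Fin m) ↦ F p.1 (chartInv x p.2))
      (t, chartAt (EuclideanSpace ℝ (Fin m)) x x)) : SmoothFamily m ε F := by
  rintro ⟨t, x⟩ ⟨ht, -⟩
  refine ContMDiffAt.contMDiffWithinAt ?_
  have h := hF t ht x
  rw [← contMDiffAt_iff_contDiffAt, modelWithCornersSelf_prod, ← chartedSpaceSelf_prod] at h
  have hx := mem_chart_source (EuclideanSpace ℝ (Fin m)) x
  have h1 : ContMDiffAt (𝓘(ℝ, ℝ).prod (𝓡 m)) (𝓘(ℝ, ℝ).prod (𝓡 m)) ∞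
      (fun p : ℝ × M ↦ (p.1, chartAt (EuclideanSpace ℝ (Fin m)) x p.2)) (t, x) :=
    contMDiffAt_fst.prodMk ((contMDiffOn_chart.contMDiffAt
      ((chartAt (EuclideanSpace ℝ (Fin m)) x).open_source.mem_nhds hx)).comp (t, x) contMDiffAt_snd)
  refine (ContMDiffAt.comp (t, x) h h1).congr_of_eventuallyEq ?_
  have hev : ∀ᶠ p : ℝ × M in 𝓝 (t, x), p.2 ∈ (chartAt (EuclideanSpace ℝ (Fin m)) x).source :=
    continuousAt_snd.eventually
      ((chartAt (EuclideanSpace ℝ (Fin m)) x).open_source.mem_nhds hx)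
  filter_upwards [hev] with p hp
  simp [chartInv, (chartAt (EuclideanSpace ℝ (Fin m)) x).left_inv hp]

lemma SmoothFamily.hasDerivAt {ε : ℝ} {F : ℝ → M → X} (hF : SmoothFamily m ε F) {t : ℝ}
    (ht : t ∈ Ioo (-ε) ε) (x : M) :
    HasDerivAt (fun s ↦ F s x) (deriv (fun s ↦ F s x) t) t := by
  have hx := mem_chart_source (EuclideanSpace ℝ (Fin m)) x
  have h := (hF.contDiffAt ht x ((chartAt (EuclideanSpace ℝ (Fin m)) x).map_source hx)).differentiableAt
    (by simp)
  have h2 : DifferentiableAt ℝ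
      (fun s : ℝ ↦ F s (chartInv x (chartAt (EuclideanSpace ℝ (Fin m)) x x))) t :=
    h.comp (f := fun s : ℝ ↦ (s, chartAt (EuclideanSpace ℝ (Fin m)) x x)) t
      (differentiableAt_id.prodMk (differentiableAt_const _))
  simp only [chartInv, (chartAt (EuclideanSpace ℝ (Fin m)) x).left_inv hx] at h2
  exact h2.hasDerivAt

lemma SmoothFamily.deriv {ε : ℝ} {F : ℝ → M → X} (hF : SmoothFamily m ε F) :
    SmoothFamily m ε fun t x ↦ deriv (fun s ↦ F s x) t := by
  refine SmoothFamily.of_contDiffAt fun t ht x ↦ ?_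
  have hx := (chartAt (EuclideanSpace ℝ (Fin m)) x).map_source
    (mem_chart_source (EuclideanSpace ℝ (Fin m)) x)
  set K := fun p : ℝ × EuclideanSpace ℝ (Fin m) ↦ F p.1 (chartInv x p.2) with hK
  have h1 : ContDiffAt ℝ ∞ (fun p ↦ fderiv ℝ K p ((1 : ℝ), (0 : EuclideanSpace ℝ (Fin m))))
      (t, chartAt (EuclideanSpace ℝ (Fin m)) x x) :=
    ((hF.contDiffAt ht x hx).fderiv_right (by simp)).clm_apply contDiffAt_const
  refine h1.congr_of_eventuallyEq ?_
  filter_upwards [(isOpen_Ioo.prod (chartAt (EuclideanSpace ℝ (Fin m)) x).open_target).mem_nhds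
    ⟨ht, hx⟩] with p hp
  have h2 := ((hF.contDiffAt hp.1 x hp.2).differentiableAt (by simp)).hasFDerivAt
  have h3 : HasDerivAt (fun s : ℝ ↦ ((s, p.2) : ℝ × EuclideanSpace ℝ (Fin m))) (1, 0) p.1 :=
    (hasDerivAt_id _).prodMk (hasDerivAt_const _ _)
  exact (h2.comp_hasDerivAt p.1 h3).deriv

omit [IsManifold (𝓡 m) ∞ M] in
lemma SmoothFamily.continuous {ε : ℝ} {F : ℝ → M → X} (hF : SmoothFamily m ε F) {t : ℝ}
    (ht : t ∈ Ioo (-ε) ε) : Continuous (F t) := by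
  rw [continuous_iff_continuousAt]
  intro x
  exact (hF.contMDiffAt ht x).continuousAt.comp (f := fun x : M ↦ (t, x))
    (by fun_prop)

/-- Differentiation under the integral sign on a compact manifold. -/
lemma SmoothFamily.hasDerivAt_integral [CompactSpace M] [MeasurableSpace M] [BorelSpace M]
    {μ : Measure M} [IsFiniteMeasure μ] {ε : ℝ} {F : ℝ → M → ℝ} (hF : SmoothFamily m ε F) {t : ℝ}
    (ht : t ∈ Ioo (-ε) ε) :
    HasDerivAt (fun s ↦ ∫ x, F s x ∂μ) (∫ x, _root_.deriv (fun s ↦ F s x) t ∂μ) t := by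
  have hint : ∀ {G : ℝ → M → ℝ}, SmoothFamily m ε G → ∀ s ∈ Ioo (-ε) ε, Integrable (G s) μ :=
    fun hG s hs ↦ (hG.continuous hs).integrable_of_hasCompactSupport
      (HasCompactSupport.of_compactSpace _)
  obtain ⟨r, hr, hball⟩ := Metric.nhds_basis_closedBall.mem_iff.1 (isOpen_Ioo.mem_nhds ht)
  have hcomp : IsCompact (Metric.closedBall t r ×ˢ (univ : Set M)) :=
    (isCompact_closedBall _ _).prod isCompact_univ
  obtain ⟨C, hC⟩ := hcomp.exists_bound_of_continuousOn
    (f := fun p : ℝ × M ↦ _root_.deriv (fun s ↦ F s p.2) p.1)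
    ((ContMDiffOn.continuousOn hF.deriv).mono (prod_mono hball subset_rfl))
  refine (hasDerivAt_integral_of_dominated_loc_of_deriv_le (bound := fun _ ↦ C)
    (F' := fun t x ↦ _root_.deriv (fun s ↦ F s x) t)
    (Metric.closedBall_mem_nhds t hr) ?_ (hint hF t ht)
    (hint hF.deriv t ht).aestronglyMeasurable ?_ (integrable_const C) ?_).2
  · filter_upwards [isOpen_Ioo.mem_nhds ht] with s hs
    exact (hint hF s hs).aestronglyMeasurable
  · exact Filter.Eventually.of_forall fun x s hs ↦ hC (s, x) ⟨hs, mem_univ _⟩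
  · exact Filter.Eventually.of_forall fun x s hs ↦ hF.hasDerivAt (hball hs) x

end SmoothFamilies

/-! ### Smoothness of the energy integrand -/

section IntegrandSmooth

open Matrix
open scoped Matrix.Norms.Operator

variable {ι : Type*} [Fintype ι] [DecidableEq ι]
  {X : Type*} [NormedAddCommGroup X] [NormedSpace ℝ X]

lemma contDiffAt_matrix {k : WithTop ℕ∞} {G : X → Matrix ι ι ℝ} {x : X}
    (hG : ∀ i j, ContDiffAt ℝ k (fun x ↦ G x i j) x) : ContDiffAt ℝ k G x := by
  have h : G = fun x ↦ ∑ i, ∑ j, G x i j • Matrix.single i j (1 : ℝ) := by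
    ext1 x
    conv_lhs => rw [matrix_eq_sum_single (G x)]
    simp only [smul_single, smul_eq_mul, mul_one]
  rw [h]
  exact ContDiffAt.sum fun i _ ↦ ContDiffAt.sum fun j _ ↦ (hG i j).smul contDiffAt_const

lemma contDiffAt_det {k : WithTop ℕ∞} {G : X → Matrix ι ι ℝ} {x : X}
    (hG : ∀ i j, ContDiffAt ℝ k (fun x ↦ G x i j) x) : ContDiffAt ℝ k (fun x ↦ (G x).det) x := by
  simp only [det_apply, Units.smul_def, zsmul_eq_mul]
  exact ContDiffAt.sum fun σ _ ↦ contDiffAt_const.mul (contDiffAt_prod fun i _ ↦ hG _ _)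

/-- Cramer's rule. -/
lemma contDiffAt_inv_apply {k : WithTop ℕ∞} {G : X → Matrix ι ι ℝ} {x : X}
    (hG : ∀ i j, ContDiffAt ℝ k (fun x ↦ G x i j) x) (hdet : (G x).det ≠ 0) (i j : ι) :
    ContDiffAt ℝ k (fun x ↦ (G x)⁻¹ i j) x := by
  have h : (fun x ↦ (G x)⁻¹ i j) =
      fun x ↦ (G x).det⁻¹ * ((G x).updateRow j (Pi.single i 1)).det := by
    ext1 x
    rw [inv_def, Ring.inverse_eq_inv', Matrix.smul_apply, smul_eq_mul, adjugate_apply]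
  rw [h]
  refine ((contDiffAt_det hG).inv hdet).mul (contDiffAt_det fun k l ↦ ?_)
  by_cases hk : k = j
  · subst hk
    simp only [updateRow_apply, if_true]
    exact contDiffAt_const
  · simp only [updateRow_apply, if_neg hk]
    exact hG k l

lemma contDiffAt_volDensity {k : WithTop ℕ∞} {G H : X → Matrix ι ι ℝ} {x : X}
    (hG : ∀ i j, ContDiffAt ℝ k (fun x ↦ G x i j) x)
    (hH : ∀ i j, ContDiffAt ℝ k (fun x ↦ H x i j) x) (hpos : 0 < (G x).det) :
    ContDiffAt ℝ k (fun x ↦ volDensity (G x) (H x)) x := by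
  have hsq := (contDiffAt_det hG).sqrt hpos.ne'
  have hi : ContDiffAt ℝ k (fun x ↦ (G x)⁻¹) x := contDiffAt_matrix (contDiffAt_inv_apply hG hpos.ne')
  have hA : ContDiffAt ℝ k (fun x ↦ (G x)⁻¹ * H x) x := hi.mul (contDiffAt_matrix hH)
  have ht : ContDiffAt ℝ k (fun x ↦ trace ((G x)⁻¹ * H x * ((G x)⁻¹ * H x) * ((G x)⁻¹ * H x))) x :=
    (traceLinearMap ι ℝ ℝ).toContinuousLinearMap.contDiff.contDiffAt.comp x ((hA.mul hA).mul hA)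
  exact (contDiffAt_const.mul ht).mul hsq

variable {m n q : ℕ}
  {M : Type*} [TopologicalSpace M] [ChartedSpace (EuclideanSpace ℝ (Fin m)) M]
  [IsManifold (𝓡 m) ∞ M] [RiemannianBundle (fun x : M ↦ TangentSpace (𝓡 m) x)]
  {f : M → EuclideanSpace ℝ (Fin q)}
  {N : Type*} [TopologicalSpace N] [ChartedSpace (EuclideanSpace ℝ (Fin n)) N]
  [IsManifold (𝓡 n) ∞ N] [RiemannianBundle (fun y : N ↦ TangentSpace (𝓡 n) y)]
  [IsContMDiffRiemannianBundle (𝓡 n) ∞ (EuclideanSpace ℝ (Fin n))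
    (fun y : N ↦ TangentSpace (𝓡 n) y)]

/-- The coefficients of the metric pulled back by a smooth map are smooth. -/
lemma contDiffAt_inner_mfderiv {U : EuclideanSpace ℝ (Fin m) → N}
    {s : Set (EuclideanSpace ℝ (Fin m))} (hs : IsOpen s) (hU : ContMDiffOn (𝓡 m) (𝓡 n) ∞ U s)
    {z : EuclideanSpace ℝ (Fin m)} (hz : z ∈ s) (v w : EuclideanSpace ℝ (Fin m)) :
    ContDiffAt ℝ ∞ (fun z ↦ inner ℝ (mfderiv (𝓡 m) (𝓡 n) U z v) (mfderiv (𝓡 m) (𝓡 n) U z w)) z := by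
  have key : ∀ v : EuclideanSpace ℝ (Fin m), ContMDiffAt (𝓡 m) (𝓡 n).tangent ∞
      (fun z ↦ (⟨U z, mfderiv (𝓡 m) (𝓡 n) U z v⟩ : TangentBundle (𝓡 n) N)) z := by
    intro v
    have h1 := (hU.contMDiffOn_tangentMapWithin (m := ∞) (by simp) hs.uniqueMDiffOn)
    have h2 : ContMDiffAt (𝓡 m) (𝓡 m).tangent ∞
        (fun z ↦ (⟨z, v⟩ : TangentBundle (𝓡 m) (EuclideanSpace ℝ (Fin m)))) z :=
      contMDiffAt_vectorSpace_iff_contDiffAt.2 contDiffAt_const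
    have h3 := ContMDiffWithinAt.comp (t := TotalSpace.proj ⁻¹' s) (s := s) z
      (f := fun z ↦ (⟨z, v⟩ : TangentBundle (𝓡 m) (EuclideanSpace ℝ (Fin m))))
      (h1 ⟨z, v⟩ hz) h2.contMDiffWithinAt (fun y hy ↦ hy)
    refine (h3.contMDiffAt (hs.mem_nhds hz)).congr_of_eventuallyEq ?_
    filter_upwards [hs.mem_nhds hz] with y hy
    simp only [Function.comp_apply, tangentMapWithin, mfderivWithin_of_isOpen hs hy]
  rw [← contMDiffAt_iff_contDiffAt]
  exact (key v).inner_bundle (key w)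

/-- The integrand of the energy is jointly smooth along a smooth family of immersions. -/
lemma smoothFamily_energyIntegrand (hf : IsIsometricImmersion (m := m) f) {u : M → N}
    (hu : ContMDiff (𝓡 m) (𝓡 n) ∞ u) {ε : ℝ} {G : ℝ → M → EuclideanSpace ℝ (Fin q)}
    (hG : SmoothFamily m ε G)
    (hinj : ∀ t ∈ Ioo (-ε) ε, ∀ x, Function.Injective (euclideanDifferential (m := m) (G t) x)) :
    SmoothFamily m ε fun t x ↦ energyIntegrand m n f (G t) u x := by
  refine SmoothFamily.of_contDiffAt fun t ht x ↦ ?_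
  set φ := chartAt (EuclideanSpace ℝ (Fin m)) x with hφ
  have hx : φ x ∈ φ.target := φ.map_source (mem_chart_source (EuclideanSpace ℝ (Fin m)) x)
  have hGd : ∀ t ∈ Ioo (-ε) ε, ∀ y, MDifferentiableAt (𝓡 m) (𝓡 q) (G t) y := fun t ht y ↦ by
    have h1 := (hG.contMDiffAt ht y).mdifferentiableAt (by simp)
    exact h1.comp (f := fun y : M ↦ (t, y)) y (mdifferentiableAt_const.prodMk mdifferentiableAt_id)
  set K := fun p : ℝ × EuclideanSpace ℝ (Fin m) ↦ G p.1 (chartInv x p.2) with hK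
  have hGm : ∀ i j, ContDiffAt ℝ ∞ (fun p : ℝ × EuclideanSpace ℝ (Fin m) ↦
      gramD (G p.1 ∘ chartInv x) p.2 i j) (t, φ x) := by
    intro i j
    have h1 : ∀ v : EuclideanSpace ℝ (Fin m), ContDiffAt ℝ ∞ (fun p ↦ fderiv ℝ K p ((0 : ℝ), v))
        (t, φ x) := fun v ↦
      ((hG.contDiffAt ht x hx).fderiv_right (by simp)).clm_apply contDiffAt_const
    refine ((h1 (EuclideanSpace.single i 1)).inner ℝ
      (h1 (EuclideanSpace.single j 1))).congr_of_eventuallyEq ?_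
    filter_upwards [(isOpen_Ioo.prod φ.open_target).mem_nhds ⟨ht, hx⟩] with p hp
    have h2 := ((hG.contDiffAt hp.1 x hp.2).differentiableAt (by simp)).hasFDerivAt
    have h3 : HasFDerivAt (fun z : EuclideanSpace ℝ (Fin m) ↦ (p.1, z))
        (ContinuousLinearMap.inr ℝ ℝ _) p.2 := hasFDerivAt_prodMk_right _ _
    have h4 : fderiv ℝ (G p.1 ∘ chartInv x) p.2 = _ := (h2.comp p.2 h3).fderiv
    simp only [gramD, gram_apply, h4]
    rfl
  have hHm := fun i j ↦ (contDiffAt_inner_mfderiv (U := u ∘ chartInv x) φ.open_target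
    (hu.comp_contMDiffOn contMDiffOn_chart_symm) hx (EuclideanSpace.single i 1)
    (EuclideanSpace.single j 1)).comp (t, φ x) contDiffAt_snd
  have hpos : 0 < (gramD (G t ∘ chartInv x) (φ x)).det := by
    refine det_gramD_pos ?_
    intro v w h
    rw [← euclideanDifferential_chartInv x hx (hGd t ht _),
      ← euclideanDifferential_chartInv x hx (hGd t ht _)] at h
    exact ((mdifferentiable_chart (I := 𝓡 m) x).symm.mfderiv hx).injective (hinj t ht _ h)
  have hf1 := det_gramD_pos (fderiv_comp_chartInv_injective hf x hx)
  have hfm : ContDiffAt ℝ ∞ (fun p : ℝ × EuclideanSpace ℝ (Fin m) ↦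
      √(gramD (f ∘ chartInv x) p.2).det) (t, φ x) :=
    ContDiffAt.comp (t, φ x) (g := fun z ↦ √(gramD (f ∘ chartInv x) z).det)
      ((contDiffAt_det fun i j ↦ contDiffAt_gramD (contDiffAt_comp_chartInv x hx
        hf.contMDiff.contMDiffAt) i j).sqrt hf1.ne') contDiffAt_snd
  refine ((contDiffAt_volDensity hGm hHm hpos).div hfm
    (Real.sqrt_pos.2 hf1).ne').congr_of_eventuallyEq ?_
  filter_upwards [(isOpen_Ioo.prod φ.open_target).mem_nhds ⟨ht, hx⟩] with p hp
  rw [energyIntegrand_chartInv x hp.2 (hf.mdifferentiableAt _) (hGd _ hp.1 _)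
    (hu.mdifferentiableAt (by simp))]
  rfl

end IntegrandSmooth

/-! ### Families of diffeomorphisms with prescribed velocity -/

section EuclideanFamilies

variable {E : Type*} [NormedAddCommGroup E] [NormedSpace ℝ E] [FiniteDimensional ℝ E]

omit [FiniteDimensional ℝ E] in
lemma lipschitzWith_const_smul {Y : E → E} {C : NNReal} (hY : LipschitzWith C Y) (t : ℝ) :
    LipschitzWith (‖t‖₊ * C) fun z ↦ t • Y z :=
  (lipschitzWith_smul t).comp hY

/-- Small perturbations of the identity are bijective: solving for the preimage is a fixed point
problem for a contraction. -/
lemma bijective_add_smul {Y : E → E} {C : NNReal} (hY : LipschitzWith C Y) {t : ℝ}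
    (ht : ‖t‖₊ * C < 1) : Function.Bijective fun z ↦ z + t • Y z := by
  constructor
  · intro z w h
    have h1 := (lipschitzWith_const_smul hY t).dist_le_mul z w
    have h2 : z - w = -(t • Y z - t • Y w) := by
      rw [neg_sub, sub_eq_sub_iff_add_eq_add, add_comm (t • Y w)]
      exact h
    rw [dist_eq_norm, dist_eq_norm, ← norm_neg, ← h2] at h1
    have h3 : ((‖t‖₊ * C : NNReal) : ℝ) < 1 := by exact_mod_cast ht
    by_contra hne
    have h4 : 0 < ‖z - w‖ := norm_pos_iff.2 (sub_ne_zero.2 hne)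
    nlinarith
  · intro w
    have hc : ContractingWith (‖t‖₊ * C) fun z ↦ w - t • Y z := by
      refine ⟨ht, LipschitzWith.of_dist_le_mul fun x y ↦ ?_⟩
      rw [dist_sub_left]
      exact (lipschitzWith_const_smul hY t).dist_le_mul x y
    have h := hc.fixedPoint_isFixedPt
    exact ⟨hc.fixedPoint, by rw [← eq_sub_iff_add_eq]; exact h.symm⟩

/-- The inverse of the maps `z ↦ z + t Y(z)` is smooth in `t` and `z`. -/
lemma contDiffOn_invFun_add_smul {Y : E → E} (hY : ContDiff ℝ ∞ Y) {C : NNReal}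
    (hC : LipschitzWith C Y) {ε : ℝ} (hε : ∀ t ∈ Ioo (-ε) ε, ‖t‖₊ * C < 1) :
    ContDiffOn ℝ ∞ (fun p : ℝ × E ↦ Function.invFun (fun z ↦ z + p.1 • Y z) p.2)
      (Ioo (-ε) ε ×ˢ univ) := by
  rintro ⟨t, w⟩ ⟨ht, -⟩
  refine ContDiffAt.contDiffWithinAt ?_
  -- The inverse function theorem for `Φ` yields the smoothness in both variables at once.
  let Φ : ℝ × E → ℝ × E := fun p ↦ (p.1, p.2 + p.1 • Y p.2)
  have hΦ : ContDiff ℝ ∞ Φ :=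
    contDiff_fst.prodMk (contDiff_snd.add (contDiff_fst.smul (hY.comp contDiff_snd)))
  set z := Function.invFun (fun z ↦ z + t • Y z) w with hz
  have hzw : z + t • Y z = w := Function.rightInverse_invFun (bijective_add_smul hC (hε t ht)).2 w
  have hd : HasFDerivAt Φ ((ContinuousLinearMap.fst ℝ ℝ E).prod (ContinuousLinearMap.snd ℝ ℝ E +
      (t • (fderiv ℝ Y z).comp (ContinuousLinearMap.snd ℝ ℝ E) +
        (ContinuousLinearMap.fst ℝ ℝ E).smulRight (Y z)))) (t, z) := by
    refine hasFDerivAt_fst.prodMk (hasFDerivAt_snd.add ?_)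
    have h1 : HasFDerivAt (fun p : ℝ × E ↦ Y p.2)
        ((fderiv ℝ Y z).comp (ContinuousLinearMap.snd ℝ ℝ E)) (t, z) :=
      ((hY.differentiable (by simp)) z).hasFDerivAt.comp (t, z) hasFDerivAt_snd
    exact hasFDerivAt_fst.smul h1
  set D := (ContinuousLinearMap.fst ℝ ℝ E).prod (ContinuousLinearMap.snd ℝ ℝ E +
      (t • (fderiv ℝ Y z).comp (ContinuousLinearMap.snd ℝ ℝ E) +
        (ContinuousLinearMap.fst ℝ ℝ E).smulRight (Y z))) with hD
  have hinj : Function.Injective D := by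
    rw [injective_iff_map_eq_zero]
    rintro ⟨a, v⟩ h
    simp only [hD, ContinuousLinearMap.prod_apply, ContinuousLinearMap.coe_fst',
      _root_.add_apply, ContinuousLinearMap.coe_snd', _root_.smul_apply,
      ContinuousLinearMap.comp_apply, ContinuousLinearMap.smulRight_apply, Prod.mk_eq_zero] at h
    obtain ⟨rfl, h2⟩ := h
    rw [zero_smul, add_zero] at h2
    have h3 : ‖v‖ ≤ ‖t‖ * (C * ‖v‖) := by
      have h3 : ‖v‖ = ‖t‖ * ‖fderiv ℝ Y z v‖ := by
        rw [← norm_smul, ← norm_neg (t • _), ← eq_neg_of_add_eq_zero_left h2]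
      rw [h3]
      refine mul_le_mul_of_nonneg_left ?_ (norm_nonneg t)
      rw [← h3]
      exact (ContinuousLinearMap.le_opNorm _ _).trans
        (by gcongr; exact norm_fderiv_le_of_lipschitz ℝ hC)
    have h4 : ‖t‖ * C < 1 := by exact_mod_cast hε t ht
    have h5 : ‖v‖ = 0 := by nlinarith [norm_nonneg v]
    rw [norm_eq_zero.1 h5]
    rfl
  let e : (ℝ × E) ≃L[ℝ] (ℝ × E) :=
    (LinearEquiv.ofInjectiveEndo D.toLinearMap hinj).toContinuousLinearEquiv
  have he : HasFDerivAt Φ (e : ℝ × E →L[ℝ] ℝ × E) (t, z) := by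
    convert hd using 1
    ext x <;> rfl
  have hne : (∞ : WithTop ℕ∞) ≠ 0 := by simp
  have hinv := hΦ.contDiffAt.to_localInverse (a := (t, z)) he hne
  have hΦz : Φ (t, z) = (t, w) := by simp only [Φ, hzw]
  have hright := (hΦ.contDiffAt.hasStrictFDerivAt' he hne).eventually_right_inverse
  rw [hΦz] at hinv hright
  refine (contDiffAt_snd.comp (t, w) hinv).congr_of_eventuallyEq ?_
  filter_upwards [hright, (isOpen_Ioo.prod isOpen_univ).mem_nhds ⟨ht, mem_univ w⟩] with p hp hpI
  change _ = (HasStrictFDerivAt.localInverse Φ e (t, z) _ p).2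
  set r := HasStrictFDerivAt.localInverse Φ e (t, z) (hΦ.contDiffAt.hasStrictFDerivAt' he hne) p
  have hp : Φ r = p := hp
  have h1 : (Φ r).1 = p.1 := by rw [hp]
  have h2 : (Φ r).2 = p.2 := by rw [hp]
  simp only [Φ] at h1 h2
  rw [← h2, h1]
  exact Function.leftInverse_invFun (bijective_add_smul hC (hε p.1 hpI.1)).1 r.2

end EuclideanFamilies

section DiffeoFamilies

variable {m q : ℕ}
  {M : Type*} [TopologicalSpace M] [ChartedSpace (EuclideanSpace ℝ (Fin m)) M]

variable (m) in
/-- A smooth family `ψ` of diffeomorphisms of `M` for `|t| < ε`, with `ψ 0 = id` and with inverses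
`θ`. -/
structure DiffeoFamily (ε : ℝ) (ψ θ : ℝ → M → M) : Prop where
  pos : 0 < ε
  smooth : ContMDiffOn (𝓘(ℝ, ℝ).prod (𝓡 m)) (𝓡 m) ∞ (fun p : ℝ × M ↦ ψ p.1 p.2)
    (Ioo (-ε) ε ×ˢ univ)
  smooth_inv : ContMDiffOn (𝓘(ℝ, ℝ).prod (𝓡 m)) (𝓡 m) ∞ (fun p : ℝ × M ↦ θ p.1 p.2)
    (Ioo (-ε) ε ×ˢ univ)
  left_inv : ∀ t ∈ Ioo (-ε) ε, ∀ x, θ t (ψ t x) = x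
  right_inv : ∀ t ∈ Ioo (-ε) ε, ∀ x, ψ t (θ t x) = x
  init : ∀ x, ψ 0 x = x

/-- The vector field with image `ξ` under the differential of `f` is the velocity at `t = 0` of a
smooth family of diffeomorphisms. -/
def IsVelocity (f : M → EuclideanSpace ℝ (Fin q)) (ξ : M → EuclideanSpace ℝ (Fin q)) : Prop :=
  ∃ (ε : ℝ) (ψ θ : ℝ → M → M), DiffeoFamily m ε ψ θ ∧ ∀ x, HasDerivAt (fun t ↦ f (ψ t x)) (ξ x) 0

lemma DiffeoFamily.mono {ε δ : ℝ} {ψ θ : ℝ → M → M} (h : DiffeoFamily m ε ψ θ) (hδ : 0 < δ)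
    (hle : δ ≤ ε) : DiffeoFamily m δ ψ θ := by
  have hsub : Ioo (-δ) δ ⊆ Ioo (-ε) ε := Ioo_subset_Ioo (neg_le_neg hle) hle
  exact ⟨hδ, h.smooth.mono (prod_mono hsub subset_rfl), h.smooth_inv.mono (prod_mono hsub subset_rfl),
    fun t ht ↦ h.left_inv t (hsub ht), fun t ht ↦ h.right_inv t (hsub ht), h.init⟩

lemma DiffeoFamily.comp {ε : ℝ} {ψ₁ θ₁ ψ₂ θ₂ : ℝ → M → M} (h₁ : DiffeoFamily m ε ψ₁ θ₁)
    (h₂ : DiffeoFamily m ε ψ₂ θ₂) :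
    DiffeoFamily m ε (fun t x ↦ ψ₁ t (ψ₂ t x)) (fun t x ↦ θ₂ t (θ₁ t x)) where
  pos := h₁.pos
  smooth := h₁.smooth.comp (contMDiff_fst.contMDiffOn.prodMk h₂.smooth) fun p hp ↦ ⟨hp.1, mem_univ _⟩
  smooth_inv := h₂.smooth_inv.comp (contMDiff_fst.contMDiffOn.prodMk h₁.smooth_inv)
    fun p hp ↦ ⟨hp.1, mem_univ _⟩
  left_inv t ht x := by rw [h₁.left_inv t ht, h₂.left_inv t ht]
  right_inv t ht x := by rw [h₂.right_inv t ht, h₁.right_inv t ht]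
  init x := by rw [h₂.init, h₁.init]

lemma isVelocity_zero (f : M → EuclideanSpace ℝ (Fin q)) : IsVelocity (m := m) f fun _ ↦ 0 :=
  ⟨1, fun _ x ↦ x, fun _ x ↦ x, ⟨one_pos, contMDiff_snd.contMDiffOn, contMDiff_snd.contMDiffOn,
    fun _ _ _ ↦ rfl, fun _ _ _ ↦ rfl, fun _ ↦ rfl⟩, fun _ ↦ hasDerivAt_const _ _⟩

/-- Velocities add up under composition of the families. -/
lemma IsVelocity.add {f ξ₁ ξ₂ : M → EuclideanSpace ℝ (Fin q)} (hf : ContMDiff (𝓡 m) (𝓡 q) ∞ f)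
    (h₁ : IsVelocity (m := m) f ξ₁) (h₂ : IsVelocity (m := m) f ξ₂) :
    IsVelocity (m := m) f fun x ↦ ξ₁ x + ξ₂ x := by
  obtain ⟨ε₁, ψ₁, θ₁, hd₁, hv₁⟩ := h₁
  obtain ⟨ε₂, ψ₂, θ₂, hd₂, hv₂⟩ := h₂
  have hε : 0 < min ε₁ ε₂ := lt_min hd₁.pos hd₂.pos
  replace hd₁ := hd₁.mono hε (min_le_left _ _)
  replace hd₂ := hd₂.mono hε (min_le_right _ _)
  set ε := min ε₁ ε₂
  refine ⟨ε, _, _, hd₁.comp hd₂, fun x ↦ ?_⟩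
  have h0 : (0 : ℝ) ∈ Ioo (-ε) ε := ⟨neg_lt_zero.2 hε, hε⟩
  -- The composite family is the restriction of `A` to the diagonal.
  let A : ℝ × ℝ → EuclideanSpace ℝ (Fin q) := fun p ↦ f (ψ₁ p.1 (ψ₂ p.2 x))
  have hA : DifferentiableAt ℝ A (0, 0) := by
    rw [← mdifferentiableAt_iff_differentiableAt, modelWithCornersSelf_prod, ← chartedSpaceSelf_prod]
    have h1 : ContMDiffAt (𝓘(ℝ, ℝ).prod (𝓡 m)) (𝓡 m) ∞ (fun p : ℝ × M ↦ ψ₂ p.1 p.2) (0, x) :=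
      hd₂.smooth.contMDiffAt ((isOpen_Ioo.prod isOpen_univ).mem_nhds ⟨h0, mem_univ _⟩)
    have h2 : ContMDiffAt (𝓘(ℝ, ℝ).prod (𝓡 m)) (𝓡 m) ∞ (fun p : ℝ × M ↦ ψ₁ p.1 p.2)
        (0, ψ₂ 0 x) :=
      hd₁.smooth.contMDiffAt ((isOpen_Ioo.prod isOpen_univ).mem_nhds ⟨h0, mem_univ _⟩)
    have h3 : ContMDiffAt (𝓘(ℝ, ℝ).prod 𝓘(ℝ, ℝ)) (𝓡 m) ∞ (fun p : ℝ × ℝ ↦ ψ₂ p.2 x) (0, 0) :=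
      h1.comp (f := fun p : ℝ × ℝ ↦ (p.2, x)) (0, 0) (contMDiffAt_snd.prodMk contMDiffAt_const)
    have h4 : ContMDiffAt (𝓘(ℝ, ℝ).prod 𝓘(ℝ, ℝ)) (𝓡 m) ∞ (fun p : ℝ × ℝ ↦ ψ₁ p.1 (ψ₂ p.2 x))
        (0, 0) :=
      h2.comp (f := fun p : ℝ × ℝ ↦ (p.1, ψ₂ p.2 x)) (0, 0) (contMDiffAt_fst.prodMk h3)
    exact (hf.contMDiffAt.comp _ h4).mdifferentiableAt (by simp)
  have hdiag := hA.hasFDerivAt.comp_hasDerivAt (f := fun t : ℝ ↦ (t, t)) 0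
    ((hasDerivAt_id _).prodMk (hasDerivAt_id _))
  have hleft := hA.hasFDerivAt.comp_hasDerivAt (f := fun t : ℝ ↦ (t, (0 : ℝ))) 0
    ((hasDerivAt_id _).prodMk (hasDerivAt_const _ _))
  have hright := hA.hasFDerivAt.comp_hasDerivAt (f := fun t : ℝ ↦ ((0 : ℝ), t)) 0
    ((hasDerivAt_const _ _).prodMk (hasDerivAt_id _))
  have e1 : A ∘ (fun t : ℝ ↦ (t, (0 : ℝ))) = fun t ↦ f (ψ₁ t x) := by
    ext1 t
    simp only [A, Function.comp_apply, hd₂.init]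
  have e2 : A ∘ (fun t : ℝ ↦ ((0 : ℝ), t)) = fun t ↦ f (ψ₂ t x) := by
    ext1 t
    simp only [A, Function.comp_apply, hd₁.init]
  rw [e1] at hleft
  rw [e2] at hright
  refine HasDerivAt.congr_deriv hdiag ?_
  beta_reduce
  rw [← hleft.unique (hv₁ x), ← hright.unique (hv₂ x), ← map_add]
  simp

lemma IsVelocity.sum {f : M → EuclideanSpace ℝ (Fin q)} (hf : ContMDiff (𝓡 m) (𝓡 q) ∞ f) {ι : Type*}
    (s : Finset ι) {ξ : ι → M → EuclideanSpace ℝ (Fin q)}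
    (h : ∀ i ∈ s, IsVelocity (m := m) f (ξ i)) : IsVelocity (m := m) f fun x ↦ ∑ i ∈ s, ξ i x := by
  classical
  induction s using Finset.induction_on with
  | empty => simpa using isVelocity_zero f
  | insert a s ha ih =>
    simp only [Finset.sum_insert ha]
    exact (h a (Finset.mem_insert_self a s)).add hf
      (ih fun i hi ↦ h i (Finset.mem_insert_of_mem hi))

end DiffeoFamilies

/-! ### Existence of families with prescribed velocity -/

section TangentialCoordinates

open Matrix

variable {m q : ℕ}

/-- The coefficients, in the standard basis, of the preimage under the injective linear map `L` of
the orthogonal projection of `ξ` to the range of `L`. -/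
def tangentialCoords (L : EuclideanSpace ℝ (Fin m) →L[ℝ] EuclideanSpace ℝ (Fin q))
    (ξ : EuclideanSpace ℝ (Fin q)) : EuclideanSpace ℝ (Fin m) :=
  ∑ i, ((gram ℝ fun i ↦ L (EuclideanSpace.single i (1 : ℝ)))⁻¹ *ᵥ
    fun j ↦ inner ℝ (L (EuclideanSpace.single j (1 : ℝ))) ξ) i • EuclideanSpace.single i (1 : ℝ)

/-- The orthogonal projection by the normal equations; unlike the projection itself, the right side is
visibly smooth in `L`. -/
lemma starProjection_range {L : EuclideanSpace ℝ (Fin m) →L[ℝ] EuclideanSpace ℝ (Fin q)}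
    (hL : Function.Injective L) (ξ : EuclideanSpace ℝ (Fin q)) :
    L.range.starProjection ξ = L (tangentialCoords L ξ) := by
  set G := gram ℝ fun i ↦ L (EuclideanSpace.single i (1 : ℝ)) with hG
  have hdet : IsUnit G.det := by
    have := det_gram_pos L.toLinearMap hL (EuclideanSpace.basisFun (Fin m) ℝ).toBasis
    refine (ne_of_gt ?_).isUnit
    simpa [hG] using this
  refine Submodule.eq_starProjection_of_mem_of_inner_eq_zero ⟨_, rfl⟩ ?_
  have key : ∀ k, inner ℝ (ξ - L (tangentialCoords L ξ)) (L (EuclideanSpace.single k (1 : ℝ))) = 0 := by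
    intro k
    set b : Fin m → ℝ := fun j ↦ inner ℝ (L (EuclideanSpace.single j (1 : ℝ))) ξ with hb
    have h1 : inner ℝ (L (tangentialCoords L ξ)) (L (EuclideanSpace.single k (1 : ℝ))) =
        (G *ᵥ (G⁻¹ *ᵥ b)) k := by
      rw [tangentialCoords, map_sum, sum_inner]
      simp only [map_smul, inner_smul_left, conj_trivial]
      rw [mulVec, dotProduct]
      refine Finset.sum_congr rfl fun i _ ↦ ?_
      rw [hG, gram_apply, real_inner_comm, mul_comm]
    rw [inner_sub_left, h1, mulVec_mulVec, mul_nonsing_inv _ hdet, one_mulVec, hb, real_inner_comm,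
      sub_self]
  rintro _ ⟨v, rfl⟩
  have hv : v = ∑ k, v k • EuclideanSpace.single k (1 : ℝ) := by
    conv_lhs => rw [← (EuclideanSpace.basisFun (Fin m) ℝ).sum_repr v]
    simp
  rw [hv]
  simp only [ContinuousLinearMap.coe_coe, map_sum, map_smul, inner_sum, inner_smul_right]
  exact Finset.sum_eq_zero fun k _ ↦ by rw [key, mul_zero]

lemma contDiffAt_tangentialCoords {X : Type*} [NormedAddCommGroup X] [NormedSpace ℝ X]
    {L : X → EuclideanSpace ℝ (Fin m) →L[ℝ] EuclideanSpace ℝ (Fin q)}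
    {ξ : X → EuclideanSpace ℝ (Fin q)} {x : X} (hL : ContDiffAt ℝ ∞ L x) (hξ : ContDiffAt ℝ ∞ ξ x)
    (hinj : Function.Injective (L x)) :
    ContDiffAt ℝ ∞ (fun x ↦ tangentialCoords (L x) (ξ x)) x := by
  have hLi : ∀ i, ContDiffAt ℝ ∞ (fun x ↦ L x (EuclideanSpace.single i (1 : ℝ))) x :=
    fun i ↦ hL.clm_apply contDiffAt_const
  set G := fun x ↦ gram ℝ fun i ↦ L x (EuclideanSpace.single i (1 : ℝ)) with hG
  have hGij : ∀ i j, ContDiffAt ℝ ∞ (fun x ↦ G x i j) x := fun i j ↦ (hLi i).inner ℝ (hLi j)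
  have hdet : (G x).det ≠ 0 := by
    have := det_gram_pos (L x).toLinearMap hinj (EuclideanSpace.basisFun (Fin m) ℝ).toBasis
    refine ne_of_gt ?_
    simpa [hG] using this
  simp only [tangentialCoords, mulVec, dotProduct]
  exact ContDiffAt.sum fun i _ ↦ (ContDiffAt.sum fun j _ ↦
    (contDiffAt_inv_apply hGij hdet i j).mul ((hLi j).inner ℝ hξ)).smul contDiffAt_const

end TangentialCoordinates

section Existence

variable {m q : ℕ}
  {M : Type*} [TopologicalSpace M] [T2Space M] [ChartedSpace (EuclideanSpace ℝ (Fin m)) M]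
  [IsManifold (𝓡 m) ∞ M]

omit [T2Space M] in
lemma range_fderiv_comp_chartInv {g : M → EuclideanSpace ℝ (Fin q)} (x₀ : M) {x : M}
    (hx : x ∈ (chartAt (EuclideanSpace ℝ (Fin m)) x₀).source)
    (hg : MDifferentiableAt (𝓡 m) (𝓡 q) g x) :
    (fderiv ℝ (g ∘ chartInv x₀) (chartAt (EuclideanSpace ℝ (Fin m)) x₀ x)).range =
      (euclideanDifferential (m := m) g x).range := by
  have hz := (chartAt (EuclideanSpace ℝ (Fin m)) x₀).map_source hx
  have hxx : chartInv x₀ (chartAt (EuclideanSpace ℝ (Fin m)) x₀ x) = x :=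
    (chartAt (EuclideanSpace ℝ (Fin m)) x₀).left_inv hx
  have h : (fderiv ℝ (g ∘ chartInv x₀) (chartAt (EuclideanSpace ℝ (Fin m)) x₀ x)).range =
      (euclideanDifferential (m := m) g
        (chartInv x₀ (chartAt (EuclideanSpace ℝ (Fin m)) x₀ x))).range := by
    rw [← hxx] at hg
    apply le_antisymm
    · rintro _ ⟨v, rfl⟩
      exact ⟨_, euclideanDifferential_chartInv x₀ hz hg⟩
    · rintro _ ⟨v, rfl⟩
      obtain ⟨w, rfl⟩ := ((mdifferentiable_chart (I := 𝓡 m) x₀).symm.mfderiv hz).surjective v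
      exact ⟨w, (euclideanDifferential_chartInv x₀ hz hg).symm⟩
  rw [h, hxx]

open Classical in
/-- The map of `M` given by `k` in the chart around `x₀`, and by the identity outside of it. -/
def chartTransfer (x₀ : M) (k : EuclideanSpace ℝ (Fin m) → EuclideanSpace ℝ (Fin m)) (x : M) : M :=
  if x ∈ (chartAt (EuclideanSpace ℝ (Fin m)) x₀).source then
    chartInv x₀ (k (chartAt (EuclideanSpace ℝ (Fin m)) x₀ x)) else x

omit [T2Space M] [IsManifold (𝓡 m) ∞ M] in
lemma chartTransfer_chartTransfer (x₀ : M)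
    {k l : EuclideanSpace ℝ (Fin m) → EuclideanSpace ℝ (Fin m)}
    (hk : MapsTo k (chartAt (EuclideanSpace ℝ (Fin m)) x₀).target
      (chartAt (EuclideanSpace ℝ (Fin m)) x₀).target) (hlk : ∀ z, l (k z) = z) (x : M) :
    chartTransfer x₀ l (chartTransfer x₀ k x) = x := by
  by_cases hx : x ∈ (chartAt (EuclideanSpace ℝ (Fin m)) x₀).source
  · have h1 := hk ((chartAt (EuclideanSpace ℝ (Fin m)) x₀).map_source hx)
    have h2 := (chartAt (EuclideanSpace ℝ (Fin m)) x₀).map_target h1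
    rw [chartTransfer, chartTransfer, if_pos hx, if_pos h2, chartInv,
      (chartAt (EuclideanSpace ℝ (Fin m)) x₀).right_inv h1, hlk,
      (chartAt (EuclideanSpace ℝ (Fin m)) x₀).left_inv hx]
  · rw [chartTransfer, chartTransfer, if_neg hx, if_neg hx]

/-- A smooth family of maps of the target of a chart, equal to the identity outside of a compact set
`K`, defines a smooth family of maps of the manifold. -/
lemma contMDiffOn_chartTransfer (x₀ : M) {K : Set (EuclideanSpace ℝ (Fin m))} (hK : IsCompact K)
    (hKt : K ⊆ (chartAt (EuclideanSpace ℝ (Fin m)) x₀).target) {ε : ℝ}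
    {k : ℝ → EuclideanSpace ℝ (Fin m) → EuclideanSpace ℝ (Fin m)}
    (hk : ContDiffOn ℝ ∞ (fun p : ℝ × EuclideanSpace ℝ (Fin m) ↦ k p.1 p.2)
      (Ioo (-ε) ε ×ˢ univ))
    (hid : ∀ t ∈ Ioo (-ε) ε, ∀ z, z ∉ K → k t z = z)
    (hmaps : ∀ t ∈ Ioo (-ε) ε, MapsTo (k t) (chartAt (EuclideanSpace ℝ (Fin m)) x₀).target
      (chartAt (EuclideanSpace ℝ (Fin m)) x₀).target) :
    ContMDiffOn (𝓘(ℝ, ℝ).prod (𝓡 m)) (𝓡 m) ∞ (fun p : ℝ × M ↦ chartTransfer x₀ (k p.1) p.2)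
      (Ioo (-ε) ε ×ˢ univ) := by
  set φ := chartAt (EuclideanSpace ℝ (Fin m)) x₀ with hφ
  rintro ⟨t, x⟩ ⟨ht, -⟩
  refine ContMDiffAt.contMDiffWithinAt ?_
  by_cases hx : x ∈ φ.source
  · have h1 : ContMDiffAt (𝓘(ℝ, ℝ).prod (𝓡 m)) (𝓘(ℝ, ℝ).prod (𝓡 m)) ∞
        (fun p : ℝ × M ↦ (p.1, φ p.2)) (t, x) :=
      contMDiffAt_fst.prodMk ((contMDiffOn_chart.contMDiffAt
        (φ.open_source.mem_nhds hx)).comp (t, x) contMDiffAt_snd)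
    have h2 : ContMDiffAt (𝓘(ℝ, ℝ).prod (𝓡 m)) (𝓡 m) ∞
        (fun p : ℝ × EuclideanSpace ℝ (Fin m) ↦ k p.1 p.2) (t, φ x) := by
      have := hk.contDiffAt ((isOpen_Ioo.prod isOpen_univ).mem_nhds
        (show (t, φ x) ∈ Ioo (-ε) ε ×ˢ univ from ⟨ht, mem_univ _⟩))
      rwa [← contMDiffAt_iff_contDiffAt, modelWithCornersSelf_prod, ← chartedSpaceSelf_prod] at this
    have h3 := contMDiffAt_chartInv (m := m) x₀ (hmaps t ht (φ.map_source hx))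
    have h4 := ContMDiffAt.comp (t, x) (f := fun p : ℝ × M ↦ k p.1 (φ p.2)) h3
      (ContMDiffAt.comp (t, x) h2 h1)
    refine h4.congr_of_eventuallyEq ?_
    have hev : ∀ᶠ p : ℝ × M in 𝓝 (t, x), p.2 ∈ φ.source :=
      continuousAt_snd.eventually (φ.open_source.mem_nhds hx)
    filter_upwards [hev] with p hp
    simp only [chartTransfer, ← hφ, if_pos hp]
    rfl
  · have hcl : IsClosed (φ.symm '' K) :=
      (hK.image_of_continuousOn (φ.continuousOn_symm.mono hKt)).isClosed
    have hxK : x ∉ φ.symm '' K := by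
      rintro ⟨z, hz, rfl⟩
      exact hx (φ.map_target (hKt hz))
    refine contMDiffAt_snd.congr_of_eventuallyEq ?_
    filter_upwards [(isOpen_Ioo.prod hcl.isOpen_compl).mem_nhds ⟨ht, hxK⟩] with p hp
    by_cases hs : p.2 ∈ φ.source
    · have hpK : φ p.2 ∉ K := fun h ↦ hp.2 ⟨_, h, φ.left_inv hs⟩
      simp only [chartTransfer, ← hφ, if_pos hs, hid p.1 hp.1 _ hpK, chartInv, φ.left_inv hs]
    · simp only [chartTransfer, ← hφ, if_neg hs]

open Classical in
/-- Vector fields with compact support in a chart are velocities: in the chart, the family is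
`z ↦ z + t Y(z)`. -/
lemma isVelocity_of_chart {f : M → EuclideanSpace ℝ (Fin q)} (hf : ContMDiff (𝓡 m) (𝓡 q) ∞ f)
    (x₀ : M) {K : Set (EuclideanSpace ℝ (Fin m))} (hK : IsCompact K)
    (hKt : K ⊆ (chartAt (EuclideanSpace ℝ (Fin m)) x₀).target)
    {Y : EuclideanSpace ℝ (Fin m) → EuclideanSpace ℝ (Fin m)} (hY : ContDiff ℝ ∞ Y)
    (hYK : ∀ z, z ∉ K → Y z = 0) {ξ : M → EuclideanSpace ℝ (Fin q)}
    (hξ : ∀ x ∈ (chartAt (EuclideanSpace ℝ (Fin m)) x₀).source,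
      fderiv ℝ (f ∘ chartInv x₀) (chartAt (EuclideanSpace ℝ (Fin m)) x₀ x)
        (Y (chartAt (EuclideanSpace ℝ (Fin m)) x₀ x)) = ξ x)
    (hξ0 : ∀ x ∉ (chartAt (EuclideanSpace ℝ (Fin m)) x₀).source, ξ x = 0) :
    IsVelocity (m := m) f ξ := by
  set φ := chartAt (EuclideanSpace ℝ (Fin m)) x₀ with hφ
  obtain ⟨C, hC⟩ := hY.lipschitzWith_of_hasCompactSupport
    (HasCompactSupport.intro hK hYK) (by simp)
  -- For `|t| < ε`, the map `z ↦ t Y(z)` is a contraction.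
  obtain ⟨ε, hε, hεC⟩ : ∃ ε : ℝ, 0 < ε ∧ ε * C < 1 := by
    refine ⟨1 / (C + 1), by positivity, ?_⟩
    rw [div_mul_eq_mul_div, one_mul, div_lt_one (by positivity)]
    linarith
  have hsmall : ∀ t ∈ Ioo (-ε) ε, ‖t‖₊ * C < 1 := by
    intro t ht
    have h1 : ‖t‖ * C ≤ ε * C := by
      gcongr
      exact (abs_lt.2 ht).le
    have h2 : ‖t‖ * (C : ℝ) < 1 := h1.trans_lt hεC
    exact_mod_cast h2
  let k : ℝ → EuclideanSpace ℝ (Fin m) → EuclideanSpace ℝ (Fin m) := fun t z ↦ z + t • Y z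
  let l : ℝ → EuclideanSpace ℝ (Fin m) → EuclideanSpace ℝ (Fin m) := fun t ↦ Function.invFun (k t)
  have hbij : ∀ t ∈ Ioo (-ε) ε, Function.Bijective (k t) := fun t ht ↦
    bijective_add_smul hC (hsmall t ht)
  have hlk : ∀ t ∈ Ioo (-ε) ε, ∀ z, l t (k t z) = z := fun t ht ↦
    Function.leftInverse_invFun (hbij t ht).1
  have hkl : ∀ t ∈ Ioo (-ε) ε, ∀ z, k t (l t z) = z := fun t ht ↦
    Function.rightInverse_invFun (hbij t ht).2
  have hkid : ∀ t, ∀ z, z ∉ K → k t z = z := fun t z hz ↦ by simp [k, hYK z hz]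
  have hlid : ∀ t ∈ Ioo (-ε) ε, ∀ z, z ∉ K → l t z = z := fun t ht z hz ↦ by
    conv_lhs => rw [← hkid t z hz]
    exact hlk t ht z
  have hkK : ∀ t ∈ Ioo (-ε) ε, ∀ z ∈ K, k t z ∈ K := by
    intro t ht z hz
    by_contra h
    rw [(hbij t ht).1 (hkid t _ h)] at h
    exact h hz
  have hlK : ∀ t ∈ Ioo (-ε) ε, ∀ z ∈ K, l t z ∈ K := by
    intro t ht z hz
    by_contra h
    have h1 := hkid t _ h
    rw [hkl t ht] at h1
    exact h (h1 ▸ hz)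
  have hkmaps : ∀ t ∈ Ioo (-ε) ε, MapsTo (k t) φ.target φ.target := by
    intro t ht z hz
    by_cases h : z ∈ K
    · exact hKt (hkK t ht z h)
    · rwa [hkid t z h]
  have hlmaps : ∀ t ∈ Ioo (-ε) ε, MapsTo (l t) φ.target φ.target := by
    intro t ht z hz
    by_cases h : z ∈ K
    · exact hKt (hlK t ht z h)
    · rwa [hlid t ht z h]
  have hksmooth : ContDiff ℝ ∞ fun p : ℝ × EuclideanSpace ℝ (Fin m) ↦ k p.1 p.2 :=
    contDiff_snd.add (contDiff_fst.smul (hY.comp contDiff_snd))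
  refine ⟨ε, fun t ↦ chartTransfer x₀ (k t), fun t ↦ chartTransfer x₀ (l t),
    ⟨hε, contMDiffOn_chartTransfer x₀ hK hKt hksmooth.contDiffOn (fun t _ ↦ hkid t) hkmaps,
      contMDiffOn_chartTransfer x₀ hK hKt (contDiffOn_invFun_add_smul hY hC hsmall) hlid hlmaps,
      fun t ht x ↦ chartTransfer_chartTransfer x₀ (hkmaps t ht) (hlk t ht) x,
      fun t ht x ↦ chartTransfer_chartTransfer x₀ (hlmaps t ht) (hkl t ht) x, fun x ↦ ?_⟩,
    fun x ↦ ?_⟩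
  · by_cases hx : x ∈ φ.source
    · simp only [chartTransfer, ← hφ, if_pos hx, k, zero_smul, add_zero, chartInv, φ.left_inv hx]
    · simp only [chartTransfer, ← hφ, if_neg hx]
  · by_cases hx : x ∈ φ.source
    · simp only [chartTransfer, ← hφ, if_pos hx]
      have h1 : DifferentiableAt ℝ (f ∘ chartInv x₀) (φ x) :=
        (contDiffAt_comp_chartInv x₀ (φ.map_source hx) hf.contMDiffAt).differentiableAt (by simp)
      have h2 : HasDerivAt (fun t : ℝ ↦ k t (φ x)) (Y (φ x)) 0 := by
        refine HasDerivAt.congr_deriv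
          (((hasDerivAt_id (0 : ℝ)).smul_const (Y (φ x))).const_add (φ x)) (one_smul ℝ _)
      have h3 : k 0 (φ x) = φ x := by simp [k]
      rw [← h3] at h1
      have h4 := h1.hasFDerivAt.comp_hasDerivAt 0 h2
      rw [h3, hξ x hx] at h4
      exact h4
    · simp only [chartTransfer, ← hφ, if_neg hx, hξ0 x hx]
      exact hasDerivAt_const _ _

variable [CompactSpace M] [RiemannianBundle (fun x : M ↦ TangentSpace (𝓡 m) x)]

/-- Every smooth tangential `ℝ^q`-valued function is the velocity of a smooth family of
diffeomorphisms. -/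
lemma isVelocity_of_tangential {f : M → EuclideanSpace ℝ (Fin q)}
    (hf : IsIsometricImmersion (m := m) f) {ξ : M → EuclideanSpace ℝ (Fin q)}
    (hξ : ContMDiff (𝓡 m) (𝓡 q) ∞ ξ)
    (htan : ∀ x, ξ x ∈ (euclideanDifferential (m := m) f x).range) : IsVelocity (m := m) f ξ := by
  classical
  obtain ⟨ρ, hρ⟩ := SmoothPartitionOfUnity.exists_isSubordinate_chartAt_source (𝓡 m) M
  have hfin : {i | (Function.support (ρ i)).Nonempty}.Finite :=
    ρ.locallyFinite.finite_nonempty_of_compact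
  have hsum : ∀ x, ∑ i ∈ hfin.toFinset, ρ i x • ξ x = ξ x := by
    intro x
    rw [← Finset.sum_smul]
    have h1 := ρ.sum_eq_one (mem_univ x)
    rw [finsum_eq_sum_of_support_subset (s := hfin.toFinset)] at h1
    · rw [h1, one_smul]
    · intro i hi
      simp only [Finite.coe_toFinset, mem_ofPred_eq]
      exact ⟨x, hi⟩
  have key : ∀ i, IsVelocity (m := m) f fun x ↦ ρ i x • ξ x := by
    intro i
    set φ := chartAt (EuclideanSpace ℝ (Fin m)) i with hφ
    have hsub : tsupport (ρ i) ⊆ φ.source := hρ i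
    -- The coordinates of the vector field `ρ i • ξ` in the chart around `i`.
    let Y : EuclideanSpace ℝ (Fin m) → EuclideanSpace ℝ (Fin m) := fun z ↦
      if z ∈ φ.target then ρ i (chartInv i z) •
        tangentialCoords (fderiv ℝ (f ∘ chartInv i) z) (ξ (chartInv i z)) else 0
    have hKc : IsCompact (φ '' tsupport (ρ i)) :=
      ((isClosed_tsupport _).isCompact).image_of_continuousOn (φ.continuousOn.mono hsub)
    have hKt : φ '' tsupport (ρ i) ⊆ φ.target := by
      rintro _ ⟨x, hx, rfl⟩
      exact φ.map_source (hsub hx)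
    have hYK : ∀ z, z ∉ φ '' tsupport (ρ i) → Y z = 0 := by
      intro z hz
      by_cases h : z ∈ φ.target
      · have h1 : ρ i (chartInv i z) = 0 := by
          by_contra hne
          exact hz ⟨chartInv i z, subset_tsupport _ hne, φ.right_inv h⟩
        simp only [Y, h1, zero_smul, ite_self]
      · simp only [Y, if_neg h]
    have hY : ContDiff ℝ ∞ Y := by
      rw [contDiff_iff_contDiffAt]
      intro z
      by_cases hz : z ∈ φ.target
      · have h1 : ContDiffAt ℝ ∞ (fun z ↦ ρ i (chartInv i z)) z := by
          rw [← contMDiffAt_iff_contDiffAt]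
          exact ((ρ i).contMDiff.contMDiffAt).comp z (contMDiffAt_chartInv i hz)
        have h2 : ContDiffAt ℝ ∞ (fderiv ℝ (f ∘ chartInv i)) z :=
          (contDiffAt_comp_chartInv i hz hf.contMDiff.contMDiffAt).fderiv_right (by simp)
        have h3 : ContDiffAt ℝ ∞ (fun z ↦ ξ (chartInv i z)) z :=
          contDiffAt_comp_chartInv i hz hξ.contMDiffAt
        refine (h1.smul (contDiffAt_tangentialCoords h2 h3
          (fderiv_comp_chartInv_injective hf i hz))).congr_of_eventuallyEq ?_
        filter_upwards [φ.open_target.mem_nhds hz] with w hw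
        simp only [Y, if_pos hw]
        rfl
      · refine contDiffAt_const (c := 0) |>.congr_of_eventuallyEq ?_
        filter_upwards [hKc.isClosed.isOpen_compl.mem_nhds fun h ↦ hz (hKt h)] with w hw
        exact hYK w hw
    refine isVelocity_of_chart hf.contMDiff i hKc hKt hY hYK (fun x hx ↦ ?_) (fun x hx ↦ ?_)
    · have hz : φ x ∈ φ.target := φ.map_source hx
      have hxx : chartInv i (φ x) = x := φ.left_inv hx
      rw [← hφ]
      simp only [Y, if_pos hz, hxx, map_smul]
      rw [← starProjection_range (fderiv_comp_chartInv_injective hf i hz)]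
      congr 1
      refine Submodule.starProjection_eq_self_iff.2 ?_
      rw [range_fderiv_comp_chartInv i hx (hf.mdifferentiableAt x)]
      exact htan x
    · have : ρ i x = 0 := by
        by_contra hne
        exact hx (hsub (subset_tsupport _ hne))
      rw [this, zero_smul]
  have := IsVelocity.sum hf.contMDiff hfin.toFinset (ξ := fun i x ↦ ρ i x • ξ x) fun i _ ↦ key i
  simpa only [hsum] using this

end Existence

/-! ### First and second derivative of the energy integrand -/

section Derivatives

open Matrix
open scoped Matrix.Norms.Operator

variable {m n q : ℕ}
  {M : Type*} [TopologicalSpace M] [ChartedSpace (EuclideanSpace ℝ (Fin m)) M]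
  [IsManifold (𝓡 m) ∞ M]

/-- The differential of the preferred chart around `x`, at `x`. -/
def chartDifferential (x : M) : TangentSpace (𝓡 m) x →L[ℝ] EuclideanSpace ℝ (Fin m) :=
  mfderiv (𝓡 m) (𝓡 m) (chartAt (EuclideanSpace ℝ (Fin m)) x) x

/-- The differential at `x` in the preferred chart around `x`. -/
lemma euclideanDifferential_eq {g : M → EuclideanSpace ℝ (Fin q)} {x : M}
    (hg : MDifferentiableAt (𝓡 m) (𝓡 q) g x) (v : TangentSpace (𝓡 m) x) :
    euclideanDifferential g x v = fderiv ℝ (g ∘ chartInv x)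
      (chartAt (EuclideanSpace ℝ (Fin m)) x x) (chartDifferential x v) := by
  set φ := chartAt (EuclideanSpace ℝ (Fin m)) x with hφ
  have hx : x ∈ φ.source := mem_chart_source (EuclideanSpace ℝ (Fin m)) x
  have hz := φ.map_source hx
  have hxx : chartInv x (φ x) = x := φ.left_inv hx
  have hg' : MDifferentiableAt (𝓡 m) (𝓡 q) (g ∘ chartInv x) (φ x) := by
    rw [← hxx] at hg
    exact hg.comp _ (mdifferentiableAt_chartInv x hz)
  have hev : g =ᶠ[𝓝 x] (g ∘ chartInv x) ∘ φ := by
    filter_upwards [φ.open_source.mem_nhds hx] with y hy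
    simp only [Function.comp_apply, chartInv, ← hφ, φ.left_inv hy]
  rw [← mfderiv_eq_fderiv, euclideanDifferential, hev.mfderiv_eq, mfderiv_comp x hg'
    ((mdifferentiable_chart (I := 𝓡 m) x).mdifferentiableAt hx)]
  rfl

omit [IsManifold (𝓡 m) ∞ M] in
lemma SmoothFamily.contMDiff {X : Type*} [NormedAddCommGroup X] [NormedSpace ℝ X] {ε : ℝ}
    {F : ℝ → M → X} (hF : SmoothFamily m ε F) {t : ℝ}
    (ht : t ∈ Ioo (-ε) ε) : ContMDiff (𝓡 m) 𝓘(ℝ, X) ∞ (F t) := fun x ↦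
  (hF.contMDiffAt ht x).comp (f := fun y : M ↦ (t, y)) x (contMDiffAt_const.prodMk contMDiffAt_id)

/-- The mixed second derivatives agree. -/
lemma hasDerivAt_fderiv_inr {E X : Type*} [NormedAddCommGroup E] [NormedSpace ℝ E]
    [NormedAddCommGroup X] [NormedSpace ℝ X] {K : ℝ × E → X} {t : ℝ} {z : E}
    (hK : ContDiffAt ℝ ∞ K (t, z)) (a : E) :
    HasDerivAt (fun s ↦ fderiv ℝ K (s, z) (0, a))
      (fderiv ℝ (fun w ↦ fderiv ℝ K (t, w) (1, 0)) z a) t := by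
  have hK2 : HasFDerivAt (fderiv ℝ K) (fderiv ℝ (fderiv ℝ K) (t, z)) (t, z) :=
    ((hK.fderiv_right (m := ∞) (by simp)).differentiableAt (by simp)).hasFDerivAt
  have hsymm : IsSymmSndFDerivAt ℝ K (t, z) :=
    hK.isSymmSndFDerivAt (by
      rw [minSmoothness_of_isRCLikeNormedField]
      exact WithTop.coe_le_coe.2 le_top)
  have h1 : HasFDerivAt (fun w : E ↦ (t, w)) (ContinuousLinearMap.inr ℝ ℝ E) z :=
    hasFDerivAt_prodMk_right _ _
  have h2 : HasFDerivAt (fun w ↦ fderiv ℝ K (t, w)) _ z := hK2.comp z h1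
  have h3 : HasDerivAt (fun s : ℝ ↦ (s, z)) ((1 : ℝ), (0 : E)) t :=
    (hasDerivAt_id _).prodMk (hasDerivAt_const _ _)
  have h4 : HasDerivAt (fun s ↦ fderiv ℝ K (s, z)) _ t := hK2.comp_hasDerivAt t h3
  have h5 : fderiv ℝ (fun w ↦ fderiv ℝ K (t, w) (1, 0)) z a =
      fderiv ℝ (fderiv ℝ K) (t, z) (1, 0) (0, a) := by
    rw [(h2.clm_apply (hasFDerivAt_const ((1 : ℝ), (0 : E)) z)).fderiv, hsymm]
    simp
  rw [h5]
  have h6 := h4.clm_apply (hasDerivAt_const t ((0 : ℝ), a))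
  rw [map_zero, add_zero] at h6
  exact h6

/-- The `t`-derivative commutes with the differential. -/
lemma SmoothFamily.hasDerivAt_euclideanDifferential {ε : ℝ}
    {F : ℝ → M → EuclideanSpace ℝ (Fin q)} (hF : SmoothFamily m ε F) {t : ℝ}
    (ht : t ∈ Ioo (-ε) ε) (x : M) (v : TangentSpace (𝓡 m) x) :
    HasDerivAt (fun s ↦ euclideanDifferential (F s) x v)
      (euclideanDifferential (fun y ↦ _root_.deriv (fun s ↦ F s y) t) x v) t := by
  set φ := chartAt (EuclideanSpace ℝ (Fin m)) x with hφ
  have hz : φ x ∈ φ.target := φ.map_source (mem_chart_source (EuclideanSpace ℝ (Fin m)) x)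
  obtain ⟨a, ha⟩ : ∃ a, a = chartDifferential x v := ⟨_, rfl⟩
  obtain ⟨K, hK⟩ : ∃ K, K = fun p : ℝ × EuclideanSpace ℝ (Fin m) ↦ F p.1 (chartInv x p.2) :=
    ⟨_, rfl⟩
  have hKd : ∀ s ∈ Ioo (-ε) ε, ∀ w ∈ φ.target, ContDiffAt ℝ ∞ K (s, w) := fun s hs w hw ↦ by
    rw [hK]
    exact hF.contDiffAt hs x hw
  have e1 : ∀ s ∈ Ioo (-ε) ε, euclideanDifferential (F s) x v = fderiv ℝ K (s, φ x) (0, a) := by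
    intro s hs
    rw [euclideanDifferential_eq ((hF.contMDiff hs).mdifferentiableAt (by simp)), ← ha]
    have h2 := ((hKd s hs _ hz).differentiableAt (by simp)).hasFDerivAt
    have h3 : HasFDerivAt (fun z : EuclideanSpace ℝ (Fin m) ↦ (s, z))
        (ContinuousLinearMap.inr ℝ ℝ _) (φ x) := hasFDerivAt_prodMk_right _ _
    have h4 := h2.comp (φ x) h3
    rw [show F s ∘ chartInv x = K ∘ fun z ↦ (s, z) by rw [hK]; rfl, ← hφ, h4.fderiv]
    rfl
  have e2 : euclideanDifferential (fun y ↦ _root_.deriv (fun s ↦ F s y) t) x v =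
      fderiv ℝ (fun w ↦ fderiv ℝ K (t, w) (1, 0)) (φ x) a := by
    rw [euclideanDifferential_eq ((hF.deriv.contMDiff ht).mdifferentiableAt (by simp)), ← ha]
    have h1 : (fun y ↦ _root_.deriv (fun s ↦ F s y) t) ∘ chartInv x =ᶠ[𝓝 (φ x)]
        fun w ↦ fderiv ℝ K (t, w) (1, 0) := by
      filter_upwards [φ.open_target.mem_nhds hz] with w hw
      have h2 := ((hKd t ht w hw).differentiableAt (by simp)).hasFDerivAt
      have h3 : HasDerivAt (fun s : ℝ ↦ ((s, w) : ℝ × EuclideanSpace ℝ (Fin m))) (1, 0) t :=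
        (hasDerivAt_id _).prodMk (hasDerivAt_const _ _)
      have h4 := (h2.comp_hasDerivAt t h3).deriv
      rw [← h4, hK]
      rfl
    rw [← hφ, h1.fderiv_eq]
  rw [e2]
  refine (hasDerivAt_fderiv_inr (hKd t ht _ hz) a).congr_of_eventuallyEq ?_
  filter_upwards [isOpen_Ioo.mem_nhds ht] with s hs
  exact e1 s hs

/-- The symmetric part `⟨dg(eᵢ), df(eⱼ)⟩ + ⟨df(eᵢ), dg(eⱼ)⟩`: the derivative of the metric induced
by `f` when `f` moves with velocity `g`. -/
def symProduct (f g : M → EuclideanSpace ℝ (Fin q)) (x : M) (e : Fin m → TangentSpace (𝓡 m) x) :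
    Matrix (Fin m) (Fin m) ℝ :=
  of fun i j ↦ inner ℝ (euclideanDifferential g x (e i)) (euclideanDifferential f x (e j)) +
    inner ℝ (euclideanDifferential f x (e i)) (euclideanDifferential g x (e j))

lemma hasDerivAt_matrix {ι : Type*} [Fintype ι] [DecidableEq ι] {G : ℝ → Matrix ι ι ℝ}
    {G' : Matrix ι ι ℝ} {t : ℝ} (h : ∀ i j, HasDerivAt (fun s ↦ G s i j) (G' i j) t) :
    HasDerivAt G G' t :=
  hasDerivAt_pi.2 fun i ↦ hasDerivAt_pi.2 fun j ↦ h i j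

variable [RiemannianBundle (fun x : M ↦ TangentSpace (𝓡 m) x)]
  {N : Type*} [TopologicalSpace N] [ChartedSpace (EuclideanSpace ℝ (Fin n)) N]
  [RiemannianBundle (fun y : N ↦ TangentSpace (𝓡 n) y)]

/-- The first derivative at `t = 0` of the energy integrand, and the derivative of its derivative,
for a family of immersions `F` starting at the isometric immersion `f`. -/
lemma hasDerivAt_energyIntegrand {f : M → EuclideanSpace ℝ (Fin q)}
    (hf : IsIsometricImmersion (m := m) f) (u : M → N) {ε : ℝ} (hε : 0 < ε)
    {F : ℝ → M → EuclideanSpace ℝ (Fin q)} (hF : SmoothFamily m ε F) (h0 : F 0 = f)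
    (hinj : ∀ t ∈ Ioo (-ε) ε, ∀ x, Function.Injective (euclideanDifferential (m := m) (F t) x))
    (x : M) (e : OrthonormalBasis (Fin m) ℝ (TangentSpace (𝓡 m) x))
    {H : Matrix (Fin m) (Fin m) ℝ}
    (hH : H = gram ℝ fun i ↦ mfderiv (𝓡 m) (𝓡 n) u x (e i)) {ξ η : M → EuclideanSpace ℝ (Fin q)}
    (hξ : ξ = fun y ↦ deriv (fun s ↦ F s y) 0)
    (hη : η = fun y ↦ deriv (deriv fun s ↦ F s y) 0) :
    deriv (fun t ↦ energyIntegrand m n f (F t) u x) 0 = firstVar H (symProduct f ξ x e) ∧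
    deriv (deriv fun t ↦ energyIntegrand m n f (F t) u x) 0 =
      secondVar H (symProduct f ξ x e) + firstVar H
        ((2 : ℝ) • (gram ℝ fun i ↦ euclideanDifferential ξ x (e i)) + symProduct f η x e) := by
  have h0I : (0 : ℝ) ∈ Ioo (-ε) ε := ⟨neg_lt_zero.2 hε, hε⟩
  set d : ℝ → Fin m → EuclideanSpace ℝ (Fin q) := fun t i ↦ euclideanDifferential (F t) x (e i)
  set d' : ℝ → Fin m → EuclideanSpace ℝ (Fin q) := fun t i ↦
    euclideanDifferential (fun y ↦ deriv (fun s ↦ F s y) t) x (e i)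
  have hd : ∀ t ∈ Ioo (-ε) ε, ∀ i, HasDerivAt (fun s ↦ d s i) (d' t i) t := fun t ht i ↦
    hF.hasDerivAt_euclideanDifferential ht x (e i)
  have hd' : ∀ i, HasDerivAt (fun s ↦ d' s i) (euclideanDifferential η x (e i)) 0 := fun i ↦ by
    rw [hη]
    exact hF.deriv.hasDerivAt_euclideanDifferential h0I x (e i)
  set G : ℝ → Matrix (Fin m) (Fin m) ℝ := fun t ↦ gram ℝ fun i ↦ d t i with hG
  set G' : ℝ → Matrix (Fin m) (Fin m) ℝ := fun t ↦
    of fun i j ↦ inner ℝ (d' t i) (d t j) + inner ℝ (d t i) (d' t j) with hG'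
  have hGd : ∀ t ∈ Ioo (-ε) ε, HasDerivAt G (G' t) t := fun t ht ↦ hasDerivAt_matrix fun i j ↦ by
    have := (hd t ht i).inner ℝ (hd t ht j)
    exact this.congr_deriv (add_comm _ _)
  have hG'0 : G' 0 = symProduct f ξ x e := by
    ext i j
    simp only [hG', symProduct, of_apply, d, d', h0, hξ]
  have hGd' : HasDerivAt G' ((2 : ℝ) • (gram ℝ fun i ↦ euclideanDifferential ξ x (e i)) +
      symProduct f η x e) 0 := hasDerivAt_matrix fun i j ↦ by
    have := ((hd' i).inner ℝ (hd 0 h0I j)).add ((hd 0 h0I i).inner ℝ (hd' j))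
    refine HasDerivAt.congr_deriv this ?_
    simp only [Matrix.add_apply, Matrix.smul_apply, smul_eq_mul, gram_apply, symProduct, of_apply, d, d', h0, hξ]
    ring
  have horth : ∀ i j, inner ℝ (euclideanDifferential f x (e i)) (euclideanDifferential f x (e j)) =
      (1 : Matrix (Fin m) (Fin m) ℝ) i j := fun i j ↦ by
    rw [hf.inner_map, orthonormal_iff_ite.1 e.orthonormal, one_apply]
  have hG0 : G 0 = 1 := by
    ext i j
    simp only [hG, gram_apply, d, h0, horth]
  have hone : (gram ℝ fun i ↦ euclideanDifferential f x (e i)) = 1 := by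
    ext i j
    rw [gram_apply, horth]
  have hpos : ∀ t ∈ Ioo (-ε) ε, 0 < (G t).det := fun t ht ↦ by
    have := det_gram_pos (euclideanDifferential (F t) x).toLinearMap (hinj t ht x) e.toBasis
    simpa [hG, d] using this
  have hval : (fun t ↦ energyIntegrand m n f (F t) u x) = fun t ↦ volDensity (G t) H := by
    ext1 t
    rw [energyIntegrand_eq f (F t) u x e.toBasis]
    simp only [OrthonormalBasis.coe_toBasis, hone, det_one, Real.sqrt_one, div_one, ← hH]
    rfl
  have hfirst : ∀ t ∈ Ioo (-ε) ε, HasDerivAt (fun t ↦ volDensity (G t) H)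
      (√((G t).det) * firstVar ((G t)⁻¹ * H) ((G t)⁻¹ * G' t)) t := fun t ht ↦
    hasDerivAt_volDensity H (hGd t ht) (hpos t ht)
  rw [hval]
  constructor
  · rw [(hfirst 0 h0I).deriv, hG0, hG'0]
    simp
  · have h1 := hasDerivAt_deriv_volDensity H (hGd 0 h0I) hGd' hG0
    rw [hG'0] at h1
    refine (h1.congr_of_eventuallyEq ?_).deriv
    filter_upwards [isOpen_Ioo.mem_nhds h0I] with t ht
    exact (hfirst t ht).deriv

end Derivatives

/-! ### Tangential and normal fields along an isometric immersion -/

section Immersion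

variable {m q : ℕ}
  {M : Type*} [TopologicalSpace M] [ChartedSpace (EuclideanSpace ℝ (Fin m)) M]
  [IsManifold (𝓡 m) ∞ M]

omit [IsManifold (𝓡 m) ∞ M] in
lemma eventually_chartAt_mem_target (x : M) :
    ∀ᶠ w in 𝓝 (chartAt (EuclideanSpace ℝ (Fin m)) x x),
      w ∈ (chartAt (EuclideanSpace ℝ (Fin m)) x).target :=
  (chartAt (EuclideanSpace ℝ (Fin m)) x).open_target.mem_nhds
    ((chartAt (EuclideanSpace ℝ (Fin m)) x).map_source (mem_chart_source _ x))

lemma starProjection_congr {X : Type*} [NormedAddCommGroup X] [InnerProductSpace ℝ X]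
    {S T : Submodule ℝ X} [S.HasOrthogonalProjection] [T.HasOrthogonalProjection] (h : S = T)
    (ξ : X) : S.starProjection ξ = T.starProjection ξ := by
  subst h
  rfl

/-- The Hessian of `f` at `x` in the preferred chart. -/
def chartHessian (f : M → EuclideanSpace ℝ (Fin q)) (x : M) :
    EuclideanSpace ℝ (Fin m) →L[ℝ] EuclideanSpace ℝ (Fin m) →L[ℝ] EuclideanSpace ℝ (Fin q) :=
  fderiv ℝ (fderiv ℝ (f ∘ chartInv x)) (chartAt (EuclideanSpace ℝ (Fin m)) x x)

lemma hasFDerivAt_fderiv_comp_chartInv {f : M → EuclideanSpace ℝ (Fin q)}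
    (hf : ContMDiff (𝓡 m) (𝓡 q) ∞ f) (x : M) :
    HasFDerivAt (fderiv ℝ (f ∘ chartInv x)) (chartHessian f x)
      (chartAt (EuclideanSpace ℝ (Fin m)) x x) :=
  (((contDiffAt_comp_chartInv x (eventually_chartAt_mem_target x).self_of_nhds
    hf.contMDiffAt).fderiv_right (m := ∞) (by simp)).differentiableAt (by simp)).hasFDerivAt

lemma chartHessian_comm {f : M → EuclideanSpace ℝ (Fin q)}
    (hf : ContMDiff (𝓡 m) (𝓡 q) ∞ f) (x : M) (a b : EuclideanSpace ℝ (Fin m)) :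
    chartHessian f x a b = chartHessian f x b a := by
  have h : ContDiffAt ℝ ∞ (f ∘ chartInv x) (chartAt (EuclideanSpace ℝ (Fin m)) x x) :=
    contDiffAt_comp_chartInv x (eventually_chartAt_mem_target x).self_of_nhds hf.contMDiffAt
  exact (h.isSymmSndFDerivAt (by
    rw [minSmoothness_of_isRCLikeNormedField]
    exact WithTop.coe_le_coe.2 le_top)) a b

omit [IsManifold (𝓡 m) ∞ M] in
lemma secondFundamentalForm_eq (f : M → EuclideanSpace ℝ (Fin q)) (x : M)
    (v w : TangentSpace (𝓡 m) x) : secondFundamentalForm f x v w =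
      ((euclideanDifferential (m := m) f x).range)ᗮ.starProjection
        (chartHessian f x (chartDifferential x v) (chartDifferential x w)) := rfl

lemma secondFundamentalForm_comm {f : M → EuclideanSpace ℝ (Fin q)}
    (hf : ContMDiff (𝓡 m) (𝓡 q) ∞ f) (x : M) (v w : TangentSpace (𝓡 m) x) :
    secondFundamentalForm f x v w = secondFundamentalForm f x w v := by
  rw [secondFundamentalForm_eq, secondFundamentalForm_eq, chartHessian_comm hf]

omit [IsManifold (𝓡 m) ∞ M] in
lemma secondFundamentalForm_sum_right (f : M → EuclideanSpace ℝ (Fin q)) (x : M)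
    (v : TangentSpace (𝓡 m) x) {ι : Type*} (s : Finset ι) (c : ι → ℝ)
    (w : ι → TangentSpace (𝓡 m) x) :
    secondFundamentalForm f x v (∑ k ∈ s, c k • w k) =
      ∑ k ∈ s, c k • secondFundamentalForm f x v (w k) := by
  simp only [secondFundamentalForm_eq, map_sum, map_smul]

omit [IsManifold (𝓡 m) ∞ M] in
lemma inner_secondFundamentalForm {f : M → EuclideanSpace ℝ (Fin q)} {x : M}
    (v w : TangentSpace (𝓡 m) x) {ν : EuclideanSpace ℝ (Fin q)}
    (hν : ν ∈ (euclideanDifferential (m := m) f x).rangeᗮ) :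
    inner ℝ (secondFundamentalForm f x v w) ν =
      inner ℝ (chartHessian f x (chartDifferential x v) (chartDifferential x w)) ν := by
  rw [secondFundamentalForm_eq, Submodule.inner_starProjection_left_eq_right,
    Submodule.starProjection_eq_self_iff.2 hν]

omit [IsManifold (𝓡 m) ∞ M] in
lemma secondFundamentalForm_mem (f : M → EuclideanSpace ℝ (Fin q)) (x : M)
    (v w : TangentSpace (𝓡 m) x) :
    secondFundamentalForm f x v w ∈ (euclideanDifferential (m := m) f x).rangeᗮ :=
  Submodule.starProjection_apply_mem _ _

/-- The Weingarten equation: the tangential part of the derivative of a normal field is given by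
the second fundamental form. -/
lemma inner_euclideanDifferential_of_normal {f : M → EuclideanSpace ℝ (Fin q)}
    (hf : ContMDiff (𝓡 m) (𝓡 q) ∞ f) {β : M → EuclideanSpace ℝ (Fin q)}
    (hβ : ContMDiff (𝓡 m) (𝓡 q) ∞ β)
    (hnor : ∀ y, β y ∈ (euclideanDifferential (m := m) f y).rangeᗮ) (x : M)
    (v w : TangentSpace (𝓡 m) x) :
    inner ℝ (euclideanDifferential f x w) (euclideanDifferential β x v) =
      -inner ℝ (secondFundamentalForm f x v w) (β x) := by
  rw [inner_secondFundamentalForm v w (hnor x),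
    euclideanDifferential_eq ((hf x).mdifferentiableAt (by simp)),
    euclideanDifferential_eq ((hβ x).mdifferentiableAt (by simp))]
  generalize chartDifferential x v = a
  generalize chartDifferential x w = b
  set φ := chartAt (EuclideanSpace ℝ (Fin m)) x with hφ
  have hβd : HasFDerivAt (β ∘ chartInv x) (fderiv ℝ (β ∘ chartInv x) (φ x)) (φ x) :=
    ((contDiffAt_comp_chartInv x (eventually_chartAt_mem_target x).self_of_nhds
      hβ.contMDiffAt).differentiableAt (by simp)).hasFDerivAt
  have h1 := ((hasFDerivAt_fderiv_comp_chartInv hf x).clm_apply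
    (hasFDerivAt_const b (φ x))).inner ℝ hβd
  -- Differentiate `⟨df(b), β⟩ = 0`.
  have h2 : (fun w ↦ inner ℝ (fderiv ℝ (f ∘ chartInv x) w b) ((β ∘ chartInv x) w)) =ᶠ[𝓝 (φ x)]
      fun _ ↦ (0 : ℝ) := by
    filter_upwards [eventually_chartAt_mem_target x] with w hw
    have h3 := range_fderiv_comp_chartInv x (φ.map_target hw)
      ((hf (φ.symm w)).mdifferentiableAt (by simp))
    rw [φ.right_inv hw] at h3
    have h4 := hnor (φ.symm w)
    rw [← h3] at h4
    exact h4 _ ⟨b, rfl⟩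
  have h5 := congrArg (fun L ↦ L a) (h1.unique ((hasFDerivAt_const (0 : ℝ) (φ x)).congr_of_eventuallyEq h2))
  have hxx : chartInv x (φ x) = x := φ.left_inv (mem_chart_source _ x)
  simp [fderivInnerCLM_apply] at h5
  linarith

variable [RiemannianBundle (fun x : M ↦ TangentSpace (𝓡 m) x)]

/-- The orthogonal projection of a smooth function to the tangent spaces of an immersion is
smooth. -/
lemma contMDiff_starProjection {f g : M → EuclideanSpace ℝ (Fin q)}
    (hf : IsIsometricImmersion (m := m) f) (hg : ContMDiff (𝓡 m) (𝓡 q) ∞ g) :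
    ContMDiff (𝓡 m) (𝓡 q) ∞
      fun x ↦ (euclideanDifferential (m := m) f x).range.starProjection (g x) := by
  intro x
  set φ := chartAt (EuclideanSpace ℝ (Fin m)) x with hφ
  have hz := (eventually_chartAt_mem_target (m := m) x).self_of_nhds
  have h1 : ContDiffAt ℝ ∞ (fderiv ℝ (f ∘ chartInv x)) (φ x) :=
    (contDiffAt_comp_chartInv x hz hf.contMDiff.contMDiffAt).fderiv_right (by simp)
  have h2 := h1.clm_apply (contDiffAt_tangentialCoords h1
    (contDiffAt_comp_chartInv x hz hg.contMDiffAt) (fderiv_comp_chartInv_injective hf x hz))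
  have h3 : ContMDiffAt (𝓡 m) (𝓡 m) ∞ φ x :=
    contMDiffOn_chart.contMDiffAt (φ.open_source.mem_nhds (mem_chart_source _ x))
  refine (h2.contMDiffAt.comp x h3).congr_of_eventuallyEq ?_
  filter_upwards [φ.open_source.mem_nhds (mem_chart_source _ x)] with y hy
  have h4 := fderiv_comp_chartInv_injective hf x (φ.map_source hy)
  have hyy : chartInv x (φ y) = y := φ.left_inv hy
  have h5 := starProjection_range h4 (g y)
  rw [starProjection_congr (range_fderiv_comp_chartInv x hy (hf.mdifferentiableAt y)).symm, h5]
  simp only [Function.comp_apply, hyy]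

/-- The Gauss formula: the normal part of the derivative of a tangential field. -/
lemma starProjection_orthogonal_euclideanDifferential {f : M → EuclideanSpace ℝ (Fin q)}
    (hf : IsIsometricImmersion (m := m) f) {ξ : M → EuclideanSpace ℝ (Fin q)}
    (hξ : ContMDiff (𝓡 m) (𝓡 q) ∞ ξ)
    (htan : ∀ y, ξ y ∈ (euclideanDifferential (m := m) f y).range) (x : M)
    (v w : TangentSpace (𝓡 m) x) (hw : euclideanDifferential f x w = ξ x) :
    (euclideanDifferential (m := m) f x).rangeᗮ.starProjection (euclideanDifferential ξ x v) =
      secondFundamentalForm f x v w := by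
  rw [secondFundamentalForm_eq, euclideanDifferential_eq ((hξ x).mdifferentiableAt (by simp))]
  rw [euclideanDifferential_eq (hf.mdifferentiableAt x)] at hw
  generalize chartDifferential x v = a
  generalize chartDifferential x w = b at hw
  set φ := chartAt (EuclideanSpace ℝ (Fin m)) x with hφ
  have hz := (eventually_chartAt_mem_target (m := m) x).self_of_nhds
  have hxx : chartInv x (φ x) = x := φ.left_inv (mem_chart_source _ x)
  have h1 : ContDiffAt ℝ ∞ (fderiv ℝ (f ∘ chartInv x)) (φ x) :=
    (contDiffAt_comp_chartInv x hz hf.contMDiff.contMDiffAt).fderiv_right (by simp)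
  -- In the chart, `ξ = df(Y)`, and the normal part of its derivative is that of `D²f(a, Y)`.
  set Y := fun w : EuclideanSpace ℝ (Fin m) ↦ tangentialCoords (fderiv ℝ (f ∘ chartInv x) w) ((ξ ∘ chartInv x) w)
    with hY
  have hYd : HasFDerivAt Y (fderiv ℝ Y (φ x)) (φ x) := ((contDiffAt_tangentialCoords h1
    (contDiffAt_comp_chartInv x hz hξ.contMDiffAt)
    (fderiv_comp_chartInv_injective hf x hz)).differentiableAt (by simp)).hasFDerivAt
  have h2 : ∀ w ∈ φ.target, (ξ ∘ chartInv x) w = fderiv ℝ (f ∘ chartInv x) w (Y w) := by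
    intro w hw
    rw [hY, ← starProjection_range (fderiv_comp_chartInv_injective hf x hw), eq_comm]
    refine Submodule.starProjection_eq_self_iff.2 ?_
    have h3 := range_fderiv_comp_chartInv x (φ.map_target hw)
      (hf.mdifferentiableAt (φ.symm w))
    rw [φ.right_inv hw] at h3
    rw [h3]
    exact htan (φ.symm w)
  have h4 : Y (φ x) = b := by
    refine fderiv_comp_chartInv_injective hf x hz ?_
    rw [← h2 _ hz, hw, Function.comp_apply, hxx]
  have h5 := (hasFDerivAt_fderiv_comp_chartInv hf.contMDiff x).clm_apply hYd
  replace h5 := h5.congr_of_eventuallyEq (f₁ := ξ ∘ chartInv x)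
    ((eventually_chartAt_mem_target (m := m) x).mono h2)
  rw [← hφ] at h5
  rw [h5.fderiv]
  simp only [_root_.add_apply, ContinuousLinearMap.comp_apply,
    ContinuousLinearMap.flip_apply, map_add, h4]
  rw [add_eq_right]
  refine Submodule.starProjection_orthogonal_apply_eq_zero ?_
  rw [← range_fderiv_comp_chartInv x (mem_chart_source _ x) (hf.mdifferentiableAt x)]
  exact ⟨_, rfl⟩

/-- The normal part of the acceleration of a curve in the immersed submanifold. -/
lemma starProjection_orthogonal_deriv_deriv {f : M → EuclideanSpace ℝ (Fin q)}
    (hf : IsIsometricImmersion (m := m) f) {c : ℝ → M} (hc : ContMDiffAt 𝓘(ℝ, ℝ) (𝓡 m) ∞ c 0)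
    {x : M} (hx : c 0 = x) {w : TangentSpace (𝓡 m) x}
    (hw : HasDerivAt (fun t ↦ f (c t)) (euclideanDifferential f x w) 0) :
    (euclideanDifferential (m := m) f x).rangeᗮ.starProjection
      (deriv (deriv fun t ↦ f (c t)) 0) = secondFundamentalForm f x w w := by
  rw [secondFundamentalForm_eq]
  rw [euclideanDifferential_eq (hf.mdifferentiableAt x)] at hw
  generalize chartDifferential x w = b at hw
  set φ := chartAt (EuclideanSpace ℝ (Fin m)) x with hφ
  have hz := (eventually_chartAt_mem_target (m := m) x).self_of_nhds
  have hcs : ∀ᶠ t in 𝓝 0, c t ∈ φ.source :=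
    hc.continuousAt.eventually (φ.open_source.mem_nhds (hx ▸ mem_chart_source _ x))
  have hγ : ContDiffAt ℝ ∞ (φ ∘ c) 0 := by
    rw [← contMDiffAt_iff_contDiffAt]
    refine ContMDiffAt.comp 0 (contMDiffOn_chart.contMDiffAt (φ.open_source.mem_nhds ?_)) hc
    exact hx ▸ mem_chart_source _ x
  have hγ0 : (φ ∘ c) 0 = φ x := congrArg φ hx
  have hF : ∀ w ∈ φ.target, HasFDerivAt (f ∘ chartInv x) (fderiv ℝ (f ∘ chartInv x) w) w :=
    fun w hw ↦ ((contDiffAt_comp_chartInv x hw hf.contMDiff.contMDiffAt).differentiableAt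
      (by simp)).hasFDerivAt
  have hγd : ∀ᶠ t in 𝓝 0, HasDerivAt (φ ∘ c) (deriv (φ ∘ c) t) t := by
    filter_upwards [(hγ.of_le (m := 1) (WithTop.coe_le_coe.2 le_top)).eventually (by simp)] with t ht
    exact (ht.differentiableAt (by simp)).hasDerivAt
  have h1 : ∀ᶠ t in 𝓝 0, HasDerivAt (fun t ↦ f (c t))
      (fderiv ℝ (f ∘ chartInv x) ((φ ∘ c) t) (deriv (φ ∘ c) t)) t := by
    filter_upwards [hγd, hcs.eventually_nhds] with t ht hts
    refine ((hF _ (φ.map_source hts.self_of_nhds)).comp_hasDerivAt t ht).congr_of_eventuallyEq ?_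
    filter_upwards [hts] with s hs
    simp only [Function.comp_apply, chartInv, ← hφ, φ.left_inv hs]
  have h2 : deriv (φ ∘ c) 0 = b := by
    refine fderiv_comp_chartInv_injective hf x hz ?_
    have h := h1.self_of_nhds
    rw [hγ0] at h
    exact h.unique hw
  have h3 : HasDerivAt (deriv (φ ∘ c)) (deriv (deriv (φ ∘ c)) 0) 0 :=
    (((hγ.fderiv_right (m := ∞) (by simp)).clm_apply contDiffAt_const).differentiableAt
      (by simp)).hasDerivAt
  have h4 := hasFDerivAt_fderiv_comp_chartInv hf.contMDiff x
  rw [← hφ, ← hγ0] at h4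
  have h5 := (h4.comp_hasDerivAt 0 hγd.self_of_nhds).clm_apply h3
  rw [(h5.congr_of_eventuallyEq (h1.mono fun t ht ↦ ht.deriv)).deriv, h2, map_add, add_eq_left]
  refine Submodule.starProjection_orthogonal_apply_eq_zero ?_
  rw [← range_fderiv_comp_chartInv x (mem_chart_source _ x) (hf.mdifferentiableAt x),
    Function.comp_apply, hγ0]
  exact ⟨_, rfl⟩

end Immersion

/-! ### The trace of the second variation over all directions of the ambient space -/

section Trace

open Matrix

variable {ι κ : Type*} [Fintype ι] [DecidableEq ι] [Fintype κ]

lemma firstVar_add (H P Q : Matrix ι ι ℝ) : firstVar H (P + Q) = firstVar H P + firstVar H Q := by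
  simp only [firstVar, add_mul, trace_add]
  ring

lemma firstVar_diagonal (l : ι → ℝ) (P : Matrix ι ι ℝ) :
    firstVar (diagonal l) P = ∑ i, ((∑ j, l j ^ 3) / 12 - l i ^ 3 / 2) * P i i := by
  have h1 : ∑ i, l i * l i * l i = ∑ i, l i ^ 3 := Finset.sum_congr rfl fun i _ ↦ by ring
  simp only [firstVar, diagonal_mul_diagonal, trace, diag_apply, mul_diagonal, diagonal_apply_eq, h1]
  rw [Finset.mul_sum, Finset.mul_sum, ← Finset.sum_add_distrib]
  exact Finset.sum_congr rfl fun i _ ↦ by ring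

lemma secondVar_diagonal (l : ι → ℝ) (P : Matrix ι ι ℝ) :
    secondVar (diagonal l) P = ∑ i, ∑ j, ((l i ^ 2 * l j + l i ^ 3 - (∑ k, l k ^ 3) / 12) *
      (P i j * P j i) + ((∑ k, l k ^ 3) / 24 - l i ^ 3 / 2) * (P i i * P j j)) := by
  have h1 : trace (diagonal l * P * diagonal l * P * diagonal l) =
      ∑ i, ∑ j, l i ^ 2 * l j * (P i j * P j i) := by
    refine Finset.sum_congr rfl fun i _ ↦ ?_
    rw [diag_apply, mul_diagonal, mul_apply, Finset.sum_mul]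
    simp only [mul_diagonal, diagonal_mul]
    exact Finset.sum_congr rfl fun j _ ↦ by ring
  have h2 : ∑ i, l i * l i * l i = ∑ i, l i ^ 3 := Finset.sum_congr rfl fun i _ ↦ by ring
  have h3 : trace (P * P) = ∑ i, ∑ j, P i j * P j i := by
    simp only [trace, diag_apply, mul_apply]
  have h4 : trace (P * P * diagonal fun i ↦ l i * l i * l i) =
      ∑ i, ∑ j, l i ^ 3 * (P i j * P j i) := by
    refine Finset.sum_congr rfl fun i _ ↦ ?_
    rw [diag_apply, mul_diagonal, mul_apply, Finset.sum_mul]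
    exact Finset.sum_congr rfl fun j _ ↦ by ring
  have h5 : trace P ^ 2 = ∑ i, ∑ j, P i i * P j j := by
    rw [sq, trace, Finset.sum_mul_sum]
    rfl
  have h6 : trace (P * diagonal fun i ↦ l i * l i * l i) * trace P =
      ∑ i, ∑ j, l i ^ 3 * (P i i * P j j) := by
    simp only [trace, diag_apply, mul_diagonal]
    rw [Finset.sum_mul_sum]
    exact Finset.sum_congr rfl fun i _ ↦ Finset.sum_congr rfl fun j _ ↦ by ring
  rw [secondVar, h1, diagonal_mul_diagonal, diagonal_mul_diagonal, h4, mul_assoc (1 / 2 : ℝ), h6,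
    trace_diagonal, h2, h5, h3]
  generalize ∑ k, l k ^ 3 = τ
  simp only [Finset.mul_sum, ← Finset.sum_add_distrib, ← Finset.sum_sub_distrib]
  exact Finset.sum_congr rfl fun i _ ↦ Finset.sum_congr rfl fun j _ ↦ by ring

variable {X : Type*} [NormedAddCommGroup X] [InnerProductSpace ℝ X]

/-- Parseval's identity. -/
lemma sum_inner_mul_inner (ν : OrthonormalBasis κ ℝ X) (v w : X) :
    ∑ a, inner ℝ v (ν a) * inner ℝ w (ν a) = inner ℝ v w := by
  rw [← ν.sum_inner_mul_inner v w]
  exact Finset.sum_congr rfl fun a _ ↦ by rw [real_inner_comm w]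

omit [Fintype ι] in
lemma sum_inner_mul_inner_orthonormal (ν : OrthonormalBasis κ ℝ X) {ε : ι → X}
    (hε : Orthonormal ℝ ε) (i j : ι) :
    ∑ a, inner ℝ (ε i) (ν a) * inner ℝ (ε j) (ν a) = if i = j then 1 else 0 := by
  rw [sum_inner_mul_inner, orthonormal_iff_ite.1 hε]

/-- The trace formula, for a bilinear form with eigenvalues `l` in the orthonormal basis `ε` of the
tangent space, and with the second fundamental form `B`. The vector `∑ₖ ⟨εₖ, ν⟩ εₖ` is the tangential
part of `ν`. -/
lemma sum_secondVar_add_firstVar (l : ι → ℝ) (B : ι → ι → X) (hB : ∀ i j, B i j = B j i)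
    (ν : OrthonormalBasis κ ℝ X) {ε : ι → X} (hε : Orthonormal ℝ ε) :
    ∑ a, (secondVar (diagonal l) ((2 : ℝ) • of fun i j ↦ inner ℝ (B i j) (ν a)) +
      firstVar (diagonal l) (of fun i j ↦
        2 * ((∑ k, inner ℝ (B i k) (ν a) * inner ℝ (B j k) (ν a)) +
          inner ℝ (∑ k, (inner ℝ (ε k) (ν a) : ℝ) • B i k)
            (∑ k, (inner ℝ (ε k) (ν a) : ℝ) • B j k)) -
        2 * inner ℝ (B i j)
          (∑ k, ∑ k', ((inner ℝ (ε k) (ν a) : ℝ) * inner ℝ (ε k') (ν a)) • B k k'))) =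
    ∑ i, ∑ j, ((4 * l i ^ 2 * l j + 2 * l i ^ 3) * inner ℝ (B i j) (B i j) -
      l i ^ 3 * inner ℝ (B i i) (B j j)) := by
  set τ := ∑ k, l k ^ 3 with hτ
  have h1 : ∀ i, ∑ a, inner ℝ (∑ k, (inner ℝ (ε k) (ν a) : ℝ) • B i k)
      (∑ k, (inner ℝ (ε k) (ν a) : ℝ) • B i k) = ∑ k, inner ℝ (B i k) (B i k) := by
    intro i
    simp only [sum_inner, inner_sum, inner_smul_left, inner_smul_right, conj_trivial,
      Finset.mul_sum]
    rw [Finset.sum_comm]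
    refine Finset.sum_congr rfl fun k _ ↦ ?_
    rw [Finset.sum_comm]
    simp only [← mul_assoc, ← Finset.sum_mul, sum_inner_mul_inner_orthonormal ν hε, ite_mul, one_mul,
      zero_mul, Finset.sum_ite_eq, Finset.mem_univ, if_true]
  have h2 : ∀ i, ∑ a, inner ℝ (B i i)
      (∑ k, ∑ k', ((inner ℝ (ε k) (ν a) : ℝ) * inner ℝ (ε k') (ν a)) • B k k') =
      ∑ k, inner ℝ (B i i) (B k k) := by
    intro i
    rw [← inner_sum, ← inner_sum]
    congr 1
    rw [Finset.sum_comm]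
    refine Finset.sum_congr rfl fun k _ ↦ ?_
    rw [Finset.sum_comm]
    simp only [← Finset.sum_smul, sum_inner_mul_inner_orthonormal ν hε, ite_smul, one_smul,
      zero_smul, Finset.sum_ite_eq, Finset.mem_univ, if_true]
  rw [Finset.sum_add_distrib]
  have h3 : ∑ a, secondVar (diagonal l) ((2 : ℝ) • of fun i j ↦ inner ℝ (B i j) (ν a)) =
      ∑ i, ∑ j, ((4 * l i ^ 2 * l j + 4 * l i ^ 3 - τ / 3) * inner ℝ (B i j) (B i j) +
        (τ / 6 - 2 * l i ^ 3) * inner ℝ (B i i) (B j j)) := by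
    simp only [secondVar_diagonal, ← hτ, Matrix.smul_apply, of_apply, smul_eq_mul]
    rw [Finset.sum_comm]
    refine Finset.sum_congr rfl fun i _ ↦ ?_
    rw [Finset.sum_comm]
    refine Finset.sum_congr rfl fun j _ ↦ ?_
    rw [← sum_inner_mul_inner ν (B i j), ← sum_inner_mul_inner ν (B i i), Finset.mul_sum,
      Finset.mul_sum, ← Finset.sum_add_distrib]
    refine Finset.sum_congr rfl fun a _ ↦ ?_
    rw [hB j i]
    ring
  have h4 : ∀ i, ∑ a, (2 * ((∑ k, inner ℝ (B i k) (ν a) * inner ℝ (B i k) (ν a)) +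
          inner ℝ (∑ k, (inner ℝ (ε k) (ν a) : ℝ) • B i k)
            (∑ k, (inner ℝ (ε k) (ν a) : ℝ) • B i k)) -
        2 * inner ℝ (B i i)
          (∑ k, ∑ k', ((inner ℝ (ε k) (ν a) : ℝ) * inner ℝ (ε k') (ν a)) • B k k')) =
      ∑ j, (4 * inner ℝ (B i j) (B i j) - 2 * inner ℝ (B i i) (B j j)) := by
    intro i
    rw [Finset.sum_sub_distrib, ← Finset.mul_sum, ← Finset.mul_sum, Finset.sum_add_distrib, h1, h2,
      Finset.sum_comm]
    simp only [sum_inner_mul_inner, Finset.sum_sub_distrib, ← Finset.mul_sum]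
    ring
  simp only [firstVar_diagonal, of_apply]
  rw [h3, Finset.sum_comm (s := (Finset.univ : Finset κ))]
  simp only [← Finset.mul_sum, h4]
  rw [← Finset.sum_add_distrib]
  refine Finset.sum_congr rfl fun i _ ↦ ?_
  rw [Finset.mul_sum, ← Finset.sum_add_distrib]
  refine Finset.sum_congr rfl fun j _ ↦ ?_
  rw [← hτ]
  ring

omit [DecidableEq ι] in
/-- The trace of the second variation is bounded by the values of the functional defining the
superstrong instability. -/
lemma trace_formula_le {l : ι → ℝ} (hl : ∀ i, 0 ≤ l i) (B : ι → ι → X) (hB : ∀ i j, B i j = B j i) :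
    ∑ i, ∑ j, ((4 * l i ^ 2 * l j + 2 * l i ^ 3) * inner ℝ (B i j) (B i j) -
      l i ^ 3 * inner ℝ (B i i) (B j j)) ≤
    ∑ i, l i ^ 3 * ∑ j, (6 * inner ℝ (B i j) (B i j) - inner ℝ (B i i) (B j j)) := by
  -- After symmetrization in `i` and `j` this is `λᵢ² λⱼ + λⱼ² λᵢ ≤ λᵢ³ + λⱼ³`.
  have h1 : ∑ i, ∑ j, l i ^ 2 * l j * inner ℝ (B i j) (B i j) ≤
      ∑ i, ∑ j, l i ^ 3 * inner ℝ (B i j) (B i j) := by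
    have h2 : ∀ g : ι → ι → ℝ, ∑ i, ∑ j, g i j = ∑ i, ∑ j, (g i j + g j i) / 2 := by
      intro g
      have h3 : ∑ i, ∑ j, g j i = ∑ i, ∑ j, g i j := Finset.sum_comm
      simp only [← Finset.sum_div, Finset.sum_add_distrib, h3]
      ring
    rw [h2, h2 fun i j ↦ l i ^ 3 * inner ℝ (B i j) (B i j)]
    refine Finset.sum_le_sum fun i _ ↦ Finset.sum_le_sum fun j _ ↦ ?_
    rw [hB j i]
    have h4 : l i ^ 2 * l j + l j ^ 2 * l i ≤ l i ^ 3 + l j ^ 3 := by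
      nlinarith [mul_nonneg (add_nonneg (hl i) (hl j)) (sq_nonneg (l i - l j))]
    have h5 := mul_le_mul_of_nonneg_right h4 (real_inner_self_nonneg (x := B i j))
    linarith
  have h6 : ∑ i, ∑ j, ((4 * l i ^ 2 * l j + 2 * l i ^ 3) * inner ℝ (B i j) (B i j) -
      l i ^ 3 * inner ℝ (B i i) (B j j)) =
      4 * (∑ i, ∑ j, l i ^ 2 * l j * inner ℝ (B i j) (B i j)) -
      4 * (∑ i, ∑ j, l i ^ 3 * inner ℝ (B i j) (B i j)) +
      ∑ i, l i ^ 3 * ∑ j, (6 * inner ℝ (B i j) (B i j) - inner ℝ (B i i) (B j j)) := by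
    simp only [Finset.mul_sum, ← Finset.sum_sub_distrib, ← Finset.sum_add_distrib]
    refine Finset.sum_congr rfl fun i _ ↦ Finset.sum_congr rfl fun j _ ↦ ?_
    ring
  linarith

end Trace

/-! ### The second variation at a point -/

section Pointwise

open Matrix

variable {m n q : ℕ}

/-- An orthonormal basis which diagonalizes the inner product pulled back by a linear map. -/
lemma exists_orthonormalBasis_gram_eq_diagonal {E E' : Type*} [NormedAddCommGroup E]
    [InnerProductSpace ℝ E] [FiniteDimensional ℝ E] [NormedAddCommGroup E'] [InnerProductSpace ℝ E']
    [FiniteDimensional ℝ E'] (hm : Module.finrank ℝ E = m) (A : E →ₗ[ℝ] E') :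
    ∃ (e : OrthonormalBasis (Fin m) ℝ E) (l : Fin m → ℝ), (∀ i, 0 ≤ l i) ∧
      (gram ℝ fun i ↦ A (e i)) = diagonal l := by
  have hS : (LinearMap.adjoint A ∘ₗ A).IsSymmetric := fun v w ↦ by
    rw [LinearMap.comp_apply, LinearMap.comp_apply, LinearMap.adjoint_inner_left,
      LinearMap.adjoint_inner_right]
  have hgram : ∀ i j, inner ℝ (A (hS.eigenvectorBasis hm i)) (A (hS.eigenvectorBasis hm j)) =
      if i = j then hS.eigenvalues hm i else 0 := by
    intro i j
    rw [← LinearMap.adjoint_inner_left, ← LinearMap.comp_apply, hS.apply_eigenvectorBasis,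
      inner_smul_left, orthonormal_iff_ite.1 (hS.eigenvectorBasis hm).orthonormal]
    simp
  refine ⟨hS.eigenvectorBasis hm, hS.eigenvalues hm, fun i ↦ ?_, ?_⟩
  · have h := hgram i i
    rw [if_pos rfl] at h
    rw [← h]
    exact real_inner_self_nonneg
  · ext i j
    rw [gram_apply, hgram, diagonal_apply]

variable {M : Type*} [TopologicalSpace M] [ChartedSpace (EuclideanSpace ℝ (Fin m)) M]
  [IsManifold (𝓡 m) ∞ M]

omit [IsManifold (𝓡 m) ∞ M] in
lemma euclideanDifferential_add {g h : M → EuclideanSpace ℝ (Fin q)} {x : M}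
    (hg : MDifferentiableAt (𝓡 m) (𝓡 q) g x) (hh : MDifferentiableAt (𝓡 m) (𝓡 q) h x)
    (v : TangentSpace (𝓡 m) x) :
    euclideanDifferential (fun y ↦ g y + h y) x v =
      euclideanDifferential g x v + euclideanDifferential h x v :=
  congrArg (fun L ↦ L v) (mfderiv_add hg hh)

omit [IsManifold (𝓡 m) ∞ M] in
lemma symProduct_add (f : M → EuclideanSpace ℝ (Fin q)) {g h : M → EuclideanSpace ℝ (Fin q)} {x : M}
    (hg : MDifferentiableAt (𝓡 m) (𝓡 q) g x) (hh : MDifferentiableAt (𝓡 m) (𝓡 q) h x)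
    (e : Fin m → TangentSpace (𝓡 m) x) :
    symProduct f (fun y ↦ g y + h y) x e = symProduct f g x e + symProduct f h x e := by
  ext i j
  simp only [symProduct, Matrix.add_apply, of_apply, euclideanDifferential_add hg hh, inner_add_left,
    inner_add_right]
  ring

lemma symProduct_normal {f : M → EuclideanSpace ℝ (Fin q)} (hf : ContMDiff (𝓡 m) (𝓡 q) ∞ f)
    {β : M → EuclideanSpace ℝ (Fin q)} (hβ : ContMDiff (𝓡 m) (𝓡 q) ∞ β)
    (hnor : ∀ y, β y ∈ (euclideanDifferential (m := m) f y).rangeᗮ) (x : M)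
    (e : Fin m → TangentSpace (𝓡 m) x) :
    symProduct f β x e =
      -((2 : ℝ) • of fun i j ↦ inner ℝ (secondFundamentalForm f x (e i) (e j)) (β x)) := by
  ext i j
  simp only [symProduct, of_apply, Matrix.neg_apply, Matrix.smul_apply, smul_eq_mul]
  rw [real_inner_comm, inner_euclideanDifferential_of_normal hf hβ hnor,
    inner_euclideanDifferential_of_normal hf hβ hnor, secondFundamentalForm_comm hf x (e j)]
  ring

/-- The field of tangential parts of the vectors `g y`. -/
def tangentialPart (f g : M → EuclideanSpace ℝ (Fin q)) (y : M) : EuclideanSpace ℝ (Fin q) :=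
  (euclideanDifferential (m := m) f y).range.starProjection (g y)

omit [IsManifold (𝓡 m) ∞ M] in
lemma tangentialPart_mem (f g : M → EuclideanSpace ℝ (Fin q)) (y : M) :
    tangentialPart (m := m) f g y ∈ (euclideanDifferential (m := m) f y).range :=
  Submodule.starProjection_apply_mem _ _

omit [IsManifold (𝓡 m) ∞ M] in
lemma sub_tangentialPart_eq (f g : M → EuclideanSpace ℝ (Fin q)) (y : M) :
    g y - tangentialPart (m := m) f g y =
      (euclideanDifferential (m := m) f y).rangeᗮ.starProjection (g y) := by
  rw [Submodule.starProjection_orthogonal_val]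
  rfl

omit [IsManifold (𝓡 m) ∞ M] in
lemma sub_tangentialPart_mem (f g : M → EuclideanSpace ℝ (Fin q)) (y : M) :
    g y - tangentialPart (m := m) f g y ∈ (euclideanDifferential (m := m) f y).rangeᗮ := by
  rw [sub_tangentialPart_eq]
  exact Submodule.starProjection_apply_mem _ _

variable [RiemannianBundle (fun x : M ↦ TangentSpace (𝓡 m) x)]

lemma contMDiff_tangentialPart {f g : M → EuclideanSpace ℝ (Fin q)}
    (hf : IsIsometricImmersion (m := m) f) (hg : ContMDiff (𝓡 m) (𝓡 q) ∞ g) :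
    ContMDiff (𝓡 m) (𝓡 q) ∞ (tangentialPart (m := m) f g) :=
  contMDiff_starProjection hf hg

/-- The tangential part of the derivative of the projection `ξ` of a fixed vector `ν` to the tangent
spaces. -/
lemma inner_euclideanDifferential_tangentialPart {f : M → EuclideanSpace ℝ (Fin q)}
    (hf : IsIsometricImmersion (m := m) f) (ν : EuclideanSpace ℝ (Fin q)) (x : M)
    (v w : TangentSpace (𝓡 m) x) :
    inner ℝ (euclideanDifferential f x w)
      (euclideanDifferential (tangentialPart (m := m) f fun _ ↦ ν) x v) =
      inner ℝ (secondFundamentalForm f x v w) ν := by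
  have hξ := contMDiff_tangentialPart hf (contMDiff_const (c := ν))
  have hβ : ContMDiff (𝓡 m) (𝓡 q) ∞ fun y ↦ ν - tangentialPart (m := m) f (fun _ ↦ ν) y :=
    contMDiff_const.sub hξ
  have h1 := inner_euclideanDifferential_of_normal hf.contMDiff hβ
    (sub_tangentialPart_mem f fun _ ↦ ν) x v w
  have h2 : euclideanDifferential (fun y ↦ ν - tangentialPart (m := m) f (fun _ ↦ ν) y) x v =
      -euclideanDifferential (tangentialPart (m := m) f fun _ ↦ ν) x v := by
    have h3 := euclideanDifferential_add (m := m) ((hβ x).mdifferentiableAt (by simp))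
      ((hξ x).mdifferentiableAt (by simp)) v
    have h4 : euclideanDifferential (m := m) (fun _ : M ↦ ν) x v = 0 :=
      congrArg (fun L ↦ L v) (mfderiv_const (I := 𝓡 m) (I' := 𝓡 q) (c := ν) (x := x))
    simp only [sub_add_cancel, h4] at h3
    exact eq_neg_of_add_eq_zero_left h3.symm
  have h5 : inner ℝ (secondFundamentalForm f x v w) (tangentialPart (m := m) f (fun _ ↦ ν) x) = 0 := by
    rw [real_inner_comm]
    exact secondFundamentalForm_mem f x v w _ (tangentialPart_mem f _ x)
  rw [h2, inner_neg_right, inner_sub_right, h5, sub_zero] at h1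
  exact neg_injective h1

lemma symProduct_tangentialPart {f : M → EuclideanSpace ℝ (Fin q)}
    (hf : IsIsometricImmersion (m := m) f) (ν : EuclideanSpace ℝ (Fin q)) (x : M)
    (e : Fin m → TangentSpace (𝓡 m) x) :
    symProduct f (tangentialPart (m := m) f fun _ ↦ ν) x e =
      (2 : ℝ) • of fun i j ↦ inner ℝ (secondFundamentalForm f x (e i) (e j)) ν := by
  ext i j
  simp only [symProduct, of_apply, Matrix.smul_apply, smul_eq_mul]
  rw [real_inner_comm, inner_euclideanDifferential_tangentialPart hf,
    inner_euclideanDifferential_tangentialPart hf, secondFundamentalForm_comm hf.contMDiff x (e j)]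
  ring

omit [IsManifold (𝓡 m) ∞ M] in
lemma orthonormal_euclideanDifferential {f : M → EuclideanSpace ℝ (Fin q)}
    (hf : IsIsometricImmersion (m := m) f) {x : M}
    (e : OrthonormalBasis (Fin m) ℝ (TangentSpace (𝓡 m) x)) :
    Orthonormal ℝ fun i ↦ euclideanDifferential f x (e i) := by
  rw [orthonormal_iff_ite]
  intro i j
  rw [hf.inner_map, orthonormal_iff_ite.1 e.orthonormal]

omit [IsManifold (𝓡 m) ∞ M] in
lemma starProjection_range_euclideanDifferential {f : M → EuclideanSpace ℝ (Fin q)}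
    (hf : IsIsometricImmersion (m := m) f) {x : M}
    (e : OrthonormalBasis (Fin m) ℝ (TangentSpace (𝓡 m) x)) (ν : EuclideanSpace ℝ (Fin q)) :
    (euclideanDifferential (m := m) f x).range.starProjection ν = euclideanDifferential f x
      (∑ k, (inner ℝ (euclideanDifferential f x (e k)) ν : ℝ) • e k) := by
  refine Submodule.eq_starProjection_of_mem_of_inner_eq_zero ⟨_, rfl⟩ ?_
  rintro _ ⟨v, rfl⟩
  rw [← e.sum_repr v]
  simp only [ContinuousLinearMap.coe_coe, map_sum, map_smul, inner_sum, inner_smul_right]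
  refine Finset.sum_eq_zero fun k _ ↦ ?_
  rw [inner_sub_left, sum_inner]
  simp only [inner_smul_left, orthonormal_iff_ite.1 (orthonormal_euclideanDifferential hf e)]
  simp [real_inner_comm]

omit [IsManifold (𝓡 m) ∞ M] in
lemma inner_eq_sum_add_inner_orthogonal {f : M → EuclideanSpace ℝ (Fin q)}
    (hf : IsIsometricImmersion (m := m) f) {x : M}
    (e : OrthonormalBasis (Fin m) ℝ (TangentSpace (𝓡 m) x)) (v w : EuclideanSpace ℝ (Fin q)) :
    inner ℝ v w = (∑ k, inner ℝ (euclideanDifferential f x (e k)) v *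
      inner ℝ (euclideanDifferential f x (e k)) w) +
      inner ℝ ((euclideanDifferential (m := m) f x).rangeᗮ.starProjection v)
        ((euclideanDifferential (m := m) f x).rangeᗮ.starProjection w) := by
  set S := (euclideanDifferential (m := m) f x).range with hS
  have h1 : inner ℝ (S.starProjection v) w = ∑ k, inner ℝ (euclideanDifferential f x (e k)) v *
      inner ℝ (euclideanDifferential f x (e k)) w := by
    rw [starProjection_range_euclideanDifferential hf e]
    simp only [map_sum, map_smul, sum_inner, inner_smul_left, conj_trivial]
  have h2 : inner ℝ (Sᗮ.starProjection v) (Sᗮ.starProjection w) = inner ℝ (Sᗮ.starProjection v) w := by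
    rw [← Submodule.inner_starProjection_left_eq_right, Submodule.starProjection_eq_self_iff.2
      (Submodule.starProjection_apply_mem _ _)]
  rw [h2, ← h1, ← inner_add_left, Submodule.starProjection_add_starProjection_orthogonal]

/-- The integrand of the second variation in the direction of the projection of `ν`, corrected by
the first variation in the direction of the tangential acceleration. -/
lemma secondVar_add_firstVar_sub {f : M → EuclideanSpace ℝ (Fin q)}
    (hf : IsIsometricImmersion (m := m) f) (ν : EuclideanSpace ℝ (Fin q))
    {η : M → EuclideanSpace ℝ (Fin q)} (hη : ContMDiff (𝓡 m) (𝓡 q) ∞ η) (x : M)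
    (hacc : ∀ w : TangentSpace (𝓡 m) x,
      euclideanDifferential f x w = tangentialPart (m := m) f (fun _ ↦ ν) x →
      (euclideanDifferential (m := m) f x).rangeᗮ.starProjection (η x) =
        secondFundamentalForm f x w w)
    (e : OrthonormalBasis (Fin m) ℝ (TangentSpace (𝓡 m) x)) (H : Matrix (Fin m) (Fin m) ℝ) :
    secondVar H (symProduct f (tangentialPart (m := m) f fun _ ↦ ν) x e) +
      firstVar H ((2 : ℝ) • (gram ℝ fun i ↦
        euclideanDifferential (tangentialPart (m := m) f fun _ ↦ ν) x (e i)) + symProduct f η x e) -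
      firstVar H (symProduct f (tangentialPart (m := m) f η) x e) =
    secondVar H ((2 : ℝ) • of fun i j ↦ inner ℝ (secondFundamentalForm f x (e i) (e j)) ν) +
      firstVar H (of fun i j ↦
        2 * ((∑ k, inner ℝ (secondFundamentalForm f x (e i) (e k)) ν *
            inner ℝ (secondFundamentalForm f x (e j) (e k)) ν) +
          inner ℝ (∑ k, (inner ℝ (euclideanDifferential f x (e k)) ν : ℝ) •
              secondFundamentalForm f x (e i) (e k))
            (∑ k, (inner ℝ (euclideanDifferential f x (e k)) ν : ℝ) •
              secondFundamentalForm f x (e j) (e k))) -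
        2 * inner ℝ (secondFundamentalForm f x (e i) (e j))
          (∑ k, ∑ k', ((inner ℝ (euclideanDifferential f x (e k)) ν : ℝ) *
            inner ℝ (euclideanDifferential f x (e k')) ν) •
              secondFundamentalForm f x (e k) (e k'))) := by
  set w : TangentSpace (𝓡 m) x := ∑ k, (inner ℝ (euclideanDifferential f x (e k)) ν : ℝ) • e k
    with hw
  have hwξ : euclideanDifferential f x w = tangentialPart (m := m) f (fun _ ↦ ν) x :=
    (starProjection_range_euclideanDifferential hf e ν).symm
  have hξ := contMDiff_tangentialPart hf (contMDiff_const (c := ν))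
  have hζ := contMDiff_tangentialPart hf hη
  have hβ : ContMDiff (𝓡 m) (𝓡 q) ∞ fun y ↦ η y - tangentialPart (m := m) f η y := hη.sub hζ
  -- The normal part of `η` contributes a multiple of `⟨B, B(w, w)⟩`; the tangential part cancels.
  have h1 : symProduct f η x e = symProduct f (tangentialPart (m := m) f η) x e +
      symProduct f (fun y ↦ η y - tangentialPart (m := m) f η y) x e := by
    rw [← symProduct_add f ((hζ x).mdifferentiableAt (by simp)) ((hβ x).mdifferentiableAt (by simp))]
    simp only [add_sub_cancel]
  have h2 : η x - tangentialPart (m := m) f η x = secondFundamentalForm f x w w := by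
    rw [sub_tangentialPart_eq, hacc w hwξ]
  have h3 : secondFundamentalForm f x w w =
      ∑ k, ∑ k', ((inner ℝ (euclideanDifferential f x (e k)) ν : ℝ) *
        inner ℝ (euclideanDifferential f x (e k')) ν) • secondFundamentalForm f x (e k) (e k') := by
    rw [hw, secondFundamentalForm_sum_right]
    refine Finset.sum_congr rfl fun k _ ↦ ?_
    rw [secondFundamentalForm_comm hf.contMDiff, secondFundamentalForm_sum_right, Finset.smul_sum]
    simp only [smul_smul]
  have h4 : ∀ i, (euclideanDifferential (m := m) f x).rangeᗮ.starProjection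
      (euclideanDifferential (tangentialPart (m := m) f fun _ ↦ ν) x (e i)) =
      ∑ k, (inner ℝ (euclideanDifferential f x (e k)) ν : ℝ) •
        secondFundamentalForm f x (e i) (e k) := fun i ↦ by
    rw [starProjection_orthogonal_euclideanDifferential hf hξ (tangentialPart_mem f _) x (e i) w hwξ,
      hw, secondFundamentalForm_sum_right]
  rw [symProduct_tangentialPart hf, h1, add_left_comm, firstVar_add, add_sub_assoc,
    add_sub_cancel_left, symProduct_normal hf.contMDiff hβ (sub_tangentialPart_mem f η)]
  congr 2
  ext i j
  simp only [Matrix.add_apply, Matrix.neg_apply, Matrix.smul_apply, of_apply, gram_apply,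
    smul_eq_mul, h2, h3]
  rw [inner_eq_sum_add_inner_orthogonal hf e, h4, h4]
  simp only [inner_euclideanDifferential_tangentialPart hf]
  ring

end Pointwise

/-! ### Average over the ambient directions -/

section Average

open Matrix

variable {m n q : ℕ}
  {M : Type*} [TopologicalSpace M] [ChartedSpace (EuclideanSpace ℝ (Fin m)) M]
  [IsManifold (𝓡 m) ∞ M] [RiemannianBundle (fun x : M ↦ TangentSpace (𝓡 m) x)]
  {N : Type*} [TopologicalSpace N] [ChartedSpace (EuclideanSpace ℝ (Fin n)) N]
  [RiemannianBundle (fun y : N ↦ TangentSpace (𝓡 n) y)]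

/-- At every point, the sum over the ambient directions of the corrected integrands of the second
variation is nonpositive, and it vanishes only where the differential of `u` does. -/
lemma sum_nonpos_of_ssuFunctional_neg {f : M → EuclideanSpace ℝ (Fin q)}
    (hf : IsIsometricImmersion (m := m) f) {x : M}
    (hneg : ∀ (e : OrthonormalBasis (Fin m) ℝ (TangentSpace (𝓡 m) x)) (v : TangentSpace (𝓡 m) x),
      ‖v‖ = 1 → ssuFunctional f x e v < 0) (u : M → N) {κ : Type*} [Fintype κ]
    (ν : OrthonormalBasis κ ℝ (EuclideanSpace ℝ (Fin q)))
    {η : κ → M → EuclideanSpace ℝ (Fin q)} (hη : ∀ a, ContMDiff (𝓡 m) (𝓡 q) ∞ (η a))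
    (hacc : ∀ a, ∀ w : TangentSpace (𝓡 m) x,
      euclideanDifferential f x w = tangentialPart (m := m) f (fun _ ↦ ν a) x →
      (euclideanDifferential (m := m) f x).rangeᗮ.starProjection (η a x) =
        secondFundamentalForm f x w w)
    {k : κ → ℝ}
    (hk : ∀ a (e : OrthonormalBasis (Fin m) ℝ (TangentSpace (𝓡 m) x)) (H : Matrix (Fin m) (Fin m) ℝ),
      H = (gram ℝ fun i ↦ mfderiv (𝓡 m) (𝓡 n) u x (e i)) →
      k a = secondVar H (symProduct f (tangentialPart (m := m) f fun _ ↦ ν a) x e) +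
        firstVar H ((2 : ℝ) • (gram ℝ fun i ↦
          euclideanDifferential (tangentialPart (m := m) f fun _ ↦ ν a) x (e i)) +
            symProduct f (η a) x e) -
        firstVar H (symProduct f (tangentialPart (m := m) f (η a)) x e)) :
    ∑ a, k a ≤ 0 ∧ (∑ a, k a = 0 → mfderiv (𝓡 m) (𝓡 n) u x = 0) := by
  obtain ⟨e, l, hl, hH⟩ := exists_orthonormalBasis_gram_eq_diagonal
    (E := TangentSpace (𝓡 m) x) (E' := TangentSpace (𝓡 n) (u x)) (m := m) (finrank_tangentSpace x)
    (mfderiv (𝓡 m) (𝓡 n) u x).toLinearMap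
  have hBs : ∀ i j, secondFundamentalForm f x (e i) (e j) = secondFundamentalForm f x (e j) (e i) :=
    fun i j ↦ secondFundamentalForm_comm hf.contMDiff x _ _
  have h1 : ∑ a, k a ≤ ∑ i, l i ^ 3 * ssuFunctional f x e (e i) := by
    refine le_trans (le_of_eq ?_) (trace_formula_le hl
      (fun i j ↦ secondFundamentalForm f x (e i) (e j)) hBs)
    rw [← sum_secondVar_add_firstVar l _ hBs ν (orthonormal_euclideanDifferential hf e)]
    refine Finset.sum_congr rfl fun a _ ↦ ?_
    rw [hk a e (diagonal l) hH.symm, secondVar_add_firstVar_sub hf (ν a) (hη a) x (hacc a) e]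
  have h2 : ∀ i, l i ^ 3 * ssuFunctional f x e (e i) ≤ 0 := fun i ↦
    mul_nonpos_of_nonneg_of_nonpos (pow_nonneg (hl i) 3)
      (hneg e (e i) (e.orthonormal.norm_eq_one i)).le
  refine ⟨h1.trans (Finset.sum_nonpos fun i _ ↦ h2 i), fun h0 ↦ ?_⟩
  have h3 : ∑ i, l i ^ 3 * ssuFunctional f x e (e i) = 0 :=
    le_antisymm (Finset.sum_nonpos fun i _ ↦ h2 i) (h0 ▸ h1)
  have h4 : ∀ i, mfderiv (𝓡 m) (𝓡 n) u x (e i) = 0 := by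
    intro i
    have h5 := (Finset.sum_eq_zero_iff_of_nonpos fun i _ ↦ h2 i).1 h3 i (Finset.mem_univ i)
    have h6 : l i = 0 := by
      rcases mul_eq_zero.1 h5 with h | h
      · exact pow_eq_zero_iff (by norm_num) |>.1 h
      · exact absurd h (hneg e (e i) (e.orthonormal.norm_eq_one i)).ne
    have h7 := congrFun (congrFun hH i) i
    rw [gram_apply, diagonal_apply_eq, h6] at h7
    exact inner_self_eq_zero.1 h7
  have h5 : (mfderiv (𝓡 m) (𝓡 n) u x).toLinearMap = 0 := e.toBasis.ext fun i ↦ by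
    simpa using h4 i
  ext v
  exact congrArg (fun L ↦ L v) h5

end Average

/-! ### Variations by diffeomorphisms of the domain -/

section Variations

open Matrix

variable {m n q : ℕ}
  {M : Type*} [TopologicalSpace M] [ChartedSpace (EuclideanSpace ℝ (Fin m)) M]

/-- The members of a family of diffeomorphisms. -/
def DiffeoFamily.diffeomorph {ε : ℝ} {ψ θ : ℝ → M → M} (h : DiffeoFamily m ε ψ θ) {t : ℝ}
    (ht : t ∈ Ioo (-ε) ε) : Diffeomorph (𝓡 m) (𝓡 m) M M ∞ where
  toFun := ψ t
  invFun := θ t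
  left_inv := h.left_inv t ht
  right_inv := h.right_inv t ht
  contMDiff_toFun := contMDiffOn_univ.1 (h.smooth.comp
    (contMDiff_const.prodMk contMDiff_id).contMDiffOn fun x _ ↦ ⟨ht, mem_univ x⟩)
  contMDiff_invFun := contMDiffOn_univ.1 (h.smooth_inv.comp
    (contMDiff_const.prodMk contMDiff_id).contMDiffOn fun x _ ↦ ⟨ht, mem_univ x⟩)

lemma DiffeoFamily.zero_mem {ε : ℝ} {ψ θ : ℝ → M → M} (h : DiffeoFamily m ε ψ θ) :
    (0 : ℝ) ∈ Ioo (-ε) ε := ⟨neg_lt_zero.2 h.pos, h.pos⟩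

lemma DiffeoFamily.init_inv {ε : ℝ} {ψ θ : ℝ → M → M} (h : DiffeoFamily m ε ψ θ) (x : M) :
    θ 0 x = x := by
  rw [← h.init (θ 0 x), h.right_inv 0 h.zero_mem]

lemma DiffeoFamily.smoothFamily {f : M → EuclideanSpace ℝ (Fin q)}
    (hf : ContMDiff (𝓡 m) (𝓡 q) ∞ f) {ε : ℝ} {ψ θ : ℝ → M → M} (h : DiffeoFamily m ε ψ θ) :
    SmoothFamily m ε fun t x ↦ f (ψ t x) :=
  hf.comp_contMDiffOn h.smooth

variable [IsManifold (𝓡 m) ∞ M] [RiemannianBundle (fun x : M ↦ TangentSpace (𝓡 m) x)]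

omit [IsManifold (𝓡 m) ∞ M] in
lemma DiffeoFamily.injective_euclideanDifferential {f : M → EuclideanSpace ℝ (Fin q)}
    (hf : IsIsometricImmersion (m := m) f) {ε : ℝ} {ψ θ : ℝ → M → M} (h : DiffeoFamily m ε ψ θ)
    {t : ℝ} (ht : t ∈ Ioo (-ε) ε) (x : M) :
    Function.Injective (euclideanDifferential (m := m) (fun x ↦ f (ψ t x)) x) := by
  have h1 : euclideanDifferential (m := m) (fun x ↦ f (ψ t x)) x =
      (euclideanDifferential f (ψ t x)).comp (mfderiv (𝓡 m) (𝓡 m) (ψ t) x) :=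
    mfderiv_comp x (hf.mdifferentiableAt _)
      ((h.diffeomorph ht).contMDiff.mdifferentiableAt (by simp))
  rw [h1]
  exact (hf.injective _).comp
    ((h.diffeomorph ht).mfderivToContinuousLinearEquiv (by simp) x).injective

variable [CompactSpace M] [MeasurableSpace M] [BorelSpace M]
  {N : Type*} [TopologicalSpace N] [ChartedSpace (EuclideanSpace ℝ (Fin n)) N]
  [RiemannianBundle (fun y : N ↦ TangentSpace (𝓡 n) y)]

lemma DiffeoFamily.energy_eq {f : M → EuclideanSpace ℝ (Fin q)}
    (hf : IsIsometricImmersion (m := m) f) {ε : ℝ} {ψ θ : ℝ → M → M} (h : DiffeoFamily m ε ψ θ)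
    {u : M → N} (hu : MDifferentiable (𝓡 m) (𝓡 n) u) {t : ℝ} (ht : t ∈ Ioo (-ε) ε) :
    energy m n (fun x ↦ u (θ t x)) =
      ∫ y, energyIntegrand m n f (fun x ↦ f (ψ t x)) u y ∂(riemannianVolume m M) :=
  energy_comp_symm hf (h.diffeomorph ht) hu

variable [IsManifold (𝓡 n) ∞ N] [IsContMDiffRiemannianBundle (𝓡 n) ∞ (EuclideanSpace ℝ (Fin n))
    (fun y : N ↦ TangentSpace (𝓡 n) y)]

omit [CompactSpace M] [MeasurableSpace M] [BorelSpace M] in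
lemma DiffeoFamily.smoothFamily_energyIntegrand {f : M → EuclideanSpace ℝ (Fin q)}
    (hf : IsIsometricImmersion (m := m) f) {ε : ℝ} {ψ θ : ℝ → M → M} (h : DiffeoFamily m ε ψ θ)
    {u : M → N} (hu : ContMDiff (𝓡 m) (𝓡 n) ∞ u) :
    SmoothFamily m ε fun t y ↦ energyIntegrand m n f (fun x ↦ f (ψ t x)) u y :=
  Phi3.smoothFamily_energyIntegrand hf hu (h.smoothFamily hf.contMDiff)
    fun _ ht ↦ h.injective_euclideanDifferential hf ht

lemma isFiniteMeasure_riemannianVolume {f : M → EuclideanSpace ℝ (Fin q)}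
    (hf : IsIsometricImmersion (m := m) f) : IsFiniteMeasure (riemannianVolume m M) := by
  have := isLocallyFiniteMeasure_riemannianVolume hf
  infer_instance

lemma DiffeoFamily.hasDerivAt_energy {f : M → EuclideanSpace ℝ (Fin q)}
    (hf : IsIsometricImmersion (m := m) f) {ε : ℝ} {ψ θ : ℝ → M → M} (h : DiffeoFamily m ε ψ θ)
    {u : M → N} (hu : ContMDiff (𝓡 m) (𝓡 n) ∞ u) {t : ℝ} (ht : t ∈ Ioo (-ε) ε) :
    HasDerivAt (fun t ↦ energy m n (fun x ↦ u (θ t x)))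
      (∫ y, deriv (fun s ↦ energyIntegrand m n f (fun x ↦ f (ψ s x)) u y) t
        ∂(riemannianVolume m M)) t := by
  have := isFiniteMeasure_riemannianVolume hf
  refine ((h.smoothFamily_energyIntegrand hf hu).hasDerivAt_integral ht).congr_of_eventuallyEq ?_
  filter_upwards [isOpen_Ioo.mem_nhds ht] with s hs
  exact h.energy_eq hf (hu.mdifferentiable (by simp)) hs

/-- The first variation in the direction of a tangential field vanishes for harmonic maps. -/
lemma DiffeoFamily.integral_deriv_eq_zero {f : M → EuclideanSpace ℝ (Fin q)}
    (hf : IsIsometricImmersion (m := m) f) {ε : ℝ} {ψ θ : ℝ → M → M} (h : DiffeoFamily m ε ψ θ)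
    {u : M → N} (hu : IsPhi3Harmonic m n u) :
    ∫ y, deriv (fun s ↦ energyIntegrand m n f (fun x ↦ f (ψ s x)) u y) 0
        ∂(riemannianVolume m M) = 0 := by
  rw [← (h.hasDerivAt_energy hf hu.1 h.zero_mem).deriv]
  exact hu.2 ε (fun t x ↦ u (θ t x)) ⟨h.pos, hu.1.comp_contMDiffOn h.smooth_inv,
    fun x ↦ by rw [h.init_inv]⟩

/-- The second variation along a family of diffeomorphisms of the domain is nonnegative for stable
harmonic maps. -/
lemma DiffeoFamily.integral_deriv_deriv_nonneg {f : M → EuclideanSpace ℝ (Fin q)}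
    (hf : IsIsometricImmersion (m := m) f) {ε : ℝ} {ψ θ : ℝ → M → M} (h : DiffeoFamily m ε ψ θ)
    {u : M → N} (hu : IsStablePhi3Harmonic m n u) :
    0 ≤ ∫ y, deriv (deriv fun s ↦ energyIntegrand m n f (fun x ↦ f (ψ s x)) u y) 0
        ∂(riemannianVolume m M) := by
  have hfin := isFiniteMeasure_riemannianVolume hf
  have hsum : ∀ s ∈ Ioo (-(ε / 2)) (ε / 2), ∀ t ∈ Ioo (-(ε / 2)) (ε / 2), s + t ∈ Ioo (-ε) ε :=
    fun s hs t ht ↦ ⟨by linarith [hs.1, ht.1], by linarith [hs.2, ht.2]⟩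
  have hmap : ContMDiff (𝓘(ℝ, ℝ).prod (𝓘(ℝ, ℝ).prod (𝓡 m))) (𝓘(ℝ, ℝ).prod (𝓡 m)) ∞
      fun p : ℝ × ℝ × M ↦ (p.1 + p.2.1, p.2.2) :=
    (contMDiff_fst.add (contMDiff_fst.comp contMDiff_snd)).prodMk
      (contMDiff_snd.comp contMDiff_snd)
  -- The variation `u ∘ θ_{s + t}` has equal variation fields in `s` and `t`, and its energy depends
  -- only on `s + t`.
  have hvar : IsTwoParameterVariation m n u (ε / 2) fun s t x ↦ u (θ (s + t) x) := by
    refine ⟨half_pos h.pos, ?_, fun x ↦ by rw [add_zero, h.init_inv]⟩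
    exact (hu.1.1.comp_contMDiffOn h.smooth_inv).comp hmap.contMDiffOn
      fun p hp ↦ ⟨hsum _ hp.1 _ hp.2.1, mem_univ _⟩
  have hcongr : ∀ {A B : ℝ → N}, A = B →
      (mfderiv 𝓘(ℝ, ℝ) (𝓡 n) A 0 (1 : ℝ) : EuclideanSpace ℝ (Fin n)) =
        mfderiv 𝓘(ℝ, ℝ) (𝓡 n) B 0 (1 : ℝ) := by
    rintro A _ rfl
    rfl
  have hsecond := hu.2 (ε / 2) _ hvar fun x ↦
    hcongr (funext fun t ↦ by simp only [zero_add, add_zero])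
  have h1 : secondVariation m n (fun s t x ↦ u (θ (s + t) x)) =
      deriv (deriv fun t ↦ energy m n fun x ↦ u (θ t x)) 0 := by
    rw [secondVariation]
    congr 1
    ext1 s
    rw [deriv_comp_const_add (fun t ↦ energy m n fun x ↦ u (θ t x)), add_zero]
  rw [h1] at hsecond
  have h2 := (h.smoothFamily_energyIntegrand hf hu.1.1).deriv.hasDerivAt_integral
    (μ := riemannianVolume m M) h.zero_mem
  have h3 := (h2.congr_of_eventuallyEq (f₁ := deriv fun t ↦ energy m n fun x ↦ u (θ t x)) (by
    filter_upwards [isOpen_Ioo.mem_nhds h.zero_mem] with t ht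
    exact (h.hasDerivAt_energy hf hu.1.1 ht).deriv)).deriv
  rw [h3] at hsecond
  exact hsecond

variable [T2Space M]

/-- Every ambient direction `ν` gives a function with nonnegative integral, the corrected integrand
of the second variation. -/
lemma exists_integral_nonneg {f : M → EuclideanSpace ℝ (Fin q)}
    (hf : IsIsometricImmersion (m := m) f) {u : M → N} (hu : IsStablePhi3Harmonic m n u)
    (ν : EuclideanSpace ℝ (Fin q)) :
    ∃ (η : M → EuclideanSpace ℝ (Fin q)) (k : M → ℝ), ContMDiff (𝓡 m) (𝓡 q) ∞ η ∧
      (∀ x, ∀ w : TangentSpace (𝓡 m) x,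
        euclideanDifferential f x w = tangentialPart (m := m) f (fun _ ↦ ν) x →
        (euclideanDifferential (m := m) f x).rangeᗮ.starProjection (η x) =
          secondFundamentalForm f x w w) ∧
      Continuous k ∧ 0 ≤ ∫ x, k x ∂(riemannianVolume m M) ∧
      ∀ x (e : OrthonormalBasis (Fin m) ℝ (TangentSpace (𝓡 m) x)) (H : Matrix (Fin m) (Fin m) ℝ),
        H = (gram ℝ fun i ↦ mfderiv (𝓡 m) (𝓡 n) u x (e i)) →
        k x = secondVar H (symProduct f (tangentialPart (m := m) f fun _ ↦ ν) x e) +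
          firstVar H ((2 : ℝ) • (gram ℝ fun i ↦
            euclideanDifferential (tangentialPart (m := m) f fun _ ↦ ν) x (e i)) +
              symProduct f η x e) -
          firstVar H (symProduct f (tangentialPart (m := m) f η) x e) := by
  have hfin := isFiniteMeasure_riemannianVolume hf
  obtain ⟨ε, ψ, θ, h, hvel⟩ := isVelocity_of_tangential hf
    (contMDiff_tangentialPart hf (contMDiff_const (c := ν))) (tangentialPart_mem f _)
  have hF := h.smoothFamily hf.contMDiff
  set η : M → EuclideanSpace ℝ (Fin q) := fun y ↦ deriv (deriv fun s ↦ f (ψ s y)) 0 with hηdef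
  have hη : ContMDiff (𝓡 m) (𝓡 q) ∞ η := hF.deriv.deriv.contMDiff h.zero_mem
  -- The tangential part of the acceleration is a velocity as well.
  obtain ⟨ε', ψ', θ', h', hvel'⟩ := isVelocity_of_tangential hf
    (contMDiff_tangentialPart hf hη) (tangentialPart_mem f _)
  have hg := h.smoothFamily_energyIntegrand hf hu.1.1
  have hg' := h'.smoothFamily_energyIntegrand hf hu.1.1
  have hc : Continuous fun y ↦
      deriv (deriv fun s ↦ energyIntegrand m n f (fun x ↦ f (ψ s x)) u y) 0 :=
    hg.deriv.deriv.continuous h.zero_mem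
  have hc' : Continuous fun y ↦ deriv (fun s ↦ energyIntegrand m n f (fun x ↦ f (ψ' s x)) u y) 0 :=
    hg'.deriv.continuous h'.zero_mem
  refine ⟨η, fun y ↦ deriv (deriv fun s ↦ energyIntegrand m n f (fun x ↦ f (ψ s x)) u y) 0 -
    deriv (fun s ↦ energyIntegrand m n f (fun x ↦ f (ψ' s x)) u y) 0, hη, fun x w hw ↦ ?_,
    hc.sub hc', ?_, fun x e H hH ↦ ?_⟩
  · refine starProjection_orthogonal_deriv_deriv hf (c := fun t ↦ ψ t x) ?_ (h.init x) ?_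
    · exact ContMDiffAt.comp (0 : ℝ) (f := fun t : ℝ ↦ (t, x))
        (h.smooth.contMDiffAt ((isOpen_Ioo.prod isOpen_univ).mem_nhds ⟨h.zero_mem, mem_univ x⟩))
        (contMDiffAt_id.prodMk contMDiffAt_const)
    · rw [hw]
      exact hvel x
  · rw [integral_sub (hc.integrable_of_hasCompactSupport (HasCompactSupport.of_compactSpace _))
      (hc'.integrable_of_hasCompactSupport (HasCompactSupport.of_compactSpace _)),
      h'.integral_deriv_eq_zero hf hu.1, sub_zero]
    exact h.integral_deriv_deriv_nonneg hf hu
  · have h1 := (hasDerivAt_energyIntegrand hf u h.pos hF (funext fun x ↦ by rw [h.init])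
      (fun t ht ↦ h.injective_euclideanDifferential hf ht) x e hH
      (ξ := tangentialPart (m := m) f fun _ ↦ ν) (funext fun y ↦ (hvel y).deriv.symm) hηdef).2
    have h2 := (hasDerivAt_energyIntegrand hf u h'.pos (h'.smoothFamily hf.contMDiff)
      (funext fun x ↦ by rw [h'.init])
      (fun t ht ↦ h'.injective_euclideanDifferential hf ht) x e hH
      (ξ := tangentialPart (m := m) f η) (funext fun y ↦ (hvel' y).deriv.symm) rfl).1
    exact congrArg₂ _ h1 h2

/-- The differential of a stable harmonic map vanishes. -/
lemma mfderiv_eq_zero_of_stable (hM : IsPhi3SSU m M) {u : M → N}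
    (hu : IsStablePhi3Harmonic m n u) (x : M) : mfderiv (𝓡 m) (𝓡 n) u x = 0 := by
  obtain ⟨q, f, hf, hneg⟩ := hM
  have hfin := isFiniteMeasure_riemannianVolume hf
  have hpos := isOpenPosMeasure_riemannianVolume hf
  let ν := EuclideanSpace.basisFun (Fin q) ℝ
  choose η k hη hacc hc hint hk using fun a ↦ exists_integral_nonneg hf hu (ν a)
  have hpt : ∀ x, ∑ a, k a x ≤ 0 ∧ (∑ a, k a x = 0 → mfderiv (𝓡 m) (𝓡 n) u x = 0) := fun x ↦
    sum_nonpos_of_ssuFunctional_neg hf (hneg x) u ν hη (fun a ↦ hacc a x) fun a ↦ hk a x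
  refine (hpt x).2 ?_
  have hcs : Continuous fun x ↦ -∑ a, k a x := (continuous_finsetSum _ fun a _ ↦ hc a).neg
  have hi : ∀ {g : M → ℝ}, Continuous g → Integrable g (riemannianVolume m M) := fun hg ↦
    hg.integrable_of_hasCompactSupport (HasCompactSupport.of_compactSpace _)
  -- The sum is nonpositive and continuous and has nonnegative integral, hence vanishes.
  have h1 : ∫ x, -∑ a, k a x ∂(riemannianVolume m M) = 0 := by
    refine le_antisymm ?_ (integral_nonneg fun x ↦ neg_nonneg.2 (hpt x).1)
    rw [integral_neg, integral_finsetSum _ fun a _ ↦ hi (hc a)]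
    exact neg_nonpos.2 (Finset.sum_nonneg fun a _ ↦ hint a)
  have h2 := (integral_eq_zero_iff_of_nonneg (fun x ↦ neg_nonneg.2 (hpt x).1) (hi hcs)).1 h1
  have h3 := congrFun ((hcs.ae_eq_iff_eq _ continuous_zero).1 h2) x
  exact neg_eq_zero.1 h3

end Variations

/-! ### Maps with vanishing differential -/

section Constant

variable {m n : ℕ}
  {M : Type*} [TopologicalSpace M] [ConnectedSpace M] [ChartedSpace (EuclideanSpace ℝ (Fin m)) M]
  [IsManifold (𝓡 m) ∞ M]
  {N : Type*} [TopologicalSpace N] [ChartedSpace (EuclideanSpace ℝ (Fin n)) N]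
  [IsManifold (𝓡 n) ∞ N]

/-- In charts, `u` has vanishing derivative on a ball, so that it is locally constant. -/
lemma exists_eq_const_of_mfderiv_eq_zero {u : M → N} (hu : ContMDiff (𝓡 m) (𝓡 n) ∞ u)
    (h : ∀ x, mfderiv (𝓡 m) (𝓡 n) u x = 0) : ∃ c : N, ∀ x : M, u x = c := by
  have hloc : IsLocallyConstant u := by
    rw [IsLocallyConstant.iff_eventually_eq]
    intro x
    set φ := chartAt (EuclideanSpace ℝ (Fin m)) x with hφ
    set χ := chartAt (EuclideanSpace ℝ (Fin n)) (u x) with hχ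
    have hx : x ∈ φ.source := mem_chart_source _ x
    have hopen : IsOpen (φ.target ∩ φ.symm ⁻¹' (u ⁻¹' χ.source)) :=
      φ.isOpen_inter_preimage_symm (χ.open_source.preimage hu.continuous)
    obtain ⟨r, hr, hball⟩ := Metric.isOpen_iff.1 hopen (φ x) ⟨φ.map_source hx, by
      rw [mem_preimage, mem_preimage, φ.left_inv hx]
      exact mem_chart_source _ _⟩
    have hd : ∀ z ∈ Metric.ball (φ x) r, HasFDerivAt (χ ∘ u ∘ φ.symm)
        (0 : EuclideanSpace ℝ (Fin m) →L[ℝ] EuclideanSpace ℝ (Fin n)) z := by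
      intro z hz
      have h1 := (mdifferentiableAt_chartInv x (hball hz).1).hasMFDerivAt
      have h2 := (hu.mdifferentiable (by simp) (φ.symm z)).hasMFDerivAt
      rw [h] at h2
      have h3 := ((mdifferentiable_chart (I := 𝓡 n) (u x)).mdifferentiableAt
        (hball hz).2).hasMFDerivAt
      have h4 := h3.comp z (h2.comp z h1)
      have h5 := hasMFDerivAt_iff_hasFDerivAt.1 h4
      refine h5.congr_fderiv (ContinuousLinearMap.ext fun v ↦ ?_)
      exact map_zero (mfderiv (𝓡 n) (𝓡 n) χ (u (φ.symm z)))
    filter_upwards [φ.open_source.mem_nhds hx,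
      φ.continuousAt hx (Metric.ball_mem_nhds (φ x) hr)] with y hy hyb
    have h5 := (convex_ball (φ x) r).is_const_of_fderivWithin_eq_zero (𝕜 := ℝ)
      (fun z hz ↦ (hd z hz).differentiableAt.differentiableWithinAt)
      (fun z hz ↦ (hd z hz).hasFDerivWithinAt.fderivWithin
        (Metric.isOpen_ball.uniqueDiffWithinAt hz)) hyb (Metric.mem_ball_self hr)
    simp only [Function.comp_apply, φ.left_inv hx, φ.left_inv hy] at h5
    have h6 := (hball hyb).2
    rw [mem_preimage, mem_preimage, φ.left_inv hy] at h6
    exact χ.injOn h6 (mem_chart_source _ _) h5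
  obtain ⟨x₀⟩ := (inferInstance : Nonempty M)
  exact ⟨u x₀, fun x ↦ hloc.apply_eq_of_preconnectedSpace x x₀⟩

end Constant

end Phi3

end

theorem theorem7p1 {m n : ℕ}
    {M : Type*} [TopologicalSpace M] [T2Space M] [CompactSpace M] [ConnectedSpace M]
    [MeasurableSpace M] [BorelSpace M]
    [ChartedSpace (EuclideanSpace ℝ (Fin m)) M] [IsManifold (𝓡 m) ∞ M]
    [RiemannianBundle (fun x : M ↦ TangentSpace (𝓡 m) x)]
    [IsContMDiffRiemannianBundle (𝓡 m) ∞ (EuclideanSpace ℝ (Fin m))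
      (fun x : M ↦ TangentSpace (𝓡 m) x)]
    {N : Type*} [TopologicalSpace N] [T2Space N] [CompactSpace N]
    [ChartedSpace (EuclideanSpace ℝ (Fin n)) N] [IsManifold (𝓡 n) ∞ N]
    [RiemannianBundle (fun y : N ↦ TangentSpace (𝓡 n) y)]
    [IsContMDiffRiemannianBundle (𝓡 n) ∞ (EuclideanSpace ℝ (Fin n))
      (fun y : N ↦ TangentSpace (𝓡 n) y)]
    (hM : Phi3.IsPhi3SSU m M) (u : M → N) (hu : Phi3.IsStablePhi3Harmonic m n u) :
    ∃ c : N, ∀ x : M, u x = c :=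
  Phi3.exists_eq_const_of_mfderiv_eq_zero hu.1.1 (Phi3.mfderiv_eq_zero_of_stable hM hu)
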